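/- Let $G\subset SL_n(\mathbb C)$ be a finite subgroup, $V=\mathbb C^n$ the given representation, $V^\vee$ its dual, with $(g\cdot m)(v)=m(g^{-1}v)$, and $R=\mathbb C[V]$. Let $Y$ be a smooth separated scheme of finite type over $\mathbb C$, of dimension $n$, and let $\pi_Y,\pi_{\mathbb C^n}$ be the projections of $Y\times\mathbb C^n$, on which $G$ acts through the second factor. For a quasi-coherent $G$-equivariant sheaf $\mathcal F$ on $Y\times\mathbb C^n$ (for example a gnat-family) put $$\Psi_{\mathcal F}(E)=\bigl(\pi_{Y*}(\mathcal F\otimes^{L}\pi_{\mathbb C^n}^*E)\bigr)^G\in D(Y).$$ For a finite-dimensional representation $\rho$ of $G$ let $\mathcal O_0\otimes\rho$ be the $G$-sheaf on $\mathbb C^n$ on which $\mathcal O_{\mathbb C^n}$ acts through the structure sheaf $\mathcal O_0$ of the origin and $G$ acts through $\rho$. (1) $\Psi_{\mathcal F}(\mathcal O_0\otimes\rho)$ is isomorphic in $D(Y)$ to the $G$-invariant part of the complex $$\wedge^nV^\vee\otimes\pi_{Y*}\mathcal F\otimes\rho\xrightarrow{\delta_n}\cdots\xrightarrow{\delta_{k+1}}\wedge^kV^\vee\otimes\pi_{Y*}\mathcal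 F\otimes\rho\xrightarrow{\delta_k}\cdots\xrightarrow{\delta_1}\pi_{Y*}\mathcal F\otimes\rho$$ with the rightmost term in degree $0$ and $$\delta_k\bigl((m_1\wedge\dots\wedge m_k)\otimes s\otimes v\bigr)=\sum_{i=1}^k(-1)^i(\dots\wedge m_{i-1}\wedge m_{i+1}\wedge\cdots)\otimes(m_i\cdot s)\otimes v .$$ For the remaining parts let $G$ be abelian and $Y$ integral with a birational morphism $Y\to\mathbb C^n/G$ over $\mathbb C$, through which $K(Y)=K(\mathbb C^n)^G$. Fix a basis $x_1,\dots,x_n$ of $V^\vee$ of $G$-eigenvectors, let $\kappa(x_i)$ be the character by which $G$ acts on $x_i$, and for $e=x_{i_1}\wedge\dots\wedge x_{i_k}$ with $i_1<\dots<i_k$ put $\kappa(e)=\kappa(x_{i_1})\cdots\kappa(x_{i_k})$; let $I_k$ be the set of these $e$. A $G$-divisor $D$ on $Y$ is given by local equations in $K(\mathbb C^n)^*$ that are $G$-homogeneous, all of the same character, and $\mathcal L(D)\subset K(\mathbb C^n)$ is the corresponding sheaf of $\mathcal O_Y$-modules. Let $D_\chi$ ($\chi\in G^\vee$) be $G$-divisors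 such that $G$ acts on $\mathcal L(D_\chi)$ by $\chi$, hence on $\mathcal L(-D_\chi)$ by $\chi^{-1}$, let $\bigoplus_\chi\mathcal L(-D_\chi)$ be closed under multiplication by the $x_i$, and let $\mathcal F$ be a quasi-coherent $G$-sheaf on $Y\times\mathbb C^n$ with $\pi_{Y*}\mathcal F=\bigoplus_\chi\mathcal L(-D_\chi)$ as sheaves of $\mathcal O_Y\otimes(R\rtimes G)$-modules. Let $\chi$ be a character of $G$. (2) $\Psi_{\mathcal F}(\mathcal O_0\otimes\chi)$ is isomorphic in $D(Y)$ to the complex $$\bigoplus_{e\in I_n}\mathcal L(-D_{\kappa(e)\chi})\to\cdots\to\bigoplus_{e\in I_k}\mathcal L(-D_{\kappa(e)\chi})\to\cdots\to\mathcal L(-D_\chi)$$ of sums of line bundles, with the rightmost term in degree $0$, whose differential has as its component from the summand of $x_{i_1}\wedge\dots\wedge x_{i_k}$ to that of $\cdots x_{i_{j-1}}\wedge x_{i_{j+1}}\cdots$ the map $s\mapsto(-1)^jx_{i_j}s$, its other components being zero. In other words, it is the total complex of the skew-commutative cube obtained, with the signs $(-1)^j$, from the commutative cube of the line bundles $\mathcal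 L(-D_{\kappa(e)\chi})$ and the maps $s\mapsto x_is$. (3) Let $\tilde{\mathcal F}$ be the dual family: the quasi-coherent $G$-sheaf on $Y\times\mathbb C^n$ with $\pi_{Y*}\tilde{\mathcal F}=\mathcal Hom_Y(\pi_{Y*}\mathcal F,\mathcal O_Y)$, where $(g\cdot\alpha)(s)=\alpha(g^{-1}s)$ and $(f\cdot\alpha)(s)=\alpha(fs)$. Then $\Psi_{\tilde{\mathcal F}}(\mathcal O_0\otimes\chi)$ is isomorphic in $D(Y)$ to the complex of sums of line bundles with terms $\bigoplus_{e\in I_k}\mathcal L(D_{\kappa(e)^{-1}\chi^{-1}})$, the rightmost one, $\mathcal L(D_{\chi^{-1}})$, in degree $0$, and with the components $s\mapsto(-1)^jx_{i_j}s$ of the differential as in (2). (4) Let $n=3$. The McKay quiver of $G$ has the characters of $G$ as vertices and, for each vertex $\psi$ and each $k\in\{1,2,3\}$, an arrow $(\psi,k)$ from $\psi$ to $\kappa(x_k)\psi$. Its representation associated to $\mathcal F$ has $\mathcal L(-D_{\psi^{-1}})$ at the vertex $\psi$ and $s\mapsto x_ks$ at the arrow $(\psi,k)$. Its restriction to $\mathrm{hex}(\psi)$,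 the six triangles around the vertex $\psi$, is a commutative cube: at the subset $v\subseteq\{1,2,3\}$ stands the vertex $\kappa(v)^{-1}\psi$, where $\kappa(v)=\prod_{i\in v}\kappa(x_i)$, and at the edge $v\cup\{i\}\to v$ the $x_i$-arrow. Then $\mathrm{hex}(\chi^{-1})$ gives a cube of line bundles, and $\Psi_{\mathcal F}(\mathcal O_0\otimes\chi)$ is isomorphic in $D(Y)$ to the total complex of the skew-commutative cube obtained from it by multiplying the map that removes $i_j$ from $\{i_1<\dots<i_k\}$ by $(-1)^j$. -/

import Mathlib

open CategoryTheory AlgebraicGeometry Limits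

namespace McKayTransform
universe u
noncomputable section
variable {X : Scheme.{u}}

/-- Presheaf tensor product of two `O_X`-modules, `U ↦ M(U) ⊗_{O(U)} N(U)`. -/
def preTensor (M N : X.Modules) : X.PresheafOfModules :=
  PresheafOfModules.Monoidal.tensorObj (R := X.presheaf) M.val N.val

/-- The tensor product `M ⊗_{O_X} N`: sheafification of the presheaf tensor product. -/
def tensorObj (M N : X.Modules) : X.Modules :=
  (PresheafOfModules.sheafification (𝟙 X.ringCatSheaf.obj)).obj (preTensor M N)

/-- Universal property of the sheafification in `tensorObj`. -/
def tensorHomEquiv (M N K : X.Modules) : (tensorObj M N ⟶ K) ≃ (preTensor M N ⟶ (PresheafOfModules.restrictScalars (𝟙 X.ringCatSheaf.obj)).obj K.val) :=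
  PresheafOfModules.sheafificationHomEquiv (𝟙 X.ringCatSheaf.obj) (P := preTensor M N) (F := K)

/-- `O_X`-bilinear maps `M × N → K`, compatible with restriction. -/
structure Bilin (M N K : X.Modules) where
  f (U : X.Opens) : Γ(M,U) → Γ(N,U) → Γ(K,U)
  add_left : ∀ U m m' n, f U (m+m') n = f U m n + f U m' n
  add_right : ∀ U m n n', f U m (n+n') = f U m n + f U m n'
  smul_left : ∀ U (r : Γ(X,U)) m n, f U (r • m) n = r • f U m n
  smul_right : ∀ U (r : Γ(X,U)) m n, f U m (r • n) = r • f U m n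
  map : ∀ {U V : X.Opens} (i : V ⟶ U) m n, K.presheaf.map i.op (f U m n) = f V (M.presheaf.map i.op m) (N.presheaf.map i.op n)

open scoped TensorProduct

/-- The map on presheaf tensor products over `U` given by a bilinear map. -/
def Bilin.pre {M N K : X.Modules} (b : Bilin M N K) (U : X.Opens) :
    ModuleCat.of Γ(X,U) (TensorProduct Γ(X,U) Γ(M,U) Γ(N,U)) ⟶ ModuleCat.of Γ(X,U) Γ(K,U) :=
  ModuleCat.ofHom (TensorProduct.lift (LinearMap.mk₂ Γ(X,U) (b.f U) (b.add_left U) (b.smul_left U) (b.add_right U) (b.smul_right U)))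

/-- The morphism from the presheaf tensor product given by a bilinear map. -/
def Bilin.preHom {M N K : X.Modules} (b : Bilin M N K) : preTensor M N ⟶ (PresheafOfModules.restrictScalars (𝟙 X.ringCatSheaf.obj)).obj K.val where
  app U := b.pre U.unop
  naturality {U V} i := by
    apply ModuleCat.MonoidalCategory.tensor_ext (R := X.presheaf.obj U)
    intro m n
    exact (b.map i.unop m n).symm

/-- The morphism `M ⊗ N → K` given by a bilinear map. -/
def Bilin.lift {M N K : X.Modules} (b : Bilin M N K) : tensorObj M N ⟶ K :=
  (tensorHomEquiv M N K).symm b.preHom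

/-- The canonical map `M(U) ⊗ N(U) → (M ⊗ N)(U)`. -/
def toTensor (M N : X.Modules) (U : X.Opens) : TensorProduct Γ(X,U) Γ(M,U) Γ(N,U) →ₗ[Γ(X,U)] Γ(tensorObj M N, U) :=
  ModuleCat.Hom.hom (show ModuleCat.of Γ(X,U) (TensorProduct Γ(X,U) Γ(M,U) Γ(N,U)) ⟶ ModuleCat.of Γ(X,U) Γ(tensorObj M N, U) from (tensorHomEquiv M N _ (𝟙 _)).app (.op U))

/-- The section `m ⊗ n` of `M ⊗ N` over `U`. -/
def tmul {M N : X.Modules} (U : X.Opens) (m : Γ(M,U)) (n : Γ(N,U)) : Γ(tensorObj M N, U) :=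
  toTensor M N U (m ⊗ₜ n)

theorem app_tmul {M N K : X.Modules} (φ : tensorObj M N ⟶ K) (U : X.Opens) (m : Γ(M,U)) (n : Γ(N,U)) :
   φ.app U (tmul U m n) = ((tensorHomEquiv M N _ φ).app (.op U)).hom (TensorProduct.tmul Γ(X,U) m n : TensorProduct Γ(X,U) Γ(M,U) Γ(N,U)) := rfl

theorem lift_tmul {M N K : X.Modules} (b : Bilin M N K) (U : X.Opens) (m : Γ(M,U)) (n : Γ(N,U)) :
   b.lift.app U (tmul U m n) = b.f U m n := by
  rw [app_tmul, Bilin.lift, Equiv.apply_symm_apply]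
  rfl

theorem tensor_ext {M N K : X.Modules} {φ ψ : tensorObj M N ⟶ K} (h : ∀ U (m : Γ(M,U)) (n : Γ(N,U)), φ.app U (tmul U m n) = ψ.app U (tmul U m n)) : φ = ψ := by
  apply (tensorHomEquiv M N K).injective
  ext U : 1
  apply ModuleCat.MonoidalCategory.tensor_ext (R := X.presheaf.obj U)
  intro m n
  exact h U.unop m n

/-- The universal bilinear map `(m, n) ↦ m ⊗ n`. -/
def tmulBilin (M N : X.Modules) : Bilin M N (tensorObj M N) where
  f U := tmul U
  add_left U m m' n := by simp only [tmul, TensorProduct.add_tmul, map_add]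
  add_right U m m' n := by simp only [tmul, TensorProduct.tmul_add, map_add]
  smul_left U r m n := by simp only [tmul, ← TensorProduct.smul_tmul', map_smul]
  smul_right U r m n := by simp only [tmul, TensorProduct.tmul_smul, map_smul]
  map {U V} i m n := by
    have := ((tensorHomEquiv M N _ (𝟙 _)).naturality i.op)
    have := congr($(this) (TensorProduct.tmul Γ(X,U) m n : TensorProduct Γ(X,U) Γ(M,U) Γ(N,U)))
    exact this.symm

variable {X' : Scheme.{u}}
/-- Restriction of sections of an `O_X`-module. -/
def res (M : X.Modules) {U V : X.Opens} (h : V ≤ U) (s : Γ(M,U)) : Γ(M,V) := M.presheaf.map (homOfLE h).op s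

theorem res_self (M : X.Modules) {U : X.Opens} (h : U ≤ U) (s : Γ(M,U)) : res M h s = s := by
  have : (homOfLE h).op = 𝟙 (Opposite.op U) := rfl
  simp only [res, this, CategoryTheory.Functor.map_id]; rfl

theorem res_res (M : X.Modules) {U V W : X.Opens} (h : V ≤ U) (h' : W ≤ V) (s : Γ(M,U)) : res M h' (res M h s) = res M (h'.trans h) s := by
  have : (homOfLE (h'.trans h)).op = (homOfLE h).op ≫ (homOfLE h').op := rfl
  simp only [res, this, CategoryTheory.Functor.map_comp]; rfl

theorem app_res {M N : X.Modules} (φ : M ⟶ N) {U V : X.Opens} (h : V ≤ U) (s : Γ(M,U)) : φ.app V (res M h s) = res N h (φ.app U s) :=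
  congr($(φ.mapPresheaf.naturality (homOfLE h).op) s)

theorem pre_mono (f : X ⟶ X') {U V : X'.Opens} (h : V ≤ U) : f ⁻¹ᵁ V ≤ f ⁻¹ᵁ U := fun _ hx => h hx

theorem tmul_res {M N : X.Modules} {U V : X.Opens} (h : V ≤ U) (m : Γ(M,U)) (n : Γ(N,U)) :
    tmul V (res M h m) (res N h n) = res _ h (tmul U m n) :=
  ((tmulBilin M N).map (homOfLE h) m n).symm

/-- Pull-back `f^* s` of a section `s ∈ M(U)`, a section of `f^* M` over `f⁻¹ U`. -/
def pb (f : X ⟶ X') (M : X'.Modules) (U : X'.Opens) (s : Γ(M,U)) : Γ((Scheme.Modules.pullback f).obj M, f ⁻¹ᵁ U) :=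
  ((Scheme.Modules.pullbackPushforwardAdjunction f).unit.app M).app U s

theorem pb_res (f : X ⟶ X') (M : X'.Modules) {U V : X'.Opens} (h : V ≤ U) (s : Γ(M,U)) (h' : f ⁻¹ᵁ V ≤ f ⁻¹ᵁ U) :
    pb f M V (res M h s) = res _ h' (pb f M U s) := app_res _ h s

theorem pb_lift (f : X ⟶ X') {M : X'.Modules} {N : X.Modules} (φ : M ⟶ (Scheme.Modules.pushforward f).obj N) (U : X'.Opens) (s : Γ(M,U)) :
    Scheme.Modules.Hom.app (((Scheme.Modules.pullbackPushforwardAdjunction f).homEquiv M N).symm φ) (f ⁻¹ᵁ U) (pb f M U s) = φ.app U s := by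
  have := ((Scheme.Modules.pullbackPushforwardAdjunction f).homEquiv M N).apply_symm_apply φ
  rw [Adjunction.homEquiv_unit] at this
  exact congr(Scheme.Modules.Hom.app $this U s)

theorem pb_ext (f : X ⟶ X') {M : X'.Modules} {N : X.Modules} {φ ψ : (Scheme.Modules.pullback f).obj M ⟶ N}
    (h : ∀ U s, φ.app (f ⁻¹ᵁ U) (pb f M U s) = ψ.app (f ⁻¹ᵁ U) (pb f M U s)) : φ = ψ := by
  apply ((Scheme.Modules.pullbackPushforwardAdjunction f).homEquiv M N).injective
  rw [Adjunction.homEquiv_unit, Adjunction.homEquiv_unit]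
  ext U s
  exact h U s

attribute [irreducible] tmul pb tensorObj Bilin.lift

/-- An action of `G` on the scheme `X` through its pull-backs of functions: `t g` is the automorphism with
`(g • φ) = (t g)^* φ` for functions `φ`, i.e. `t g` is translation by `g⁻¹`. Hence `t (g h) = t h ∘ t g`. -/
structure GAct (G : Type) [Group G] (X : Scheme.{u}) where
  t : G → (X ⟶ X)
  t_one : t 1 = 𝟙 X
  t_mul (g h : G) : t (g * h) = t g ≫ t h

variable {G : Type} [Group G]

theorem GAct.one_le (a : GAct G X) (U : X.Opens) : a.t 1 ⁻¹ᵁ U ≤ U := by rw [a.t_one]; rfl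
theorem GAct.mul_le (a : GAct G X) (g h : G) (U : X.Opens) : a.t (g * h) ⁻¹ᵁ U ≤ a.t g ⁻¹ᵁ (a.t h ⁻¹ᵁ U) := by rw [a.t_mul]; rfl

/-- A morphism `M → f_* N` on sections, with target written as sections of `N` over `f⁻¹ U`. -/
def sapp {f : X ⟶ X'} {M : X'.Modules} {N : X.Modules} (φ : M ⟶ (Scheme.Modules.pushforward f).obj N) (U : X'.Opens) (m : Γ(M,U)) :
    Γ(N, f ⁻¹ᵁ U) := φ.app U m

/-- A `G`-equivariant sheaf of `O_X`-modules: `act g : M → (t g)_* M` is the action `s ↦ g • s` on sections. It is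
semilinear over the action of `g` on functions because it is a morphism of `O_X`-modules to the push-forward. -/
structure GSheaf (a : GAct G X) where
  M : X.Modules
  act (g : G) : M ⟶ (Scheme.Modules.pushforward (a.t g)).obj M
  act_one (U : X.Opens) (s : Γ(M,U)) : sapp (act 1) U s = res M (a.one_le U) s
  act_mul (g h : G) (U : X.Opens) (s : Γ(M,U)) :
    sapp (act (g * h)) U s = res M (a.mul_le g h U) (sapp (act g) _ (sapp (act h) U s))

namespace GSheaf
variable {a : GAct G X}
/-- The action of `g` on a section over `U`. -/
def s (E : GSheaf a) (g : G) (U : X.Opens) (m : Γ(E.M,U)) : Γ(E.M, a.t g ⁻¹ᵁ U) := sapp (E.act g) U m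

theorem s_res (E : GSheaf a) (g : G) {U V : X.Opens} (h : V ≤ U) (h' : a.t g ⁻¹ᵁ V ≤ a.t g ⁻¹ᵁ U) (m : Γ(E.M,U)) :
   E.s g V (res _ h m) = res _ h' (E.s g U m) := app_res _ h m

/-- `G`-equivariant morphisms of `O_X`-modules. -/
@[ext]
structure Hom (E F : GSheaf a) where
  hom : E.M ⟶ F.M
  equivariant (g : G) (U : X.Opens) (m : Γ(E.M,U)) : hom.app _ (E.s g U m) = F.s g U (hom.app U m)

instance : Category (GSheaf a) where
  Hom := Hom
  id E := ⟨𝟙 _, fun _ _ _ => rfl⟩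
  comp f g := ⟨f.hom ≫ g.hom, fun γ U m => by
    change g.hom.app _ (f.hom.app _ _) = _
    rw [f.equivariant, g.equivariant]; rfl⟩

@[ext] theorem hom_ext {E F : GSheaf a} {f g : E ⟶ F} (h : f.hom = g.hom) : f = g := Hom.ext h

instance : HasZeroMorphisms (GSheaf a) where
  zero E F := ⟨⟨0, fun g U m => by
    change _ = (F.act g).app U 0
    rw [map_zero]; rfl⟩⟩
  comp_zero f Z := by apply Hom.ext; exact comp_zero
  zero_comp f Z := by intros; apply Hom.ext; exact zero_comp

/-- The diagonal action `g (m ⊗ n) = g m ⊗ g n`. -/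
def tensorAct (F E : GSheaf a) (g : G) : tensorObj F.M E.M ⟶ (Scheme.Modules.pushforward (a.t g)).obj (tensorObj F.M E.M) :=
  Bilin.lift
  { f U m n := tmul (a.t g ⁻¹ᵁ U) (F.s g U m) (E.s g U n)
    add_left U m m' n := by
      rw [show F.s g U (m + m') = F.s g U m + F.s g U m' from map_add _ _ _]
      exact (tmulBilin _ _).add_left _ _ _ _
    add_right U m n n' := by
      rw [show E.s g U (n + n') = E.s g U n + E.s g U n' from map_add _ _ _]
      exact (tmulBilin _ _).add_right _ _ _ _
    smul_left U r m n := by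
      rw [show F.s g U (r • m) = (a.t g).app U r • F.s g U m from Scheme.Modules.Hom.app_smul (F.act g) r m]
      exact (tmulBilin _ _).smul_left _ _ _ _
    smul_right U r m n := by
      rw [show E.s g U (r • n) = (a.t g).app U r • E.s g U n from Scheme.Modules.Hom.app_smul (E.act g) r n]
      exact (tmulBilin _ _).smul_right _ _ _ _
    map {U V} i m n := by
      have h' : a.t g ⁻¹ᵁ V ≤ a.t g ⁻¹ᵁ U := fun x hx => leOfHom i hx
      have e1 : F.s g V (res _ (leOfHom i) m) = _ := s_res F g (leOfHom i) h' m
      have e2 : E.s g V (res _ (leOfHom i) n) = _ := s_res E g (leOfHom i) h' n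
      change _ = tmul (a.t g ⁻¹ᵁ V) (F.s g V (res _ (leOfHom i) m)) (E.s g V (res _ (leOfHom i) n))
      rw [e1, e2, tmul_res]; rfl }

theorem tensorAct_tmul (F E : GSheaf a) (g : G) (U : X.Opens) (m : Γ(F.M,U)) (n : Γ(E.M,U)) :
    sapp (tensorAct F E g) U (tmul U m n) = tmul (a.t g ⁻¹ᵁ U) (F.s g U m) (E.s g U n) := lift_tmul _ _ _ _


theorem s_add (E : GSheaf a) (g : G) (U : X.Opens) (m m' : Γ(E.M,U)) : E.s g U (m + m') = E.s g U m + E.s g U m' := map_add ((E.act g).app U).hom m m'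
theorem s_smul (E : GSheaf a) (g : G) (U : X.Opens) (r : Γ(X,U)) (m : Γ(E.M,U)) :
    E.s g U (r • m) = (a.t g).app U r • E.s g U m := Scheme.Modules.Hom.app_smul (E.act g) r m
theorem s_one (E : GSheaf a) (U : X.Opens) (m : Γ(E.M,U)) : E.s 1 U m = res _ (a.one_le U) m := E.act_one U m
theorem s_mul (E : GSheaf a) (g h : G) (U : X.Opens) (m : Γ(E.M,U)) :
    E.s (g * h) U m = res _ (a.mul_le g h U) (E.s g _ (E.s h U m)) := E.act_mul g h U m

/-- The identification `f_* M = f'_* M` for `f = f'`. -/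
def resHom (M : X.Modules) {f f' : X ⟶ X'} (h : f = f') : (Scheme.Modules.pushforward f).obj M ⟶ (Scheme.Modules.pushforward f').obj M :=
  (Scheme.Modules.pushforwardCongr h).hom.app M

theorem resHom_app (M : X.Modules) {f f' : X ⟶ X'} (h : f = f') (U : X'.Opens) (h' : f' ⁻¹ᵁ U ≤ f ⁻¹ᵁ U) (m : Γ(M, f ⁻¹ᵁ U)) :
  sapp (resHom M h) U m = res M h' m := rfl

/-- The identification `g_* f_* M = g'_* f'_* M` for `g ∘ f = g' ∘ f'`. -/
def swap {X₁ X₂ X₃ : Scheme.{u}} (M : X.Modules) (f : X ⟶ X₁) (g : X₁ ⟶ X₃) (f' : X ⟶ X₂) (g' : X₂ ⟶ X₃) (e : f ≫ g = f' ≫ g') :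
    (Scheme.Modules.pushforward g).obj ((Scheme.Modules.pushforward f).obj M) ⟶
      (Scheme.Modules.pushforward g').obj ((Scheme.Modules.pushforward f').obj M) :=
  (Scheme.Modules.pushforwardComp f g).hom.app M ≫ (Scheme.Modules.pushforwardCongr e).hom.app M ≫
    (Scheme.Modules.pushforwardComp f' g').inv.app M

theorem swap_app {X₁ X₂ X₃ : Scheme.{u}} (M : X.Modules) (f : X ⟶ X₁) (g : X₁ ⟶ X₃) (f' : X ⟶ X₂) (g' : X₂ ⟶ X₃) (e : f ≫ g = f' ≫ g')
   (U : X₃.Opens) (h : f' ⁻¹ᵁ (g' ⁻¹ᵁ U) ≤ f ⁻¹ᵁ (g ⁻¹ᵁ U)) (m : Γ(M, f ⁻¹ᵁ (g ⁻¹ᵁ U))) :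
  (swap M f g f' g' e).app U m = res M h m := rfl

/-- The tensor product of `G`-sheaves, with diagonal action. -/
def tensor (F E : GSheaf a) : GSheaf a where
  M := tensorObj F.M E.M
  act g := tensorAct F E g
  act_one := by
    suffices h : tensorAct F E 1 = (Scheme.Modules.pushforwardId X).inv.app _ ≫ resHom _ a.t_one.symm by
      intro U s; rw [h]; rfl
    apply tensor_ext
    intro U m n
    change sapp (tensorAct F E 1) U (tmul U m n) = res _ (a.one_le U) (tmul U m n)
    rw [tensorAct_tmul, s_one, s_one, tmul_res]
  act_mul g h := by
    suffices h : tensorAct F E (g * h) = tensorAct F E h ≫ (Scheme.Modules.pushforward (a.t h)).map (tensorAct F E g) ≫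
       (Scheme.Modules.pushforwardComp _ _).hom.app _ ≫ resHom _ (a.t_mul g h).symm by
      intro U s; rw [h]; rfl
    apply tensor_ext
    intro U m n
    change sapp (tensorAct F E (g * h)) U (tmul U m n) = res _ (a.mul_le g h U) (sapp (tensorAct F E g) _ (sapp (tensorAct F E h) U (tmul U m n)))
    rw [tensorAct_tmul, s_mul, s_mul, tmul_res, tensorAct_tmul, tensorAct_tmul]

theorem tensor_s (F E : GSheaf a) (g : G) (U : X.Opens) (m : Γ(F.M,U)) (n : Γ(E.M,U)) :
    (tensor F E).s g U (tmul U m n) = tmul (a.t g ⁻¹ᵁ U) (F.s g U m) (E.s g U n) := tensorAct_tmul _ _ _ _ _ _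

/-- The bilinear map `(m, n) ↦ m ⊗ φ n`. -/
def tensorMapBilin (F : X.Modules) {M N : X.Modules} (φ : M ⟶ N) : Bilin F M (tensorObj F N) where
  f U m n := tmul U m (φ.app U n)
  add_left U m m' n := (tmulBilin _ _).add_left _ _ _ _
  add_right U m n n' := by rw [map_add]; exact (tmulBilin _ _).add_right _ _ _ _
  smul_left U r m n := (tmulBilin _ _).smul_left _ _ _ _
  smul_right U r m n := by rw [Scheme.Modules.Hom.app_smul]; exact (tmulBilin _ _).smul_right _ _ _ _
  map {U V} i m n := by
    have e : φ.app V (res _ (leOfHom i) n) = _ := app_res φ (leOfHom i) n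
    change _ = tmul V (res _ (leOfHom i) m) (φ.app V (res _ (leOfHom i) n))
    rw [e, tmul_res]; rfl

/-- The functor `F ⊗ -` on `G`-sheaves. -/
def tensorLeft (F : GSheaf a) : GSheaf a ⥤ GSheaf a where
  obj E := tensor F E
  map {E E'} φ :=
   { hom := (tensorMapBilin F.M φ.hom).lift
     equivariant g U := by
      suffices h : (tensorAct F E g) ≫ (Scheme.Modules.pushforward (a.t g)).map (tensorMapBilin F.M φ.hom).lift =
          (tensorMapBilin F.M φ.hom).lift ≫ tensorAct F E' g from fun m => congr(Scheme.Modules.Hom.app $h U m)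
      apply tensor_ext
      intro U m n
      change Scheme.Modules.Hom.app (tensorMapBilin F.M φ.hom).lift _ (sapp (tensorAct F E g) U (tmul U m n)) = sapp (tensorAct F E' g) U (Scheme.Modules.Hom.app (tensorMapBilin F.M φ.hom).lift _ (tmul U m n))
      rw [tensorAct_tmul, lift_tmul, lift_tmul]
      refine Eq.trans ?_ (tensorAct_tmul F E' g U _ _).symm
      change tmul _ _ _ = _
      rw [φ.equivariant] }
  map_id E := by
    apply Hom.ext
    apply tensor_ext
    intro U m n
    refine (lift_tmul _ _ _ _).trans ?_
    change tmul U m n = tmul U m n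
    rfl
  map_comp f g := by
    apply Hom.ext
    apply tensor_ext
    intro U m n
    refine (lift_tmul _ _ _ _).trans ?_
    symm
    change Scheme.Modules.Hom.app (Bilin.lift _) _ (Scheme.Modules.Hom.app (Bilin.lift _) _ _) = _
    rw [lift_tmul]
    refine (lift_tmul _ _ _ _).trans ?_
    change tmul U m (g.hom.app U (f.hom.app U n)) = tmul U m (g.hom.app U (f.hom.app U n))
    rfl

variable {a' : GAct G X'}
/-- `G`-equivariant morphisms of schemes. -/
structure EquivHom (a : GAct G X) (a' : GAct G X') where
  f : X ⟶ X'
  comm (g : G) : a.t g ≫ f = f ≫ a'.t g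

theorem EquivHom.le (f : EquivHom a a') (g : G) (U : X'.Opens) : f.f ⁻¹ᵁ (a'.t g ⁻¹ᵁ U) ≤ a.t g ⁻¹ᵁ (f.f ⁻¹ᵁ U) := by
  change (f.f ≫ a'.t g) ⁻¹ᵁ U ≤ (a.t g ≫ f.f) ⁻¹ᵁ U
  rw [f.comm]
theorem EquivHom.le' (f : EquivHom a a') (g : G) (U : X'.Opens) : a.t g ⁻¹ᵁ (f.f ⁻¹ᵁ U) ≤ f.f ⁻¹ᵁ (a'.t g ⁻¹ᵁ U) := by
  change (a.t g ≫ f.f) ⁻¹ᵁ U ≤ (f.f ≫ a'.t g) ⁻¹ᵁ U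
  rw [f.comm]

/-- The action of `g` on `f^* E`, characterised by `g (f^* m) = f^* (g m)`. -/
def pullAct (f : EquivHom a a') (E : GSheaf a') (g : G) :
   (Scheme.Modules.pullback f.f).obj E.M ⟶ (Scheme.Modules.pushforward (a.t g)).obj ((Scheme.Modules.pullback f.f).obj E.M) :=
  ((Scheme.Modules.pullbackPushforwardAdjunction f.f).homEquiv _ _).symm
   (E.act g ≫ (Scheme.Modules.pushforward (a'.t g)).map ((Scheme.Modules.pullbackPushforwardAdjunction f.f).unit.app E.M) ≫
     swap _ f.f (a'.t g) _ _ (f.comm g).symm)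

theorem pullAct_pb (f : EquivHom a a') (E : GSheaf a') (g : G) (U : X'.Opens) (m : Γ(E.M,U)) :
   sapp (pullAct f E g) (f.f ⁻¹ᵁ U) (pb f.f E.M U m) = res _ (f.le' g U) (pb f.f E.M _ (E.s g U m)) := by
  refine (pb_lift f.f _ U m).trans ?_
  rw [pb]
  rfl


/-- The push-forward `f_* E` of a `G`-sheaf along an equivariant morphism. -/
def pushObj (f : EquivHom a a') (E : GSheaf a) : GSheaf a' where
  M := (Scheme.Modules.pushforward f.f).obj E.M
  act g := (Scheme.Modules.pushforward f.f).map (E.act g) ≫ swap E.M _ _ _ _ (f.comm g)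
  act_one U m := by
    suffices h : ∀ m : Γ(E.M, f.f ⁻¹ᵁ U), res E.M (f.le 1 U) (E.s 1 (f.f ⁻¹ᵁ U) m) = res E.M (U := f.f ⁻¹ᵁ U) (V := f.f ⁻¹ᵁ (a'.t 1 ⁻¹ᵁ U)) ((f.le 1 U).trans (a.one_le _)) m from h m
    intro m
    rw [s_one, res_res]
  act_mul g h U m := by
    suffices h : ∀ m : Γ(E.M, f.f ⁻¹ᵁ U), res E.M (f.le (g * h) U) (E.s (g * h) (f.f ⁻¹ᵁ U) m) = res E.M (U := f.f ⁻¹ᵁ (a'.t g ⁻¹ᵁ (a'.t h ⁻¹ᵁ U))) (V := f.f ⁻¹ᵁ (a'.t (g * h) ⁻¹ᵁ U))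
      (pre_mono _ (a'.mul_le g h U)) (res E.M (f.le g _) (E.s g _ (res E.M (f.le h _) (E.s h (f.f ⁻¹ᵁ U) m)))) from h m
    intro m
    have := s_res E g (f.le h U) (pre_mono _ (f.le h U)) (E.s h (f.f ⁻¹ᵁ U) m)
    rw [this, s_mul, res_res, res_res, res_res]

theorem push_s (f : EquivHom a a') (E : GSheaf a) (g : G) (U : X'.Opens) (m : Γ(E.M, f.f ⁻¹ᵁ U)) :
  (pushObj f E).s g U m = res E.M (f.le g U) (E.s g (f.f ⁻¹ᵁ U) m) := rfl

/-- The functor `f_*` on `G`-sheaves. -/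
def push (f : EquivHom a a') : GSheaf a ⥤ GSheaf a' where
  obj := pushObj f
  map {E E'} φ :=
   { hom := (Scheme.Modules.pushforward f.f).map φ.hom
     equivariant g U m := by
      suffices h : ∀ m : Γ(E.M, f.f ⁻¹ᵁ U), φ.hom.app _ (res _ (f.le g U) (E.s g (f.f ⁻¹ᵁ U) m)) = res _ (f.le g U) (E'.s g (f.f ⁻¹ᵁ U) (φ.hom.app (f.f ⁻¹ᵁ U) m)) from h m
      intro m
      rw [app_res, φ.equivariant] }
  map_id E := Hom.ext ((Scheme.Modules.pushforward f.f).map_id _)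
  map_comp φ ψ := Hom.ext ((Scheme.Modules.pushforward f.f).map_comp φ.hom ψ.hom)

/-- The pull-back `f^* E` of a `G`-sheaf along an equivariant morphism. -/
def pullObj (f : EquivHom a a') (E : GSheaf a') : GSheaf a where
  M := (Scheme.Modules.pullback f.f).obj E.M
  act g := pullAct f E g
  act_one := by
    suffices h : pullAct f E 1 = (Scheme.Modules.pushforwardId X).inv.app _ ≫ resHom _ a.t_one.symm by
      intro U s; rw [h]; rfl
    apply pb_ext
    intro U m
    change sapp (pullAct f E 1) (f.f ⁻¹ᵁ U) (pb f.f E.M U m) = res _ (a.one_le _) (pb f.f E.M U m)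
    rw [pullAct_pb, s_one, pb_res, res_res]
    exact ((f.le 1 U).trans (a.one_le _))
  act_mul g h := by
    suffices h : pullAct f E (g * h) = pullAct f E h ≫ (Scheme.Modules.pushforward (a.t h)).map (pullAct f E g) ≫
       (Scheme.Modules.pushforwardComp _ _).hom.app _ ≫ resHom _ (a.t_mul g h).symm by
      intro U s; rw [h]; rfl
    apply pb_ext
    intro U m
    change sapp (pullAct f E (g * h)) (f.f ⁻¹ᵁ U) (pb f.f E.M U m) =
       res _ (a.mul_le g h _) (sapp (pullAct f E g) _ (sapp (pullAct f E h) (f.f ⁻¹ᵁ U) (pb f.f E.M U m)))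
    have := app_res (pullAct f E g) (f.le' h U) (pb f.f E.M _ (E.s h U m))
    change sapp (pullAct f E g) _ (res _ (f.le' h U) _) = res _ (pre_mono _ (f.le' h U)) (sapp (pullAct f E g) _ _) at this
    rw [pullAct_pb, pullAct_pb, this, pullAct_pb, s_mul, pb_res f.f E.M (a'.mul_le g h U) _ (pre_mono _ (a'.mul_le g h U)), res_res, res_res, res_res]

/-- The functor `f^*` on `G`-sheaves. -/
def pull (f : EquivHom a a') : GSheaf a' ⥤ GSheaf a where
  obj := pullObj f
  map {E E'} φ :=
   { hom := (Scheme.Modules.pullback f.f).map φ.hom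
     equivariant g := by
      suffices h : (pullAct f E g) ≫ (Scheme.Modules.pushforward (a.t g)).map ((Scheme.Modules.pullback f.f).map φ.hom) =
          (Scheme.Modules.pullback f.f).map φ.hom ≫ pullAct f E' g from fun U m => congr(Scheme.Modules.Hom.app $h U m)
      apply pb_ext
      intro U m
      have nat (V) (k : Γ(E.M, V)): Scheme.Modules.Hom.app ((Scheme.Modules.pullback f.f).map φ.hom) (f.f ⁻¹ᵁ V) (pb f.f E.M V k) = pb f.f E'.M V (φ.hom.app V k) := by
        have := (Scheme.Modules.pullbackPushforwardAdjunction f.f).unit.naturality φ.hom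
        have := congr(Scheme.Modules.Hom.app $this V k)
        rw [pb, pb]
        exact this.symm
      change Scheme.Modules.Hom.app ((Scheme.Modules.pullback f.f).map φ.hom) _ (sapp (pullAct f E g) (f.f ⁻¹ᵁ U) (pb f.f E.M U m)) =
        sapp (pullAct f E' g) (f.f ⁻¹ᵁ U) (Scheme.Modules.Hom.app ((Scheme.Modules.pullback f.f).map φ.hom) _ (pb f.f E.M U m))
      rw [nat, pullAct_pb, pullAct_pb, app_res, nat, φ.equivariant] }
  map_id E := Hom.ext ((Scheme.Modules.pullback f.f).map_id _)
  map_comp φ ψ := Hom.ext ((Scheme.Modules.pullback f.f).map_comp φ.hom ψ.hom)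


end GSheaf
end
end McKayTransform

namespace McKayTransform
noncomputable section
open GSheaf
variable {G : Type} [Group G]

/-- The trivial action of `G` on `Y`. -/
def GAct.triv (G : Type) [Group G] (Y : Scheme.{0}) : GAct G Y where
  t _ := 𝟙 Y
  t_one := rfl
  t_mul _ _ := (Category.id_comp _).symm

variable {Y : Scheme.{0}}
/-- For the trivial action on `Y`, each `g` acts on a `G`-sheaf by an `O_Y`-linear automorphism. -/
def GSheaf.op (E : GSheaf (GAct.triv G Y)) (g : G) : E.M ⟶ E.M :=
  E.act g ≫ (Scheme.Modules.pushforwardId Y).hom.app E.M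

theorem GSheaf.op_app (E : GSheaf (GAct.triv G Y)) (g : G) (U : Y.Opens) (m : Γ(E.M, U)) : (E.op g).app U m = E.s g U m := rfl

theorem GSheaf.op_comm {E E' : GSheaf (GAct.triv G Y)} (φ : E ⟶ E') (g : G) : E.op g ≫ φ.hom = φ.hom ≫ E'.op g := by
  ext U m
  exact φ.equivariant g U m

/-- The functor of `G`-invariants `E ↦ E^G` for the trivial action on `Y`: the sections `s` with `g s = s` for all `g`. -/
def invariants : GSheaf (GAct.triv G Y) ⥤ Y.Modules where
  obj E := kernel (Pi.lift fun g : G => E.op g - 𝟙 E.M)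
  map {E E'} φ := kernel.map _ _ φ.hom (Limits.Pi.map fun _ => φ.hom) (by
    refine Pi.hom_ext _ _ fun g => ?_
    simp [GSheaf.op_comm, Preadditive.sub_comp, Preadditive.comp_sub])
  map_id E := by
    rw [← cancel_mono (kernel.ι _)]
    simp; rfl
  map_comp f g := by
    rw [← cancel_mono (kernel.ι _)]
    simp; rfl

section tilde
variable {R : CommRingCat.{0}}

/-- The global section of `M~` defined by `m ∈ M`. -/
def td (M : ModuleCat R) (m : M) : Γ(tilde M, ⊤) := (tilde.toOpen M ⊤).hom m

/-- `R`-linear maps `M → Γ(Spec R, N)`. -/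
structure Td (M : ModuleCat R) (N : (Spec R).Modules) where
  f : M → Γ(N, ⊤)
  add : ∀ m m', f (m + m') = f m + f m'
  smul : ∀ (r : R) m, f (r • m) = (Scheme.ΓSpecIso R).inv r • f m

/-- The morphism `M~ → N` defined by an `R`-linear map `M → Γ(Spec R, N)`. -/
def tdLift {M : ModuleCat R} {N : (Spec R).Modules} (b : Td M N) : tilde M ⟶ N :=
  (tilde.adjunction.homEquiv M N).symm (ModuleCat.ofHom (Y := moduleSpecΓFunctor.obj N) { toFun := b.f, map_add' := b.add, map_smul' := b.smul })

theorem tdLift_td {M : ModuleCat R} {N : (Spec R).Modules} (b : Td M N) (m : M) : (tdLift b).app ⊤ (td M m) = b.f m := by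
  have := (tilde.adjunction.homEquiv M N).apply_symm_apply (ModuleCat.ofHom (Y := moduleSpecΓFunctor.obj N) { toFun := b.f, map_add' := b.add, map_smul' := b.smul })
  rw [Adjunction.homEquiv_unit] at this
  exact congr($this m)

theorem td_ext {M : ModuleCat R} {N : (Spec R).Modules} {φ ψ : tilde M ⟶ N} (h : ∀ m, φ.app ⊤ (td M m) = ψ.app ⊤ (td M m)) : φ = ψ := by
  suffices H : ∀ φ ψ : (tilde.functor R).obj M ⟶ N, (∀ m, Scheme.Modules.Hom.app φ ⊤ (td M m) = Scheme.Modules.Hom.app ψ ⊤ (td M m)) → φ = ψ from H φ ψ h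
  intro φ ψ h
  apply (tilde.adjunction.homEquiv M N).injective
  rw [Adjunction.homEquiv_unit, Adjunction.homEquiv_unit]
  ext m
  exact h m

theorem td_add (M : ModuleCat R) (m m' : M) : td M (m + m') = td M m + td M m' := map_add (tilde.toOpen M ⊤).hom m m'
theorem td_smul (M : ModuleCat R) (r : R) (m : M) : td M (r • m) = (Scheme.ΓSpecIso R).inv r • td M m := map_smul (tilde.toOpen M ⊤).hom r m
theorem td_map {M N : ModuleCat R} (φ : M ⟶ N) (m : M) : Scheme.Modules.Hom.app (tilde.map φ) ⊤ (td M m) = td N (φ m) :=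
  congr($(tilde.toOpen_map_app φ ⊤) m)

/-- A sheaf `N` on `Spec R` with the universal property of `M~`. It is only used for `M~` itself (see `tl`); it is a device
to keep the elaboration of the constructions below cheap. -/
structure LMod (M : ModuleCat R) where
  N : (Spec R).Modules
  d : M → Γ(N, ⊤)
  d_add (m m' : M) : d (m + m') = d m + d m'
  d_smul (r : R) (m : M) : d (r • m) = (Scheme.ΓSpecIso R).inv r • d m
  lift {N' : (Spec R).Modules} (b : Td M N') : N ⟶ N'
  lift_d {N' : (Spec R).Modules} (b : Td M N') (m : M) : (lift b).app ⊤ (d m) = b.f m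
  ext {N' : (Spec R).Modules} {φ ψ : N ⟶ N'} (h : ∀ m, φ.app ⊤ (d m) = ψ.app ⊤ (d m)) : φ = ψ

/-- The sheaf `M~` with its universal property. -/
def tl (M : ModuleCat R) : LMod M := ⟨tilde M, td M, td_add M, td_smul M, tdLift, tdLift_td, td_ext⟩
end tilde

/-- Constructor for `G`-sheaves from identities of morphisms. -/
def GSheaf.mk' {X : Scheme.{0}} {a : GAct G X} (M : X.Modules) (act : (g : G) → M ⟶ (Scheme.Modules.pushforward (a.t g)).obj M)
   (h1 : act 1 = (Scheme.Modules.pushforwardId X).inv.app M ≫ resHom M a.t_one.symm)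
   (h2 : ∀ g h, act (g * h) = act h ≫ (Scheme.Modules.pushforward (a.t h)).map (act g) ≫
       (Scheme.Modules.pushforwardComp _ _).hom.app M ≫ resHom M (a.t_mul g h).symm) : GSheaf a where
  M := M
  act := act
  act_one := by intro U s; rw [h1]; rfl
  act_mul g h := by intro U s; rw [h2]; rfl

section affine
variable {A : Type} [CommRing A] [MulSemiringAction G A]

/-- The action of `g` on the ring `A` as a ring homomorphism. -/
def actHom (A : Type) [CommRing A] [MulSemiringAction G A] (g : G) : CommRingCat.of A ⟶ CommRingCat.of A := CommRingCat.ofHom (MulSemiringAction.toRingHom G A g)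

/-- The action of `G` on `Spec A` induced by an action on `A`. -/
def specAct (G : Type) [Group G] (A : Type) [CommRing A] [MulSemiringAction G A] : GAct G (Spec (CommRingCat.of A)) where
  t g := Spec.map (actHom A g)
  t_one := by
    have : actHom A (1 : G) = 𝟙 _ := by ext x; exact one_smul G x
    rw [this, Spec.map_id]
  t_mul g h := by
    rw [← Spec.map_comp]
    congr 1
    ext x
    exact mul_smul g h x

/-- The inclusion of `A` in the skew group algebra `A ⋊ G`. -/
def skewIncl (G : Type) [Group G] (A : Type) [CommRing A] [MulSemiringAction G A] : A →+* SkewMonoidAlgebra A G where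
  toFun r := SkewMonoidAlgebra.single 1 r
  map_one' := rfl
  map_mul' r s := by simp [SkewMonoidAlgebra.single_mul_single]
  map_zero' := by simp
  map_add' r s := by simp

theorem skew_comm (g : G) (r : A) : SkewMonoidAlgebra.single g (1 : A) * skewIncl G A r = skewIncl G A (g • r) * SkewMonoidAlgebra.single g (1 : A) := by
  simp [skewIncl, SkewMonoidAlgebra.single_mul_single]

/-- Restriction of scalars from `A ⋊ G` to `A`. -/
abbrev underF (G : Type) [Group G] (A : Type) [CommRing A] [MulSemiringAction G A] : ModuleCat.{0} (SkewMonoidAlgebra A G) ⥤ ModuleCat.{0} (CommRingCat.of A) :=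
  ModuleCat.restrictScalars (skewIncl G A)
/-- The underlying quasi-coherent sheaf of an `A ⋊ G`-module. -/
abbrev tildeF (G : Type) [Group G] (A : Type) [CommRing A] [MulSemiringAction G A] : ModuleCat.{0} (SkewMonoidAlgebra A G) ⥤ (Spec (CommRingCat.of A)).Modules :=
  underF G A ⋙ tilde.functor (CommRingCat.of A)

variable (M : ModuleCat.{0} (SkewMonoidAlgebra A G))
/-- The underlying `A`-module of an `A ⋊ G`-module. -/
abbrev under : ModuleCat (CommRingCat.of A) := (ModuleCat.restrictScalars (skewIncl G A)).obj M

/-- The action of `g` on an `A ⋊ G`-module. -/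
def gm (M : ModuleCat.{0} (SkewMonoidAlgebra A G)) (g : G) (m : under M) : under M := (show M from (SkewMonoidAlgebra.single g (1 : A)) • (show M from m))

theorem gm_add (g : G) (m m' : under M) : gm M g (m + m') = gm M g m + gm M g m' := smul_add (SkewMonoidAlgebra.single g (1 : A)) (show M from m) (show M from m')
theorem gm_smul (g : G) (r : A) (m : under M) : gm M g (r • m) = (g • r) • gm M g m := by
  change (SkewMonoidAlgebra.single g (1 : A)) • (skewIncl G A r • (show M from m)) = skewIncl G A (g • r) • ((SkewMonoidAlgebra.single g (1 : A)) • (show M from m))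
  rw [smul_smul, skew_comm, mul_smul]
theorem gm_one (m : under M) : gm M 1 m = m := one_smul (SkewMonoidAlgebra A G) (show M from m)
theorem gm_mul (g h : G) (m : under M) : gm M (g * h) m = gm M g (gm M h m) := by
  change (SkewMonoidAlgebra.single (g * h) (1 : A)) • (show M from m) = (SkewMonoidAlgebra.single g (1 : A)) • ((SkewMonoidAlgebra.single h (1 : A)) • (show M from m))
  rw [smul_smul, SkewMonoidAlgebra.single_mul_single]; simp


variable {M} (t : LMod (under M))
/-- The action of `g` on `M~`, characterised by `g · m~ = (g m)~` on global sections. -/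
def tildeAct (g : G) : t.N ⟶ (Scheme.Modules.pushforward ((specAct G A).t g)).obj t.N :=
  t.lift
  { f m := t.d (gm M g m)
    add m m' := by rw [gm_add, t.d_add]; rfl
    smul r m := by
      rw [gm_smul, t.d_smul]
      have := congr($(Scheme.ΓSpecIso_inv_naturality (actHom A g)) r)
      generalize t.d (gm M g m) = x
      exact congr($this • x) }

theorem tildeAct_td (g : G) (m : under M) : sapp (tildeAct t g) ⊤ (t.d m) = res _ le_top (t.d (gm M g m)) := by
  refine (t.lift_d _ m).trans ?_
  exact (res_self _ le_rfl (t.d (gm M g m))).symm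

/-- The `G`-sheaf `M~` on `Spec A` of an `A ⋊ G`-module `M`. -/
def tildeObj : GSheaf (specAct G A) := GSheaf.mk' t.N (tildeAct t)
  (by
    apply t.ext
    intro m
    change sapp (tildeAct t 1) ⊤ (t.d m) = res _ ((specAct G A).one_le _) (t.d m)
    rw [tildeAct_td, gm_one])
  (fun g h => by
    apply t.ext
    intro m
    change sapp (tildeAct t (g * h)) ⊤ (t.d m) = res _ ((specAct G A).mul_le g h _) (sapp (tildeAct t g) _ (sapp (tildeAct t h) ⊤ (t.d m)))
    have := app_res (tildeAct t g) (le_top : (specAct G A).t h ⁻¹ᵁ ⊤ ≤ ⊤) (t.d (gm M h m))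
    change sapp (tildeAct t g) _ (res _ _ _) = res _ (pre_mono _ le_top) (sapp (tildeAct t g) ⊤ (t.d (gm M h m))) at this
    rw [tildeAct_td, tildeAct_td, this, tildeAct_td, gm_mul, res_res, res_res])

variable {N : ModuleCat.{0} (SkewMonoidAlgebra A G)} (t' : LMod (under N))

/-- A morphism of `A ⋊ G`-modules on elements. -/
def uap (φ : M ⟶ N) (m : under M) : under N := φ.hom (show M from m)
theorem uap_gm (φ : M ⟶ N) (g : G) (m : under M) : uap φ (gm M g m) = gm N g (uap φ m) :=
  map_smul φ.hom (SkewMonoidAlgebra.single g (1 : A)) (show M from m)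

/-- The morphism `M~ → N~` given by a morphism of modules. -/
def tildeHom (φ : M ⟶ N) : t.N ⟶ t'.N := t.lift
  { f m := t'.d (uap φ m)
    add m m' := by
      have : φ.hom (m + m') = φ.hom m + φ.hom m' := map_add φ.hom m m'
      exact (congrArg t'.d this).trans (t'.d_add _ _)
    smul r m := by
      have : φ.hom (skewIncl G A r • (show M from m)) = skewIncl G A r • φ.hom m := map_smul φ.hom (skewIncl G A r) (show M from m)
      exact (congrArg t'.d this).trans (t'.d_smul _ _) }

theorem tildeHom_d (φ : M ⟶ N) (m : under M) : (tildeHom t t' φ).app ⊤ (t.d m) = t'.d (uap φ m) := t.lift_d _ _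

/-- The equivariant morphism `M~ → N~` given by a morphism of `A ⋊ G`-modules. -/
def tildeMap (φ : M ⟶ N) : tildeObj t ⟶ tildeObj t' where
  hom := tildeHom t t' φ
  equivariant g := by
    suffices h : (tildeAct t g) ≫ (Scheme.Modules.pushforward ((specAct G A).t g)).map (tildeHom t t' φ) =
          tildeHom t t' φ ≫ tildeAct t' g from fun U m => congr(Scheme.Modules.Hom.app $h U m)
    apply t.ext
    intro m
    change Scheme.Modules.Hom.app (tildeHom t t' φ) _ (sapp (tildeAct t g) ⊤ (t.d m)) =
        sapp (tildeAct t' g) ⊤ (Scheme.Modules.Hom.app (tildeHom t t' φ) ⊤ (t.d m))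
    rw [tildeAct_td, app_res, tildeHom_d, tildeHom_d, tildeAct_td, uap_gm]

theorem tildeMap_id : tildeMap t t (𝟙 M) = 𝟙 _ := by
  apply Hom.ext
  apply t.ext
  intro m
  exact t.lift_d _ m

theorem tildeMap_zero : tildeMap t t' 0 = 0 := by
  apply Hom.ext
  apply t.ext
  intro m
  refine (t.lift_d _ m).trans ?_
  have := t'.d_smul 0 0
  rw [zero_smul, map_zero, zero_smul] at this
  exact this

theorem tildeMap_comp {K : ModuleCat.{0} (SkewMonoidAlgebra A G)} (t'' : LMod (under K)) (φ : M ⟶ N) (ψ : N ⟶ K) :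
    tildeMap t t'' (φ ≫ ψ) = tildeMap t t' φ ≫ tildeMap t' t'' ψ := by
  apply Hom.ext
  apply t.ext
  intro m
  refine (t.lift_d _ m).trans ?_
  refine ((congrArg (Scheme.Modules.Hom.app (tildeHom t' t'' ψ) ⊤) (tildeHom_d t t' φ m)).trans ?_).symm
  exact tildeHom_d t' t'' ψ _

/-- The functor `M ↦ M~` from `A ⋊ G`-modules to `G`-sheaves on `Spec A` (an equivalence onto quasi-coherent `G`-sheaves). -/
def tildeG (G : Type) [Group G] (A : Type) [CommRing A] [MulSemiringAction G A] : ModuleCat.{0} (SkewMonoidAlgebra A G) ⥤ GSheaf (specAct G A) where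
  obj M := tildeObj (tl (under M))
  map φ := tildeMap _ _ φ
  map_id _ := tildeMap_id _
  map_comp φ ψ := tildeMap_comp _ _ _ φ ψ

instance : (tildeG G A).PreservesZeroMorphisms where
  map_zero _ _ := tildeMap_zero _ _

end affine

instance : (invariants (G := G) (Y := Y)).PreservesZeroMorphisms where
  map_zero M N := by
    refine (cancel_mono (kernel.ι (Pi.lift fun g : G => N.op g - 𝟙 N.M))).1 ?_
    refine (kernel.lift_ι _ _ _).trans ?_
    exact comp_zero.trans zero_comp.symm

section
variable {X X' : Scheme.{0}} {a : GAct G X} {a' : GAct G X'}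
instance (f : EquivHom a a') : (push f).PreservesZeroMorphisms where
  map_zero M N := Hom.ext ((Scheme.Modules.pushforward f.f).map_zero M.M N.M)
instance (f : EquivHom a a') : (pull f).PreservesZeroMorphisms where
  map_zero M N := Hom.ext ((Scheme.Modules.pullback f.f).map_zero M.M N.M)
instance (F : GSheaf a) : (tensorLeft F).PreservesZeroMorphisms where
  map_zero M N := by
    apply Hom.ext
    apply tensor_ext
    intro U m n
    refine (lift_tmul _ _ _ _).trans ?_
    change tmul U m 0 = 0
    have := (tmulBilin F.M N.M).smul_right U 0 m 0
    rw [zero_smul, zero_smul] at this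
    exact this
end
end
end McKayTransform

namespace McKayTransform
noncomputable section
open GSheaf

/-- The coordinate ring `R = ℂ[x_1, …, x_n]` of `ℂ^n`. -/
abbrev Poly (n : ℕ) : Type := MvPolynomial (Fin n) ℂ

variable {n : ℕ} (G : Subgroup (Matrix.SpecialLinearGroup (Fin n) ℂ))

/-- The action of `g` on functions on `ℂ^n`: `(g • f)(v) = f (g⁻¹ v)`. -/
def polySubst (g : Matrix.SpecialLinearGroup (Fin n) ℂ) : Poly n →ₐ[ℂ] Poly n :=
  MvPolynomial.aeval fun i => ∑ j, MvPolynomial.C ((g⁻¹).1 i j) * MvPolynomial.X j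

theorem polySubst_one : polySubst (1 : Matrix.SpecialLinearGroup (Fin n) ℂ) = AlgHom.id ℂ _ := by
  apply MvPolynomial.algHom_ext
  intro i
  simp [polySubst, Matrix.one_apply, apply_ite, ite_mul]

theorem polySubst_mul (g h : Matrix.SpecialLinearGroup (Fin n) ℂ) : polySubst (g * h) = (polySubst g).comp (polySubst h) := by
  apply MvPolynomial.algHom_ext
  intro i
  simp only [polySubst, MvPolynomial.aeval_X, AlgHom.comp_apply, map_sum, map_mul, MvPolynomial.algHom_C, mul_inv_rev,
    Matrix.SpecialLinearGroup.coe_mul, Matrix.mul_apply, Finset.sum_mul, Finset.mul_sum, MvPolynomial.algebraMap_eq]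
  rw [Finset.sum_comm]
  simp only [mul_assoc]

instance : MulSemiringAction G (Poly n) where
  smul g p := polySubst g.1 p
  one_smul p := by change polySubst 1 p = p; rw [polySubst_one]; rfl
  mul_smul g h p := by change polySubst (g.1 * h.1) p = _; rw [polySubst_mul]; rfl
  smul_zero g := map_zero (polySubst g.1)
  smul_add g := map_add (polySubst g.1)
  smul_one g := map_one (polySubst g.1)
  smul_mul g := map_mul (polySubst g.1)

theorem poly_smul_C (g : G) (c : ℂ) : g • (MvPolynomial.C c : Poly n) = MvPolynomial.C c := (polySubst g.1).commutes c

theorem poly_smul_def (g : G) (f : Poly n) : g • f = polySubst g.1 f := rfl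

variable (n) in
/-- The affine space `ℂ^n`. -/
abbrev AffSp : Scheme.{0} := Spec (CommRingCat.of (Poly n))

/-- The base `Spec ℂ`. -/
abbrev SpecC : Scheme.{0} := Spec (CommRingCat.of ℂ)

variable (n) in
/-- The structure morphism of `ℂ^n`. -/
def affStr : AffSp n ⟶ SpecC := Spec.map (CommRingCat.ofHom MvPolynomial.C)

theorem specAct_affStr (g : G) : (specAct G (Poly n)).t g ≫ affStr n = affStr n := by
  change Spec.map _ ≫ Spec.map _ = Spec.map _
  rw [← Spec.map_comp]
  have h : CommRingCat.ofHom MvPolynomial.C ≫ actHom (Poly n) g = CommRingCat.ofHom (MvPolynomial.C (R := ℂ)) :=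
    CommRingCat.hom_ext (RingHom.ext fun c => poly_smul_C G g c)
  exact congrArg _ h

variable {Y : Scheme.{0}} (p : Y ⟶ SpecC)

variable (n) in
/-- The product `Y × ℂ^n`. -/
def prodSp : Scheme.{0} := pullback p (affStr n)

variable (n) in
/-- The projection `Y × ℂ^n → Y`. -/
def prY : prodSp n p ⟶ Y := pullback.fst _ _
variable (n) in
/-- The projection `Y × ℂ^n → ℂ^n`. -/
def prC : prodSp n p ⟶ AffSp n := pullback.snd _ _

theorem pr_comm : prY n p ≫ p = prC n p ≫ affStr n := pullback.condition

theorem prod_ext {Z : Scheme.{0}} {f g : Z ⟶ prodSp n p} (h1 : f ≫ prY n p = g ≫ prY n p) (h2 : f ≫ prC n p = g ≫ prC n p) : f = g :=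
  pullback.hom_ext h1 h2

/-- The automorphism of `Y × ℂ^n` by which `g` acts: trivial on `Y`, given on `ℂ^n`. -/
def prodT (g : G) : prodSp n p ⟶ prodSp n p :=
  pullback.lift (prY n p) (prC n p ≫ (specAct G (Poly n)).t g) (by rw [Category.assoc, specAct_affStr, pr_comm])

theorem prodT_Y (g : G) : prodT G p g ≫ prY n p = prY n p := pullback.lift_fst _ _ _
theorem prodT_C (g : G) : prodT G p g ≫ prC n p = prC n p ≫ (specAct G (Poly n)).t g := pullback.lift_snd _ _ _

/-- The action of `G` on `Y × ℂ^n`, trivial on the first factor. -/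
def prodAct : GAct G (prodSp n p) where
  t := prodT G p
  t_one := by
    apply prod_ext
    · rw [prodT_Y, Category.id_comp]
    · rw [prodT_C, GAct.t_one, Category.id_comp, Category.comp_id]
  t_mul g h := by
    apply prod_ext
    · rw [Category.assoc, prodT_Y, prodT_Y, prodT_Y]
    · rw [Category.assoc, prodT_C, prodT_C, ← Category.assoc, prodT_C, GAct.t_mul, Category.assoc]

/-- The equivariant projection `π_Y : Y × ℂ^n → Y`. -/
def piY : EquivHom (prodAct G p) (GAct.triv G Y) := ⟨prY n p, fun g => (prodT_Y G p g).trans (Category.comp_id _).symm⟩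
/-- The equivariant projection `π_{ℂ^n} : Y × ℂ^n → ℂ^n`. -/
def piC : EquivHom (prodAct G p) (specAct G (Poly n)) := ⟨prC n p, prodT_C G p⟩

/-- The underived integral transform with kernel `F`, `E ↦ (π_{Y*} (F ⊗ π_{ℂ^n}^* E))^G`, on `R ⋊ G`-modules
(i.e. on quasi-coherent `G`-sheaves on `ℂ^n`). -/
def psi0 (F : GSheaf (prodAct G p)) : ModuleCat.{0} (SkewMonoidAlgebra (Poly n) G) ⥤ Y.Modules :=
  tildeG G (Poly n) ⋙ GSheaf.pull (piC G p) ⋙ GSheaf.tensorLeft F ⋙ GSheaf.push (piY G p) ⋙ invariants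

instance (F : GSheaf (prodAct G p)) : (psi0 G p F).PreservesZeroMorphisms := by
  unfold psi0; infer_instance


/-- A derived category of `O_Y`-modules. -/
instance dHas (Y : Scheme.{0}) : HasDerivedCategory.{1} Y.Modules := HasDerivedCategory.standard _

/-- A chain complex, with its term of index `k` in cohomological degree `-k`, as an object of the derived category. -/
def toD {Y : Scheme.{0}} (K : ChainComplex Y.Modules ℕ) : DerivedCategory Y.Modules :=
  DerivedCategory.Q.obj (K.extend ComplexShape.embeddingDownNat)

/-- The integral transform `Ψ_F(E) = (π_{Y*} (F ⊗^L π_{ℂ^n}^* E))^G ∈ D(Y)` of the `G`-sheaf on `ℂ^n` given by an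
`R ⋊ G`-module `E`. The derived tensor product is computed by a projective resolution of `E` over `R ⋊ G`; its terms are
projective over `R`, so the pull-backs to `Y × ℂ^n` are flat. The functors `π_{ℂ^n}^*` (flat), `π_{Y*}` (affine) and
`(-)^G` (`G` finite, over `ℂ`) are exact on the sheaves that occur, so that only the tensor product has to be derived. -/
def Psi (F : GSheaf (prodAct G p)) (E : ModuleCat.{0} (SkewMonoidAlgebra (Poly n) G)) : DerivedCategory Y.Modules :=
  toD (((psi0 G p F).mapHomologicalComplex _).obj (ProjectiveResolution.of E).complex)

variable {W : Type} [AddCommGroup W] [Module ℂ W] (ρ : Representation ℂ G W)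

theorem constantCoeff_smul (g : G) (f : Poly n) : MvPolynomial.constantCoeff (g • f) = MvPolynomial.constantCoeff f := by
  have : (MvPolynomial.constantCoeff.comp (polySubst g.1).toRingHom : Poly n →+* ℂ) = MvPolynomial.constantCoeff := by
    apply MvPolynomial.ringHom_ext
    · intro c
      simp [polySubst]
    · intro i
      simp [polySubst]
  exact congr($this f)

/-- The homomorphism `R ⋊ G → End_ℂ(W)` in which `R` acts by evaluation at the origin and `G` by `ρ`. -/
def skewRep : SkewMonoidAlgebra (Poly n) G →+* Module.End ℂ W :=
  SkewMonoidAlgebra.liftNCRingHom ((algebraMap ℂ (Module.End ℂ W)).comp MvPolynomial.constantCoeff) ρ (by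
    intro f g
    rw [RingHom.comp_apply, RingHom.comp_apply, constantCoeff_smul]
    exact Algebra.commutes _ _)

/-- The `R ⋊ G`-module of the `G`-sheaf `O_0 ⊗ ρ`: `R` acts through `O_0`, `G` through `ρ`. -/
def originRep : ModuleCat.{0} (SkewMonoidAlgebra (Poly n) G) :=
  (ModuleCat.restrictScalars (skewRep G ρ)).obj (ModuleCat.of (Module.End ℂ W) W)

end
end McKayTransform

namespace McKayTransform
noncomputable section
open GSheaf

variable {X : Scheme.{0}}

/-- A sheaf of `O_X`-modules described by its sections: groups of sections, restriction maps and unique gluing. -/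
structure ModData (X : Scheme.{0}) where
  S : X.Opens → Type
  [ab : ∀ U, AddCommGroup (S U)]
  [mod : ∀ U, Module Γ(X, U) (S U)]
  r {U V : X.Opens} (h : V ≤ U) : S U → S V
  r_add {U V : X.Opens} (h : V ≤ U) (s t : S U) : r h (s + t) = r h s + r h t
  r_smul {U V : X.Opens} (h : V ≤ U) (a : Γ(X, U)) (s : S U) : r h (a • s) = X.presheaf.map (homOfLE h).op a • r h s
  r_self {U : X.Opens} (h : U ≤ U) (s : S U) : r h s = s
  r_r {U V W : X.Opens} (h : V ≤ U) (h' : W ≤ V) (s : S U) : r h' (r h s) = r (h'.trans h) s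
  glue {ι : Type} (U : ι → X.Opens) (s : ∀ i, S (U i))
    (hs : ∀ i j, r (inf_le_left : U i ⊓ U j ≤ U i) (s i) = r inf_le_right (s j)) : ∃! t : S (iSup U), ∀ i, r (le_iSup U i) t = s i

namespace ModData
attribute [instance] ModData.ab ModData.mod
variable (D : ModData X)

/-- The underlying presheaf of abelian groups. -/
def toAb : TopCat.Presheaf Ab.{0} X where
  obj U := AddCommGrpCat.of (D.S U.unop)
  map {U V} i := AddCommGrpCat.ofHom (AddMonoidHom.mk' (D.r (leOfHom i.unop)) (D.r_add _))
  map_id U := by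
    ext s
    exact D.r_self _ s
  map_comp i j := by
    ext s
    exact (D.r_r (leOfHom i.unop) (leOfHom j.unop) s).symm

instance (U : (TopologicalSpace.Opens X)ᵒᵖ) : Module (X.ringCatSheaf.obj.obj U) (D.toAb.obj U) := D.mod U.unop

/-- The `O_X`-module given by the data. -/
def toModules : X.Modules where
  val := PresheafOfModules.ofPresheaf (R := X.ringCatSheaf.obj) D.toAb (fun U V i a s => D.r_smul (leOfHom i.unop) a s)
  isSheaf := by
    change TopCat.Presheaf.IsSheaf D.toAb
    rw [TopCat.Presheaf.isSheaf_iff_isSheafUniqueGluing]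
    intro ι U s hs
    exact D.glue U s hs

/-- A section as an element of the data. -/
def get {U : X.Opens} (s : Γ(D.toModules, U)) : D.S U := s
/-- An element of the data as a section. -/
def sec {U : X.Opens} (s : D.S U) : Γ(D.toModules, U) := s

theorem res_sec {U V : X.Opens} (h : V ≤ U) (s : D.S U) : res D.toModules h (D.sec s) = D.sec (D.r h s) := rfl
theorem smul_sec {U : X.Opens} (a : Γ(X, U)) (s : D.S U) : a • D.sec s = D.sec (a • s) := rfl
end ModData

/-- Morphisms of `O_X`-modules from their maps on sections. -/
def mkHom {M N : X.Modules} (f : ∀ U : X.Opens, Γ(M, U) → Γ(N, U)) (hadd : ∀ U s t, f U (s + t) = f U s + f U t)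
  (hsmul : ∀ U (a : Γ(X, U)) s, f U (a • s) = a • f U s) (hres : ∀ {U V : X.Opens} (h : V ≤ U) s, f V (res M h s) = res N h (f U s)) : M ⟶ N where
  val := PresheafOfModules.homMk (R := X.ringCatSheaf.obj) (M₁ := M.val) (M₂ := N.val)
    { app U := AddCommGrpCat.ofHom (AddMonoidHom.mk' (f U.unop) (hadd _))
      naturality U V i := by
        ext s
        exact hres (leOfHom i.unop) s }
    (fun U a s => hsmul U.unop a s)

theorem mkHom_app {M N : X.Modules} (f : ∀ U : X.Opens, Γ(M, U) → Γ(N, U)) (hadd) (hsmul) (hres)  (U : X.Opens) (s : Γ(M, U)) :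
   (mkHom (M := M) (N := N) f hadd hsmul hres).app U s = f U s := rfl

theorem glue_mod (M : X.Modules) {ι : Type} (U : ι → X.Opens) (s : ∀ i, Γ(M, U i))
  (hs : ∀ i j, res M (inf_le_left : U i ⊓ U j ≤ U i) (s i) = res M inf_le_right (s j)) : ∃! t : Γ(M, iSup U), ∀ i, res M (le_iSup U i) t = s i :=
  TopCat.Presheaf.IsSheaf.isSheafUniqueGluing M.isSheaf U s hs

end
end McKayTransform

namespace McKayTransform
noncomputable section
open GSheaf
open scoped TensorProduct

section koszul
variable {V S S' W W' : Type} [AddCommGroup V] [Module ℂ V] [AddCommGroup S] [Module ℂ S] [AddCommGroup S'] [Module ℂ S']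
 [AddCommGroup W] [Module ℂ W] [AddCommGroup W'] [Module ℂ W']

/-- `m ↦ (u, s, w) ↦ (m • s) ⊗ (u ⊗ w)` for `u` a decomposable element of `∧^k V`. -/
def kosPre (W : Type) [AddCommGroup W] [Module ℂ W] (a : V →ₗ[ℂ] S →ₗ[ℂ] S) (k : ℕ) : V →ₗ[ℂ] V [⋀^Fin k]→ₗ[ℂ] (S →ₗ[ℂ] W →ₗ[ℂ] S ⊗[ℂ] ((⋀[ℂ]^k V) ⊗[ℂ] W)) where
  toFun m := (LinearMap.mk₂ ℂ (fun (u : ⋀[ℂ]^k V) (s : S) => (TensorProduct.mk ℂ S ((⋀[ℂ]^k V) ⊗[ℂ] W) (a m s)).comp (TensorProduct.mk ℂ (⋀[ℂ]^k V) W u))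
    (by intros; ext; simp [TensorProduct.tmul_add]) (by intros; ext; simp)
    (by intros; ext; simp) (by intros; ext; simp)).compAlternatingMap (exteriorPower.ιMulti ℂ k)
  map_add' m m' := by ext; simp [TensorProduct.add_tmul]
  map_smul' c m := by ext; simp [TensorProduct.smul_tmul']

theorem kosPre_apply (a : V →ₗ[ℂ] S →ₗ[ℂ] S) (k : ℕ) (m : V) (v : Fin k → V) (s : S) (w : W) :
   kosPre W a k m v s w = a m s ⊗ₜ (exteriorPower.ιMulti ℂ k v ⊗ₜ w) := rfl

/-- `(m_0, …, m_k) ↦ (s, w) ↦ ∑ (-1)^i (m_i • s) ⊗ ((m_0 ∧ … omit m_i … ∧ m_k) ⊗ w)`. -/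
def kosAlt (W : Type) [AddCommGroup W] [Module ℂ W] (a : V →ₗ[ℂ] S →ₗ[ℂ] S) (k : ℕ) :
    V [⋀^Fin (k + 1)]→ₗ[ℂ] (S →ₗ[ℂ] W →ₗ[ℂ] S ⊗[ℂ] ((⋀[ℂ]^k V) ⊗[ℂ] W)) :=
  AlternatingMap.alternatizeUncurryFin (R := ℂ) (M := V) (N := S →ₗ[ℂ] W →ₗ[ℂ] S ⊗[ℂ] ((⋀[ℂ]^k V) ⊗[ℂ] W)) (kosPre W a k)

/-- The linear map on `∧^{k+1} V` given by `kosAlt`. -/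
def kosLin (W : Type) [AddCommGroup W] [Module ℂ W] (a : V →ₗ[ℂ] S →ₗ[ℂ] S) (k : ℕ) :
    (⋀[ℂ]^(k+1) V) →ₗ[ℂ] (S →ₗ[ℂ] W →ₗ[ℂ] S ⊗[ℂ] ((⋀[ℂ]^k V) ⊗[ℂ] W)) :=
  exteriorPower.alternatingMapLinearEquiv (R := ℂ) (M := V) (N := S →ₗ[ℂ] W →ₗ[ℂ] S ⊗[ℂ] ((⋀[ℂ]^k V) ⊗[ℂ] W)) (kosAlt W a k)

/-- The Koszul differential `S ⊗ ∧^{k+1} V ⊗ W → S ⊗ ∧^k V ⊗ W` for an action `a` of `V` on `S`; see `kos_apply`. The tensor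
factors are written in the order `S, ∧ V, W`. -/
def kos (W : Type) [AddCommGroup W] [Module ℂ W] (a : V →ₗ[ℂ] S →ₗ[ℂ] S) (k : ℕ) : S ⊗[ℂ] ((⋀[ℂ]^(k+1) V) ⊗[ℂ] W) →ₗ[ℂ] S ⊗[ℂ] ((⋀[ℂ]^k V) ⊗[ℂ] W) :=
  -TensorProduct.lift ((TensorProduct.uncurry (.id ℂ) (⋀[ℂ]^(k+1) V) W (S ⊗[ℂ] ((⋀[ℂ]^k V) ⊗[ℂ] W))) ∘ₗ (kosLin W a k).flip)

/-- Formula for the Koszul differential. With the positions counted from one, the sign of the `i`-th summand is `(-1)^i`. -/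
theorem kos_apply (a : V →ₗ[ℂ] S →ₗ[ℂ] S) (k : ℕ) (v : Fin (k + 1) → V) (s : S) (w : W) :
    kos W a k (s ⊗ₜ (exteriorPower.ιMulti ℂ (k+1) v ⊗ₜ w)) = ∑ i, (-1 : ℤ) ^ (i.1 + 1) • (a (v i) s ⊗ₜ (exteriorPower.ιMulti ℂ k (i.removeNth v) ⊗ₜ w)) := by
  simp [kos, kosLin, kosAlt, AlternatingMap.alternatizeUncurryFin_apply, pow_succ, ← kosPre_apply]

theorem kos_hom_ext {k : ℕ} {f g : S ⊗[ℂ] ((⋀[ℂ]^k V) ⊗[ℂ] W) →ₗ[ℂ] S'}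
    (h : ∀ s v w, f (s ⊗ₜ (exteriorPower.ιMulti ℂ k v ⊗ₜ w)) = g (s ⊗ₜ (exteriorPower.ιMulti ℂ k v ⊗ₜ w))) : f = g := by
  apply TensorProduct.ext
  refine LinearMap.ext fun s => ?_
  apply TensorProduct.ext
  apply exteriorPower.linearMap_ext
  ext v w
  exact h s v w

theorem kos_nat (a : V →ₗ[ℂ] S →ₗ[ℂ] S) (a' : V →ₗ[ℂ] S' →ₗ[ℂ] S') (f : S →ₗ[ℂ] S') (τ : V →ₗ[ℂ] V) (L : W →ₗ[ℂ] W') (k : ℕ)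
   (h : ∀ m s, f (a m s) = a' (τ m) (f s)) (x : S ⊗[ℂ] ((⋀[ℂ]^(k+1) V) ⊗[ℂ] W)) :
   TensorProduct.map f (TensorProduct.map (exteriorPower.map k τ) L) (kos W a k x) = kos W' a' k (TensorProduct.map f (TensorProduct.map (exteriorPower.map (k+1) τ) L) x) := by
  suffices H : TensorProduct.map f (TensorProduct.map (exteriorPower.map k τ) L) ∘ₗ kos W a k = kos W' a' k ∘ₗ TensorProduct.map f (TensorProduct.map (exteriorPower.map (k+1) τ) L) from congr($H x)
  apply kos_hom_ext
  intro s v w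
  simp only [LinearMap.comp_apply, kos_apply, TensorProduct.map_tmul, exteriorPower.map_apply_ιMulti, map_sum, map_zsmul, h]
  rfl

theorem kos_kos (a : V →ₗ[ℂ] S →ₗ[ℂ] S) (h : ∀ x y s, a x (a y s) = a y (a x s)) (k : ℕ) (x : S ⊗[ℂ] ((⋀[ℂ]^(k+2) V) ⊗[ℂ] W)) :
   kos W a k (kos W a (k+1) x) = 0 := by
  suffices H : kos W a k ∘ₗ kos W a (k+1) = 0 from congr($H x)
  apply kos_hom_ext
  intro s v w
  let F : V →ₗ[ℂ] V →ₗ[ℂ] V [⋀^Fin k]→ₗ[ℂ] S ⊗[ℂ] ((⋀[ℂ]^k V) ⊗[ℂ] W) :=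
    LinearMap.mk₂ ℂ (fun x y => ((TensorProduct.mk ℂ S ((⋀[ℂ]^k V) ⊗[ℂ] W) (a y (a x s))).comp ((TensorProduct.mk ℂ (⋀[ℂ]^k V) W).flip w)).compAlternatingMap (exteriorPower.ιMulti ℂ k))
     (by intros; ext; simp [TensorProduct.add_tmul]) (by intros; ext; simp [TensorProduct.smul_tmul'])
     (by intros; ext; simp [TensorProduct.add_tmul]) (by intros; ext; simp [TensorProduct.smul_tmul'])
  have hF (x y u) : F x y u = a y (a x s) ⊗ₜ (exteriorPower.ιMulti ℂ k u ⊗ₜ w) := rfl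
  have := AlternatingMap.alternatizeUncurryFin_alternatizeUncurryFinLM_comp_of_symmetric (f := F) (fun x y => by ext u; simp only [hF, h])
  have := congr($this v)
  simp only [AlternatingMap.alternatizeUncurryFin_apply, LinearMap.comp_apply, AlternatingMap.alternatizeUncurryFinLM_apply, hF] at this
  have e : kos W a k (kos W a (k+1) (s ⊗ₜ (exteriorPower.ιMulti ℂ (k+2) v ⊗ₜ w))) = ∑ i : Fin (k + 2), (-1 : ℤ) ^ (i.1 + 1) • ∑ j : Fin (k + 1), (-1 : ℤ) ^ (j.1 + 1) •
      (a (i.removeNth v j) (a (v i) s) ⊗ₜ[ℂ] (exteriorPower.ιMulti ℂ k (j.removeNth (i.removeNth v)) ⊗ₜ[ℂ] w)) := by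
    rw [kos_apply, map_sum]
    refine Finset.sum_congr rfl fun i _ => ?_
    rw [map_zsmul, kos_apply]
  refine e.trans ?_
  simp only [pow_succ, mul_neg, mul_one, neg_smul, Finset.sum_neg_distrib, smul_neg, neg_neg]
  exact this
end koszul

attribute [irreducible] kos

section twist
variable {Y : Scheme.{0}} (p : Y ⟶ SpecC)

/-- Complex numbers as functions on `Y`. -/
def scal (U : Y.Opens) : ℂ →+* Γ(Y, U) :=
  (Y.presheaf.map (homOfLE (le_top : U ≤ ⊤)).op).hom.comp (p.appTop.hom.comp (Scheme.ΓSpecIso (CommRingCat.of ℂ)).inv.hom)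

theorem scal_res {U V : Y.Opens} (h : V ≤ U) (c : ℂ) : Y.presheaf.map (homOfLE h).op (scal p U c) = scal p V c := by
  have : (homOfLE (le_top : V ≤ ⊤)).op = (homOfLE (le_top : U ≤ ⊤)).op ≫ (homOfLE h).op := rfl
  simp only [scal, this, CategoryTheory.Functor.map_comp]; rfl

/-- Sections of `M` over `U`, as a complex vector space. -/
def Sec (_p : Y ⟶ SpecC) (M : Y.Modules) (U : Y.Opens) : Type := Γ(M, U)

variable (M N : Y.Modules) (U : Y.Opens)
instance : AddCommGroup (Sec p M U) := inferInstanceAs (AddCommGroup Γ(M, U))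
instance : Module Γ(Y, U) (Sec p M U) := inferInstanceAs (Module Γ(Y, U) Γ(M, U))
instance : Module ℂ (Sec p M U) := Module.compHom _ (scal p U)
theorem Sec.smul_def (c : ℂ) (s : Sec p M U) : c • s = scal p U c • s := rfl
instance : SMulCommClass ℂ Γ(Y, U) (Sec p M U) where
  smul_comm c a s := by rw [Sec.smul_def, Sec.smul_def, smul_comm]

variable {M N U}
/-- A morphism of `O_Y`-modules on sections, as a `ℂ`-linear map. -/
def secMap (φ : M ⟶ N) (U : Y.Opens) : Sec p M U →ₗ[ℂ] Sec p N U where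
  toFun s := φ.app U s
  map_add' s t := map_add (φ.app U).hom s t
  map_smul' c s := φ.app_smul (scal p U c) s

theorem secMap_smul (φ : M ⟶ N) (a : Γ(Y,U)) (s : Sec p M U) : secMap p φ U (a • s) = a • secMap p φ U s := φ.app_smul a s

/-- Restriction of sections, as a `ℂ`-linear map. -/
def secRes (M : Y.Modules) {U V : Y.Opens} (h : V ≤ U) : Sec p M U →ₗ[ℂ] Sec p M V where
  toFun s := res M h s
  map_add' s t := map_add (M.presheaf.map (homOfLE h).op).hom s t
  map_smul' c s := by
    refine (M.map_smul (homOfLE h) (scal p U c) s).trans ?_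
    rw [scal_res]; rfl

theorem secRes_smul {U V : Y.Opens} (h : V ≤ U) (a : Γ(Y, U)) (s : Sec p M U) : secRes p M h (a • s) = Y.presheaf.map (homOfLE h).op a • secRes p M h s :=
  M.map_smul (homOfLE h) a s

theorem secMap_res (φ : M ⟶ N) {U V : Y.Opens} (h : V ≤ U) (s : Sec p M U) : secMap p φ V (secRes p M h s) = secRes p N h (secMap p φ U s) :=
  app_res φ h s

variable (W W' : Type) [AddCommGroup W] [Module ℂ W] [Module.Finite ℂ W] [AddCommGroup W'] [Module ℂ W'] [Module.Finite ℂ W']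

theorem map_smul_left (φ : Sec p M U →ₗ[ℂ] Sec p N U) (hφ : ∀ (a : Γ(Y,U)) s, φ (a • s) = a • φ s) (L : W →ₗ[ℂ] W') (a : Γ(Y,U)) (x : Sec p M U ⊗[ℂ] W) :
   TensorProduct.map φ L (a • x) = a • TensorProduct.map φ L x := by
  induction x with
  | zero => simp
  | tmul s w => simp [TensorProduct.smul_tmul', hφ]
  | add x y hx hy => simp only [smul_add, map_add, hx, hy]

/-- The `i`-th coordinate `M(U) ⊗ W → M(U)` with respect to a basis of `W`. -/
def coo (i : Fin (Module.finrank ℂ W)) (U : Y.Opens) : Sec p M U ⊗[ℂ] W →ₗ[ℂ] Sec p M U :=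
  (TensorProduct.rid ℂ (Sec p M U)).toLinearMap ∘ₗ LinearMap.lTensor _ ((Module.finBasis ℂ W).coord i)

theorem coo_tmul (i : Fin (Module.finrank ℂ W)) (s : Sec p M U) (w : W) : coo p W i U (s ⊗ₜ[ℂ] w) = (Module.finBasis ℂ W).coord i w • s := by
  simp [coo]

theorem coo_res (i : Fin (Module.finrank ℂ W)) {U V : Y.Opens} (h : V ≤ U) (x : Sec p M U ⊗[ℂ] W) : coo p W i V (LinearMap.rTensor W (secRes p M h) x) = secRes p M h (coo p W i U x) := by
  induction x with
  | zero => simp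
  | tmul s w => simp [coo_tmul]
  | add x y hx hy => simp only [map_add, hx, hy]

theorem coo_sum (x : Sec p M U ⊗[ℂ] W) : ∑ i, coo p W i U x ⊗ₜ[ℂ] Module.finBasis ℂ W i = x := by
  induction x with
  | zero => simp
  | tmul s w => simp only [coo_tmul, TensorProduct.smul_tmul, ← TensorProduct.tmul_sum, Module.Basis.coord_apply, Module.Basis.sum_repr]
  | add x y hx hy => simp only [map_add, TensorProduct.add_tmul, Finset.sum_add_distrib, hx, hy]

theorem coo_mk (s : Fin (Module.finrank ℂ W) → Sec p M U) (i) : coo p W i U (∑ j, s j ⊗ₜ[ℂ] Module.finBasis ℂ W j) = s i := by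
  simp [coo_tmul, Finsupp.single_apply]

/-- The sheaf `U ↦ M(U) ⊗_ℂ W`. -/
def twistData (M : Y.Modules) : ModData Y where
  S U := Sec p M U ⊗[ℂ] W
  r h := LinearMap.rTensor W (secRes p M h)
  r_add h := map_add _
  r_smul h a x := by
    induction x with
    | zero => simp
    | tmul s w => simp [TensorProduct.smul_tmul', secRes_smul]
    | add x y hx hy => simp only [smul_add, map_add, hx, hy]
  r_self h x := by
    have : secRes p M h = LinearMap.id := LinearMap.ext fun s => res_self M h s
    simp [this]
  r_r h h' x := by
    rw [← LinearMap.comp_apply, ← LinearMap.rTensor_comp]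
    congr 2
    exact LinearMap.ext fun s => res_res M h h' s
  glue {ι} U s hs := by
    have key (i : Fin (Module.finrank ℂ W)) := glue_mod M U (fun j => coo p W i (U j) (s j)) (fun j j' => by
      have := congrArg (coo p W i _) (hs j j')
      rw [coo_res, coo_res] at this
      exact this)
    choose t ht ht' using key
    refine ⟨∑ j, (t j : Sec p M _) ⊗ₜ[ℂ] Module.finBasis ℂ W j, fun i => ?_, fun t' h' => ?_⟩
    · rw [← coo_sum p W (s i)]
      simp only [map_sum, LinearMap.rTensor_tmul]
      exact Finset.sum_congr rfl fun j _ => congrArg (fun x : Sec p M _ => x ⊗ₜ[ℂ] Module.finBasis ℂ W j) (ht j i)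
    · rw [← coo_sum p W t']
      refine Finset.sum_congr rfl fun j _ => congrArg (fun x : Sec p M _ => x ⊗ₜ[ℂ] Module.finBasis ℂ W j) (ht' j _ fun i => ?_)
      refine (coo_res p W j (le_iSup U i) t').symm.trans ?_
      exact congrArg _ (h' i)

/-- The sheaf `M ⊗_ℂ W` for a finite-dimensional vector space `W`. -/
def twist (M : Y.Modules) : Y.Modules := (twistData p W M).toModules


variable {W W'}
/-- The morphism `φ ⊗ L : M ⊗ W → N ⊗ W'`. -/
def twistMap (φ : M ⟶ N) (L : W →ₗ[ℂ] W') : twist p W M ⟶ twist p W' N :=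
  mkHom (M := twist p W M) (N := twist p W' N) (fun U s => (twistData p W' N).sec (TensorProduct.map (secMap p φ U) L ((twistData p W M).get s)))
   (fun U s t => map_add (TensorProduct.map (secMap p φ U) L) _ _)
   (fun U a s => map_smul_left p W W' (secMap p φ U) (secMap_smul p φ) L a ((twistData p W M).get s))
   (fun {U V} h s => by
     suffices H : TensorProduct.map (secMap p φ V) L ∘ₗ LinearMap.rTensor W (secRes p M h) = LinearMap.rTensor W' (secRes p N h) ∘ₗ TensorProduct.map (secMap p φ U) L from
       congr($H ((twistData p W M).get s))
     apply TensorProduct.ext'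
     intro s w
     simp [secMap_res])

end twist

/-- A `ℂ`-linear action of the vector space `V` on `M` by commuting `O_Y`-linear endomorphisms. -/
structure LinAct {Y : Scheme.{0}} (p : Y ⟶ SpecC) (M : Y.Modules) (V : Type) [AddCommGroup V] [Module ℂ V] where
  a : V → (M ⟶ M)
  add (x y : V) (U : Y.Opens) (s : Γ(M, U)) : (a (x + y)).app U s = (a x).app U s + (a y).app U s
  smul (c : ℂ) (x : V) (U : Y.Opens) (s : Γ(M, U)) : (a (c • x)).app U s = scal p U c • (a x).app U s
  comm (x y : V) (U : Y.Opens) (s : Γ(M, U)) : (a x).app U ((a y).app U s) = (a y).app U ((a x).app U s)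

section
variable {Y : Scheme.{0}} {p : Y ⟶ SpecC} {M : Y.Modules} {V : Type} [AddCommGroup V] [Module ℂ V] [Module.Finite ℂ V] (A : LinAct p M V)
   (W : Type) [AddCommGroup W] [Module ℂ W] [Module.Finite ℂ W]

/-- The action of `V` on sections over `U`. -/
def LinAct.lin (U : Y.Opens) : V →ₗ[ℂ] Sec p M U →ₗ[ℂ] Sec p M U where
  toFun x := secMap p (A.a x) U
  map_add' x y := LinearMap.ext fun s => A.add x y U s
  map_smul' c x := LinearMap.ext fun s => A.smul c x U s

theorem LinAct.lin_apply (U : Y.Opens) (x : V) (s : Sec p M U) : A.lin U x s = secMap p (A.a x) U s := rfl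

/-- The sheaf `M ⊗ ∧^k V ⊗ W`. -/
abbrev kosTerm (_A : LinAct p M V) (W : Type) [AddCommGroup W] [Module ℂ W] [Module.Finite ℂ W] (k : ℕ) : Y.Modules := twist p ((⋀[ℂ]^k V) ⊗[ℂ] W) M

/-- The Koszul differential on sheaves. -/
def kosD (k : ℕ) : kosTerm A W (k + 1) ⟶ kosTerm A W k :=
  mkHom (M := kosTerm A W (k + 1)) (N := kosTerm A W k) (fun U s => (twistData p _ M).sec (kos W (A.lin U) k ((twistData p _ M).get s)))
   (fun U s t => map_add (kos W (A.lin U) k) _ _)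
   (fun U a s => by
    have := kos_nat (A.lin U) (A.lin U) (W := W) (W' := W) (τ := LinearMap.id) (L := LinearMap.id) (k := k)
       { toFun := fun s => a • s, map_add' := smul_add a, map_smul' := fun c s => (smul_comm c a s).symm }
       (fun m s => (secMap_smul p (A.a m) a s).symm) ((twistData p ((⋀[ℂ]^(k+1) V) ⊗[ℂ] W) M).get s)
    rw [exteriorPower.map_id, exteriorPower.map_id, TensorProduct.map_id, TensorProduct.map_id] at this
    exact this.symm)
   (fun {U V'} h s => by
    have := kos_nat (A.lin U) (A.lin V') (W := W) (W' := W) (τ := LinearMap.id) (L := LinearMap.id) (k := k)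
       (secRes p M h) (fun m s => (secMap_res p (A.a m) h s).symm) ((twistData p ((⋀[ℂ]^(k+1) V) ⊗[ℂ] W) M).get s)
    rw [exteriorPower.map_id, exteriorPower.map_id, TensorProduct.map_id, TensorProduct.map_id] at this
    exact this.symm)

theorem kosD_comp (k : ℕ) : kosD A W (k + 1) ≫ kosD A W k = 0 := by
  ext U s
  exact kos_kos (A.lin U) (fun x y s => A.comm x y U s) k ((twistData p ((⋀[ℂ]^(k+2) V) ⊗[ℂ] W) M).get s)
end
end
end McKayTransform

namespace McKayTransform
noncomputable section
open GSheaf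
open scoped TensorProduct

section
variable {Y : Scheme.{0}} (p : Y ⟶ SpecC) {G : Type} [Group G]
variable {M N K : Y.Modules} {W W' W'' : Type} [AddCommGroup W] [Module ℂ W] [Module.Finite ℂ W] [AddCommGroup W'] [Module ℂ W'] [Module.Finite ℂ W']
  [AddCommGroup W''] [Module ℂ W''] [Module.Finite ℂ W'']

theorem twistMap_id : twistMap p (𝟙 M) (LinearMap.id (M := W) (R := ℂ)) = 𝟙 _ := by
  ext U s
  have : TensorProduct.map (secMap p (𝟙 M) U) (LinearMap.id (M := W)) = LinearMap.id := TensorProduct.map_id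
  exact congr($this ((twistData p W M).get s))

theorem secMap_comp (φ : M ⟶ N) (ψ : N ⟶ K) (U : Y.Opens) : secMap p (φ ≫ ψ) U = secMap p ψ U ∘ₗ secMap p φ U := rfl

theorem twistMap_app (φ : M ⟶ N) (L : W →ₗ[ℂ] W') (U : Y.Opens) (s : Γ(twist p W M, U)) :
  (twistMap p φ L).app U s = (twistData p W' N).sec (TensorProduct.map (secMap p φ U) L ((twistData p W M).get s)) := rfl

theorem twistMap_comp (φ : M ⟶ N) (ψ : N ⟶ K) (L : W →ₗ[ℂ] W') (L' : W' →ₗ[ℂ] W'') :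
   twistMap p (φ ≫ ψ) (L' ∘ₗ L) = twistMap p φ L ≫ twistMap p ψ L' := by
  ext U s
  rw [twistMap_app, secMap_comp, TensorProduct.map_comp]
  rfl

/-- A `G`-sheaf for the trivial action on `Y` from automorphisms of the module. -/
def GSheaf.ofOps (M : Y.Modules) (o : G → (M ⟶ M)) (h1 : o 1 = 𝟙 M) (h2 : ∀ g h, o (g * h) = o h ≫ o g) : GSheaf (GAct.triv G Y) where
  M := M
  act g := o g ≫ (Scheme.Modules.pushforwardId Y).inv.app M
  act_one U s := by rw [h1]; exact (res_self M le_rfl s).symm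
  act_mul g h U s := by rw [h2]; exact (res_self M le_rfl ((o g).app U ((o h).app U s))).symm

theorem GSheaf.ofOps_s (M : Y.Modules) (o : G → (M ⟶ M)) (h1 : o 1 = 𝟙 M) (h2 : ∀ g h, o (g * h) = o h ≫ o g) (g : G) (U : Y.Opens) (s : Γ(M, U)) :
   (GSheaf.ofOps M o h1 h2).s g U s = (o g).app U s := rfl

theorem GSheaf.op_one (E : GSheaf (GAct.triv G Y)) : E.op 1 = 𝟙 E.M := by
  ext U s
  exact (E.s_one U s).trans (res_self E.M le_rfl s)
theorem GSheaf.op_mul (E : GSheaf (GAct.triv G Y)) (g h : G) : E.op (g * h) = E.op h ≫ E.op g := by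
  ext U s
  exact (E.s_mul g h U s).trans (res_self E.M le_rfl _)

/-- The `G`-sheaf `E ⊗ σ` with the diagonal action, for a finite-dimensional representation `σ`. -/
def GSheaf.twistRep (E : GSheaf (GAct.triv G Y)) (σ : Representation ℂ G W) : GSheaf (GAct.triv G Y) :=
  GSheaf.ofOps (twist p W E.M) (fun g => twistMap p (E.op g) (σ g))
   (by rw [E.op_one, map_one]; exact twistMap_id p)
   (fun g h => by rw [E.op_mul, map_mul]; exact twistMap_comp p _ _ _ _)

end
variable {G : Type} [Group G]
variable {V W : Type} [AddCommGroup V] [Module ℂ V] [Module.Finite ℂ V] [AddCommGroup W] [Module ℂ W] [Module.Finite ℂ W]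
/-- The representation `∧^k τ`. -/
def extRep (τ : Representation ℂ G V) (k : ℕ) : Representation ℂ G (⋀[ℂ]^k V) where
  toFun g := exteriorPower.map k (τ g)
  map_one' := by rw [map_one]; exact exteriorPower.map_id
  map_mul' g h := by rw [map_mul]; exact exteriorPower.map_comp (τ h) (τ g)

variable {Y : Scheme.{0}} {p : Y ⟶ SpecC} {E : GSheaf (GAct.triv G Y)} (A : LinAct p E.M V) (τ : Representation ℂ G V) (ρ : Representation ℂ G W)
  (hA : ∀ g x U (s : Γ(E.M, U)), (E.op g).app U ((A.a x).app U s) = (A.a (τ g x)).app U ((E.op g).app U s))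

/-- The `G`-sheaf `E ⊗ ∧^k τ ⊗ ρ`. -/
def kosTermG (_A : LinAct p E.M V) (τ : Representation ℂ G V) (ρ : Representation ℂ G W) (k : ℕ) : GSheaf (GAct.triv G Y) :=
  GSheaf.twistRep p (W := (⋀[ℂ]^k V) ⊗[ℂ] W) E ((extRep τ k).tprod ρ)

/-- The Koszul differential as an equivariant morphism. -/
def kosDG (k : ℕ) : kosTermG A τ ρ (k + 1) ⟶ kosTermG A τ ρ k where
  hom := kosD A W k
  equivariant g U s := (kos_nat (A.lin U) (A.lin U) (W := W) (W' := W) (τ := τ g) (L := ρ g) (k := k) (secMap p (E.op g) U) (fun m s => hA g m U s)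
    ((twistData p ((⋀[ℂ]^(k+1) V) ⊗[ℂ] W) E.M).get s)).symm

/-- The Koszul complex of `G`-sheaves `… → E ⊗ ∧^k τ ⊗ ρ → … → E ⊗ ρ`, with `E ⊗ ρ` in degree zero. -/
def kosComplex : ChainComplex (GSheaf (GAct.triv G Y)) ℕ :=
  ChainComplex.of (kosTermG A τ ρ) (kosDG A τ ρ hA) (fun k => Hom.ext (kosD_comp A W k))

end
end McKayTransform

namespace McKayTransform
noncomputable section
open GSheaf
open scoped TensorProduct

variable {n : ℕ} (G : Subgroup (Matrix.SpecialLinearGroup (Fin n) ℂ)) {Y : Scheme.{0}} (p : Y ⟶ SpecC)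

/-- The dual `V^∨` of the given representation `V = ℂ^n`. -/
abbrev Vd (n : ℕ) : Type := Module.Dual ℂ (Fin n → ℂ)

/-- The given representation of `G` on `ℂ^n`. -/
def stdRep : Representation ℂ G (Fin n → ℂ) where
  toFun g := Matrix.toLin' g.1.1
  map_one' := Matrix.toLin'_one
  map_mul' g h := Matrix.toLin'_mul _ _

/-- The dual representation on `V^∨`: `(g • m)(v) = m (g⁻¹ v)`. -/
def dualRep : Representation ℂ G (Vd n) := (stdRep G).dual

/-- A linear form on `ℂ^n` as a polynomial function. -/
def linPoly : Vd n →ₗ[ℂ] Poly n where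
  toFun m := ∑ i, MvPolynomial.C (m (Pi.single i 1)) * MvPolynomial.X i
  map_add' x y := by simp [add_mul, Finset.sum_add_distrib]
  map_smul' c x := by simp [Finset.mul_sum, mul_assoc, MvPolynomial.smul_eq_C_mul]

theorem smul_linPoly (g : G) (m : Vd n) : g • linPoly m = linPoly (dualRep G g m) := by
  rw [poly_smul_def]
  have (j : Fin n) : (dualRep G g m) (Pi.single j 1) = ∑ i, ((g.1⁻¹).1 i j) * m (Pi.single i 1) := by
    change m (Matrix.toLin' (g.1⁻¹).1 (Pi.single j 1)) = _
    rw [Matrix.toLin'_apply, Matrix.mulVec_single_one]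
    rw [LinearMap.pi_apply_eq_sum_univ m]
    refine Finset.sum_congr rfl fun i _ => ?_
    rw [smul_eq_mul, Matrix.col_apply]
    congr 2
    ext k
    simp [Pi.single_apply, eq_comm]
  simp only [linPoly, LinearMap.coe_mk, AddHom.coe_mk, this, polySubst, map_sum, map_mul, MvPolynomial.algHom_C, MvPolynomial.aeval_X,
     Finset.mul_sum, Finset.sum_mul, MvPolynomial.algebraMap_eq]
  rw [Finset.sum_comm]
  refine Finset.sum_congr rfl fun _ _ => Finset.sum_congr rfl fun _ _ => by ring

/-- A polynomial as a function on `Y × ℂ^n`. -/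
def polyTop : Poly n →+* Γ(prodSp n p, ⊤) := (prC n p).appTop.hom.comp (Scheme.ΓSpecIso (CommRingCat.of (Poly n))).inv.hom

/-- A polynomial as a function on `π_Y⁻¹ U`. -/
def polySec (U : Y.Opens) : Poly n →+* Γ(prodSp n p, prY n p ⁻¹ᵁ U) :=
  ((prodSp n p).presheaf.map (homOfLE (le_top : prY n p ⁻¹ᵁ U ≤ ⊤)).op).hom.comp (polyTop p)

theorem rmap_rmap {X : Scheme.{0}} {U V W : X.Opens} (h : V ≤ U) (h' : W ≤ V) (h'' : W ≤ U) (s : Γ(X, U)) :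
    X.presheaf.map (homOfLE h').op (X.presheaf.map (homOfLE h).op s) = X.presheaf.map (homOfLE h'').op s := by
  have : (homOfLE h'').op = (homOfLE h).op ≫ (homOfLE h').op := rfl
  simp only [this, CategoryTheory.Functor.map_comp]; rfl

theorem polySec_res {U V : Y.Opens} (h : V ≤ U) (h' : prY n p ⁻¹ᵁ V ≤ prY n p ⁻¹ᵁ U) (f : Poly n) :
  (prodSp n p).presheaf.map (homOfLE h').op (polySec p U f) = polySec p V f := rmap_rmap _ _ _ _

theorem app_rmap {X X' : Scheme.{0}} (f : X ⟶ X') {U V : X'.Opens} (h : V ≤ U) (h' : f ⁻¹ᵁ V ≤ f ⁻¹ᵁ U) (s : Γ(X', U)) :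
   f.app V (X'.presheaf.map (homOfLE h).op s) = X.presheaf.map (homOfLE h').op (f.app U s) :=
  congr($(f.naturality (homOfLE h).op) s)

theorem polyTop_act (g : G) (f : Poly n) : (prodT G p g).appTop (polyTop p f) = polyTop p (g • f) := by
  have h1 : (prC n p).appTop ≫ (prodT G p g).appTop = ((specAct G (Poly n)).t g).appTop ≫ (prC n p).appTop := by
    rw [← Scheme.Hom.comp_appTop, ← Scheme.Hom.comp_appTop, prodT_C]
  have h2 := congr($(Scheme.ΓSpecIso_inv_naturality (actHom (Poly n) g)) f)
  refine (congr($h1 ((Scheme.ΓSpecIso (CommRingCat.of (Poly n))).inv f))).trans ?_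
  exact congrArg (prC n p).appTop h2.symm

theorem polySec_act (g : G) (f : Poly n) (U : Y.Opens) (h : prY n p ⁻¹ᵁ U ≤ prodT G p g ⁻¹ᵁ (prY n p ⁻¹ᵁ U)) :
   (prodSp n p).presheaf.map (homOfLE h).op ((prodT G p g).app _ (polySec p U f)) = polySec p U (g • f) := by
  have := app_rmap (prodT G p g) (le_top : prY n p ⁻¹ᵁ U ≤ ⊤) le_top (polyTop p f)
  refine (congrArg _ this).trans ((rmap_rmap (X := prodSp n p) (U := ⊤) le_top h le_top _).trans ?_)
  exact congrArg _ (polyTop_act G p g f)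

theorem polyTop_C (c : ℂ) : polyTop (n := n) p (MvPolynomial.C c) = (prY n p).appTop (p.appTop ((Scheme.ΓSpecIso (CommRingCat.of ℂ)).inv c)) := by
  have h1 : p.appTop ≫ (prY n p).appTop = (affStr n).appTop ≫ (prC n p).appTop := by
    rw [← Scheme.Hom.comp_appTop, ← Scheme.Hom.comp_appTop, pr_comm]
  have h2 := congr($(Scheme.ΓSpecIso_inv_naturality (CommRingCat.ofHom (MvPolynomial.C (σ := Fin n) (R := ℂ)))) c)
  refine Eq.trans ?_ (congr($h1 ((Scheme.ΓSpecIso (CommRingCat.of ℂ)).inv c))).symm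
  exact congrArg (prC n p).appTop h2

theorem polySec_C (c : ℂ) (U : Y.Opens) : polySec (n := n) p U (MvPolynomial.C c) = (prY n p).app U (scal p U c) := by
  have := app_rmap (prY n p) (le_top : U ≤ ⊤) le_top (p.appTop ((Scheme.ΓSpecIso (CommRingCat.of ℂ)).inv c))
  refine Eq.trans ?_ this.symm
  exact congrArg _ (polyTop_C p c)

variable {G p} in
/-- Multiplication by a polynomial on `π_{Y*} M`. -/
def polyMul (M : (prodSp n p).Modules) (f : Poly n) : (Scheme.Modules.pushforward (prY n p)).obj M ⟶ (Scheme.Modules.pushforward (prY n p)).obj M :=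
  mkHom (M := (Scheme.Modules.pushforward (prY n p)).obj M) (N := (Scheme.Modules.pushforward (prY n p)).obj M)
   (fun U (s : Γ(M, prY n p ⁻¹ᵁ U)) => polySec p U f • s) (fun U => smul_add (A := Γ(M, prY n p ⁻¹ᵁ U)) (polySec p U f))
   (fun U a (s : Γ(M, prY n p ⁻¹ᵁ U)) => smul_comm (polySec p U f) ((prY n p).app U a) s)
   (fun {U V} h (s : Γ(M, prY n p ⁻¹ᵁ U)) => by
    have := M.map_smul (homOfLE (pre_mono (prY n p) h)) (polySec p U f) s
    rw [polySec_res p h] at this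
    exact this.symm)

theorem polyMul_app (M : (prodSp n p).Modules) (f : Poly n) (U : Y.Opens) (s : Γ(M, prY n p ⁻¹ᵁ U)) : (polyMul M f).app U s = polySec p U f • s := rfl

variable {G p} (F : GSheaf (prodAct G p))

theorem op_polyMul (g : G) (f : Poly n) (U : Y.Opens) (s : Γ(((GSheaf.push (piY G p)).obj F).M, U)) :
   (GSheaf.op ((GSheaf.push (piY G p)).obj F) g).app U ((polyMul F.M f).app U s) = (polyMul F.M (g • f)).app U ((GSheaf.op ((GSheaf.push (piY G p)).obj F) g).app U s) := by
  revert s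
  suffices h : ∀ s : Γ(F.M, prY n p ⁻¹ᵁ U), res F.M ((piY G p).le g U) (F.s g (prY n p ⁻¹ᵁ U) (polySec p U f • s)) =
       (show Γ(F.M, prY n p ⁻¹ᵁ U) from polySec p U (g • f) • (show Γ(F.M, prY n p ⁻¹ᵁ U) from res F.M ((piY G p).le g U) (F.s g (prY n p ⁻¹ᵁ U) s))) from h
  intro s
  rw [F.s_smul, ← polySec_act G p g f U ((piY G p).le g U)]
  exact F.M.map_smul (homOfLE ((piY G p).le g U)) _ _

/-- The action of linear forms on `π_{Y*} F` by multiplication. -/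
def pushLin : LinAct p ((GSheaf.push (piY G p)).obj F).M (Vd n) where
  a m := polyMul F.M (linPoly m)
  add x y U := by
    suffices h : ∀ s : Γ(F.M, prY n p ⁻¹ᵁ U), polySec p U (linPoly (x + y)) • s = polySec p U (linPoly x) • s + polySec p U (linPoly y) • s from h
    intro s
    rw [map_add, map_add, add_smul]
  smul c x U := by
    suffices h : ∀ s : Γ(F.M, prY n p ⁻¹ᵁ U), polySec p U (linPoly (c • x)) • s = (prY n p).app U (scal p U c) • polySec p U (linPoly x) • s from h
    intro s
    rw [map_smul, MvPolynomial.smul_eq_C_mul, map_mul, polySec_C, mul_smul]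
  comm x y U := by
    suffices h : ∀ s : Γ(F.M, prY n p ⁻¹ᵁ U), polySec p U (linPoly x) • polySec p U (linPoly y) • s = polySec p U (linPoly y) • polySec p U (linPoly x) • s from h
    intro s
    exact smul_comm _ _ _

variable {W : Type} [AddCommGroup W] [Module ℂ W] [Module.Finite ℂ W] (ρ : Representation ℂ G W)

/-- The `G`-invariant part of the complex `… → ∧^k V^∨ ⊗ π_{Y*} F ⊗ ρ → … → π_{Y*} F ⊗ ρ` with differential
`(m_1 ∧ … ∧ m_k) ⊗ s ⊗ v ↦ ∑ (-1)^i (m_1 ∧ … omit m_i … ∧ m_k) ⊗ (m_i • s) ⊗ v`, the last term being in degree zero. -/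
def pointComplex : ChainComplex Y.Modules ℕ :=
  (invariants.mapHomologicalComplex _).obj (kosComplex (pushLin F) (dualRep G) ρ (fun g x U s => by
    refine (op_polyMul F g (linPoly x) U s).trans ?_
    rw [smul_linPoly]; rfl))
end
end McKayTransform

namespace McKayTransform
noncomputable section
open GSheaf

variable {n : ℕ} (G : Subgroup (Matrix.SpecialLinearGroup (Fin n) ℂ)) {Y : Scheme.{0}} (p : Y ⟶ SpecC)

/-- The function field `K(ℂ^n)`. -/
abbrev RatFun (n : ℕ) : Type := FractionRing (Poly n)

/-- The action of `g` on rational functions on `ℂ^n`. -/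
def ratAct (g : G) : RatFun n ≃+* RatFun n :=
  IsFractionRing.ringEquivOfRingEquiv (MulSemiringAction.toRingEquiv G (Poly n) g)

/-- Constant rational functions. -/
def ratC (c : ℂ) : RatFun n := algebraMap (Poly n) (RatFun n) (MvPolynomial.C c)

/-- The ring of invariants `R^G`, the coordinate ring of `ℂ^n / G`. -/
abbrev InvRing : CommRingCat.{0} := CommRingCat.of (FixedPoints.subring (Poly n) G)

/-- Constants as invariant polynomials. -/
def invC : ℂ →+* FixedPoints.subring (Poly n) G := MvPolynomial.C.codRestrict _ (fun c g => poly_smul_C G g c)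

/-- A birational morphism `q : Y → ℂ^n / G = Spec R^G` over `ℂ`. Birationality is expressed by the induced identification
`ι` of the function field `K(Y)` with `K(ℂ^n)^G = K(ℂ^n / G)`. -/
structure QuotMap [IsIntegral Y] where
  q : Y ⟶ Spec (InvRing G)
  q_over : q ≫ Spec.map (CommRingCat.ofHom (invC G)) = p
  ι : Y.functionField →+* RatFun n
  ι_range (f : RatFun n) : f ∈ ι.range ↔ ∀ g : G, ratAct G g f = f
  ι_q (f : FixedPoints.subring (Poly n) G) :
    haveI : Nonempty (⊤ : Y.Opens) := ⟨⟨genericPoint Y, trivial⟩⟩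
    ι (Y.germToFunctionField ⊤ (q.appTop ((Scheme.ΓSpecIso (InvRing G)).inv f))) = algebraMap (Poly n) (RatFun n) f.1

variable {G p} [IsIntegral Y] (B : QuotMap G p)

/-- The embedding of the local ring `O_{Y,y}` in `K(ℂ^n)`. -/
def QuotMap.stalkHom (y : Y) : Y.presheaf.stalk y →+* RatFun n := B.ι.comp (algebraMap _ Y.functionField)

theorem QuotMap.stalkHom_germ (U : Y.Opens) (y z : Y) (hy : y ∈ U) (hz : z ∈ U) (a : Γ(Y, U)) :
   B.stalkHom y (Y.presheaf.germ U y hy a) = B.stalkHom z (Y.presheaf.germ U z hz a) := by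
  have : Nonempty U := ⟨⟨y, hy⟩⟩
  simp only [QuotMap.stalkHom, RingHom.comp_apply, Scheme.algebraMap_germ_eq_germToFunctionField]

/-- Characters of `G`. -/
abbrev Char (G : Subgroup (Matrix.SpecialLinearGroup (Fin n) ℂ)) : Type := G →* ℂˣ

/-- A `G`-divisor on `Y` whose sheaf `L(D)` has weight `wt` (on a smooth `Y`, `G`-Weil divisors are given by local equations):
at every point a non-zero local equation in `K(ℂ^n)`, homogeneous for `G`, of character `wt⁻¹`; near every point, one
equation serves for all points up to units of the local rings. -/
structure GDivisor where
  wt : Char G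
  eqn : Y → RatFun n
  eqn_ne (y : Y) : eqn y ≠ 0
  eqn_wt (y : Y) (g : G) : ratAct G g (eqn y) = ratC ↑(wt g)⁻¹ * eqn y
  eqn_loc (y : Y) : ∃ V : Y.Opens, y ∈ V ∧ ∀ z ∈ V, ∃ u : (Y.presheaf.stalk z)ˣ, eqn z = eqn y * B.stalkHom z u

variable {B}
theorem ratC_mul (a b : ℂ) : (ratC (n := n) (a * b)) = ratC a * ratC b := by simp [ratC]
theorem ratC_one : (ratC (n := n) 1) = 1 := by simp [ratC]

/-- The divisor `-D`. -/
def GDivisor.neg (D : GDivisor B) : GDivisor B where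
  wt := D.wt⁻¹
  eqn y := (D.eqn y)⁻¹
  eqn_ne y := inv_ne_zero (D.eqn_ne y)
  eqn_wt y g := by
    rw [map_inv₀, D.eqn_wt, mul_inv, MonoidHom.inv_apply]
    congr 1
    refine inv_eq_of_mul_eq_one_right ?_
    rw [← ratC_mul, ← Units.val_mul]
    simp [ratC_one]
  eqn_loc y := by
    obtain ⟨V, hV, h⟩ := D.eqn_loc y
    refine ⟨V, hV, fun z hz => ?_⟩
    obtain ⟨u, hu⟩ := h z hz
    refine ⟨u⁻¹, ?_⟩
    rw [hu, mul_inv]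
    congr 1
    refine inv_eq_of_mul_eq_one_right ?_
    rw [← map_mul]
    simp

instance : Neg (GDivisor B) := ⟨GDivisor.neg⟩

namespace GDivisor
variable (D : GDivisor B) {U V : Y.Opens}

/-- Sections of `L(D)` over `U`: (locally) constant functions `f` from `U` to `K(ℂ^n)` such that at every point `y` of `U`
the product of `f` with the local equation of `D` at `y` lies in `O_{Y,y}`. -/
def subgp (U : Y.Opens) : AddSubgroup (U → RatFun n) where
  carrier := {f | (∀ y : U, ∃ V : Y.Opens, y.1 ∈ V ∧ ∀ z : U, z.1 ∈ V → f z = f y) ∧ ∀ y : U, f y * D.eqn y.1 ∈ (B.stalkHom y.1).range}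
  zero_mem' := ⟨fun y => ⟨⊤, trivial, fun _ _ => rfl⟩, fun y => by simp⟩
  add_mem' := by
    rintro a b ⟨ha, ha'⟩ ⟨hb, hb'⟩
    refine ⟨fun y => ?_, fun y => ?_⟩
    · obtain ⟨V, hV, h⟩ := ha y
      obtain ⟨V', hV', h'⟩ := hb y
      exact ⟨V ⊓ V', ⟨hV, hV'⟩, fun z hz => by simp [h z hz.1, h' z hz.2]⟩
    · rw [Pi.add_apply, add_mul]
      exact add_mem (ha' y) (hb' y)
  neg_mem' := by
    rintro a ⟨ha, ha'⟩
    refine ⟨fun y => ?_, fun y => ?_⟩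
    · obtain ⟨V, hV, h⟩ := ha y
      exact ⟨V, hV, fun z hz => by simp [h z hz]⟩
    · rw [Pi.neg_apply, neg_mul]
      exact neg_mem (ha' y)

/-- Restriction of sections of `L(D)`. -/
def resSect (h : V ≤ U) (s : D.subgp U) : D.subgp V :=
  ⟨fun y => s.1 ⟨y.1, h y.2⟩, fun y => by
    obtain ⟨W, hW, h'⟩ := s.2.1 ⟨y.1, h y.2⟩
    exact ⟨W, hW, fun z hz => h' ⟨z.1, h z.2⟩ hz⟩, fun y => s.2.2 ⟨y.1, h y.2⟩⟩

instance : Module Γ(Y, U) (D.subgp U) where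
  smul a s := ⟨fun y => B.stalkHom y.1 (Y.presheaf.germ U y.1 y.2 a) * s.1 y, fun y => by
    obtain ⟨W, hW, h'⟩ := s.2.1 y
    exact ⟨W, hW, fun z hz => by simp only [h' z hz, B.stalkHom_germ U z.1 y.1 z.2 y.2]⟩, fun y => by
    simp only [mul_assoc]
    exact mul_mem ⟨_, rfl⟩ (s.2.2 y)⟩
  one_smul s := Subtype.ext (funext fun y => by change B.stalkHom y.1 _ * s.1 y = _; simp)
  mul_smul a b s := Subtype.ext (funext fun y => by
    change B.stalkHom y.1 _ * s.1 y = B.stalkHom y.1 _ * (B.stalkHom y.1 _ * s.1 y)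
    rw [map_mul, map_mul, mul_assoc])
  smul_zero a := Subtype.ext (funext fun y => mul_zero _)
  smul_add a s t := Subtype.ext (funext fun y => mul_add _ _ _)
  add_smul a b s := Subtype.ext (funext fun y => by
    change B.stalkHom y.1 _ * s.1 y = B.stalkHom y.1 _ * s.1 y + B.stalkHom y.1 _ * s.1 y
    rw [map_add, map_add, add_mul])
  zero_smul s := Subtype.ext (funext fun y => by
    change B.stalkHom y.1 _ * s.1 y = 0
    rw [map_zero, map_zero, zero_mul])

theorem smul_val (a : Γ(Y, U)) (s : D.subgp U) (y : U) : (a • s).1 y = B.stalkHom y.1 (Y.presheaf.germ U y.1 y.2 a) * s.1 y := rfl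

/-- The sheaf `L(D)`, described by its sections. -/
def modData : ModData Y where
  S U := D.subgp U
  r h s := D.resSect h s
  r_add h s t := rfl
  r_smul {U V} h a s := Subtype.ext (funext fun y => by
    change _ = B.stalkHom y.1 (Y.presheaf.germ V y.1 y.2 (Y.presheaf.map (homOfLE h).op a)) * s.1 ⟨y.1, h y.2⟩
    rw [Y.presheaf.germ_res_apply]; rfl)
  r_self h s := rfl
  r_r h h' s := rfl
  glue {ι} U s hs := by
    have key (i j : ι) (y : Y) (hi : y ∈ U i) (hj : y ∈ U j) : (s i).1 ⟨y, hi⟩ = (s j).1 ⟨y, hj⟩ :=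
      congrFun (congrArg Subtype.val (hs i j)) ⟨y, hi, hj⟩
    have mem (y : ↥(iSup U)) : ∃ i, y.1 ∈ U i := TopologicalSpace.Opens.mem_iSup.1 y.2
    choose i hi using mem
    refine ⟨⟨fun y => (s (i y)).1 ⟨y.1, hi y⟩, fun y => ?_, fun y => (s (i y)).2.2 ⟨y.1, hi y⟩⟩, fun j => ?_, fun t ht => ?_⟩
    · obtain ⟨V, hV, h⟩ := (s (i y)).2.1 ⟨y.1, hi y⟩
      refine ⟨V ⊓ U (i y), ⟨hV, hi y⟩, fun z hz => ?_⟩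
      exact (key _ (i y) z.1 (hi z) hz.2).trans (h ⟨z.1, hz.2⟩ hz.1)
    · exact Subtype.ext (funext fun y => key _ _ _ _ _)
    · exact Subtype.ext (funext fun y => congrFun (congrArg Subtype.val (ht (i y))) ⟨y.1, hi y⟩)

/-- The sheaf `L(D)`, a subsheaf of the constant sheaf `K(ℂ^n)` on `Y`. -/
def L : Y.Modules := D.modData.toModules

/-- A section of `L(D)` as a function with values in `K(ℂ^n)`. -/
def fn {D : GDivisor B} (s : Γ(D.L, U)) (y : U) : RatFun n := (D.modData.get s : D.subgp U).1 y

/-- Multiplication by `a ∈ K(ℂ^n)` as a morphism `L(D) → L(E)`, when `a L(D) ⊆ L(E)`. -/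
def mulHom (D E : GDivisor B) (a : RatFun n) (h : ∀ y, a * E.eqn y * (D.eqn y)⁻¹ ∈ (B.stalkHom y).range) : D.L ⟶ E.L :=
  mkHom (M := D.L) (N := E.L) (fun U (s : D.subgp U) => (show E.subgp U from ⟨fun y => a * s.1 y, fun y => by
      obtain ⟨W, hW, h'⟩ := s.2.1 y
      exact ⟨W, hW, fun z hz => by simp only [h' z hz]⟩, fun y => by
      have := mul_mem (s.2.2 y) (h y.1)
      have e : s.1 y * D.eqn y.1 * (a * E.eqn y.1 * (D.eqn y.1)⁻¹) = a * s.1 y * E.eqn y.1 := by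
        field_simp [D.eqn_ne y.1]
      rwa [e] at this⟩))
    (fun U (s t : D.subgp U) => Subtype.ext (funext fun y => mul_add a (s.1 y) (t.1 y)))
    (fun U b (s : D.subgp U) => Subtype.ext (funext fun y => mul_left_comm a _ (s.1 y)))
    (fun h s => rfl)

theorem mulHom_fn (D E : GDivisor B) (a : RatFun n) (h) (s : Γ(D.L, U)) (y : U) : fn ((mulHom D E a h).app U s) y = a * fn s y := rfl

theorem L_ext {s t : Γ(D.L, U)} (h : ∀ y, fn s y = fn t y) : s = t :=
  Subtype.ext (α := U → RatFun n) (funext h)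

theorem mulHom_comm {D E E' F : GDivisor B} {a b : RatFun n} (h1 h2 h3 h4) : mulHom D E a h1 ≫ mulHom E F b h2 = mulHom D E' b h3 ≫ mulHom E' F a h4 := by
  ext U s
  refine F.L_ext (s := ((mulHom E F b h2).app U ((mulHom D E a h1).app U s))) (t := ((mulHom E' F a h4).app U ((mulHom D E' b h3).app U s))) fun y => ?_
  rw [mulHom_fn, mulHom_fn, mulHom_fn, mulHom_fn, mul_left_comm]

end GDivisor
end
end McKayTransform

namespace McKayTransform
noncomputable section

variable {n : ℕ}
/-- The edges `w = v ∪ {i} → v` of the `n`-dimensional cube, with `i ∉ v`; vertices are the subsets of `{1, …, n}`. -/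
structure CubeEdge (w v : Finset (Fin n)) (i : Fin n) : Prop where
  nmem : i ∉ v
  eq : w = insert i v

universe u₁ v₁
variable {C : Type u₁} [Category.{v₁} C]

/-- A cube of objects of `C`: an object at every vertex, a morphism for every edge. -/
structure Cube (n : ℕ) (C : Type u₁) [Category.{v₁} C] where
  obj : Finset (Fin n) → C
  map {w v : Finset (Fin n)} {i : Fin n} : CubeEdge w v i → (obj w ⟶ obj v)

variable [Preadditive C]

/-- Every two-dimensional face commutes. -/
def Cube.IsCommutative (Q : Cube n C) : Prop :=
  ∀ ⦃u a b v : Finset (Fin n)⦄ ⦃i j : Fin n⦄ (h₁ : CubeEdge u a j) (h₂ : CubeEdge a v i) (h₃ : CubeEdge u b i) (h₄ : CubeEdge b v j),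
    Q.map h₁ ≫ Q.map h₂ - Q.map h₃ ≫ Q.map h₄ = 0

/-- Every two-dimensional face anti-commutes. -/
def Cube.IsSkew (Q : Cube n C) : Prop :=
  ∀ ⦃u a b v : Finset (Fin n)⦄ ⦃i j : Fin n⦄ (h₁ : CubeEdge u a j) (h₂ : CubeEdge a v i) (h₃ : CubeEdge u b i) (h₄ : CubeEdge b v j),
    Q.map h₁ ≫ Q.map h₂ + Q.map h₃ ≫ Q.map h₄ = 0

/-- The position `j` (counted from one) of `i = i_j` in `w = {i_1 < … < i_k}`. -/
def pos (w : Finset (Fin n)) (i : Fin n) : ℕ := (w.filter (· ≤ i)).card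

/-- The cube with the signs `(-1)^j` on the maps that remove `i_j` from `{i_1 < … < i_k}`. -/
def Cube.skewify (Q : Cube n C) : Cube n C where
  obj := Q.obj
  map {w _ i} h := (-1 : ℤ) ^ pos w i • Q.map h

theorem pos_edge {u a b v : Finset (Fin n)} {i j : Fin n} (h₁ : CubeEdge u a j) (h₂ : CubeEdge a v i) (h₃ : CubeEdge u b i) (h₄ : CubeEdge b v j) :
    (-1 : ℤ) ^ (pos u j + pos a i) = - (-1 : ℤ) ^ (pos u i + pos b j) := by
  obtain ⟨hi, rfl⟩ := h₂
  obtain ⟨hj, rfl⟩ := h₄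
  obtain ⟨hj', rfl⟩ := h₁
  have hij : j ≠ i := fun h => hj' (by simp [h])
  simp only [pos, Finset.filter_insert, le_refl, if_true]
  rcases lt_or_gt_of_ne hij with h | h
  · simp [h.le, not_le.2 h, hi, hj, hij]
    ring
  · simp [h.le, not_le.2 h, hi, hj, hij]
    ring

theorem Cube.IsCommutative.skewify {Q : Cube n C} (h : Q.IsCommutative) : Q.skewify.IsSkew := by
  intro u a b v i j h₁ h₂ h₃ h₄
  simp only [Cube.skewify, Preadditive.zsmul_comp, Preadditive.comp_zsmul, smul_smul]
  rw [mul_comm, ← pow_add, mul_comm, ← pow_add, pos_edge h₁ h₂ h₃ h₄, neg_smul, sub_eq_zero.1 (h h₁ h₂ h₃ h₄)]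
  exact neg_add_cancel _


open Classical in
/-- The map of the cube from `w` to `v` if `w = v ∪ {i} → v` is an edge, zero otherwise. -/
def Cube.step (Q : Cube n C) (w v : Finset (Fin n)) (i : Fin n) : Q.obj w ⟶ Q.obj v := if h : CubeEdge w v i then Q.map h else 0

theorem Cube.step_step {Q : Cube n C} (h : Q.IsSkew) (k : ℕ) (u v : Finset (Fin n)) (hv : v.card = k) (i j : Fin n) :
    ∑ w : {w : Finset (Fin n) // w.card = k + 1}, Q.step u w.1 i ≫ Q.step w.1 v j + ∑ w : {w : Finset (Fin n) // w.card = k + 1}, Q.step u w.1 j ≫ Q.step w.1 v i = 0 := by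
  by_cases hc : i ≠ j ∧ i ∉ v ∧ j ∉ v ∧ u = insert i (insert j v)
  · obtain ⟨hij, hi, hj, hu⟩ := hc
    have h₁ : CubeEdge u (insert j v) i := ⟨by simp [hij, hi], hu⟩
    have h₂ : CubeEdge (insert j v) v j := ⟨hj, rfl⟩
    have h₃ : CubeEdge u (insert i v) j := ⟨by simp [hij.symm, hj], by rw [hu, Finset.insert_comm]⟩
    have h₄ : CubeEdge (insert i v) v i := ⟨hi, rfl⟩
    rw [Finset.sum_eq_single (⟨insert j v, by rw [Finset.card_insert_of_notMem hj, hv]⟩ : {w : Finset (Fin n) // w.card = k + 1}),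
      Finset.sum_eq_single (⟨insert i v, by rw [Finset.card_insert_of_notMem hi, hv]⟩ : {w : Finset (Fin n) // w.card = k + 1})]
    · simp only [step, h₁, h₂, h₃, h₄, dif_pos]
      exact h _ _ _ _
    · intro w _ hw
      rw [step, step, dif_neg (c := CubeEdge w.1 v i) (fun e => hw (Subtype.ext e.eq)), comp_zero]
    · simp
    · intro w _ hw
      rw [step, step, dif_neg (c := CubeEdge w.1 v j) (fun e => hw (Subtype.ext e.eq)), comp_zero]
    · simp
  · rw [Finset.sum_eq_zero, Finset.sum_eq_zero, add_zero]
    · intro w _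
      by_cases h₁ : CubeEdge u w.1 j
      · by_cases h₂ : CubeEdge w.1 v i
        · refine absurd ⟨fun e => h₁.nmem (by rw [h₂.eq]; simp [e]), h₂.nmem, fun e => h₁.nmem (by rw [h₂.eq]; simp [e]), ?_⟩ hc
          rw [h₁.eq, h₂.eq, Finset.insert_comm]
        · rw [step, step, dif_neg h₂, comp_zero]
      · rw [step, step, dif_neg h₁, zero_comp]
    · intro w _
      by_cases h₁ : CubeEdge u w.1 i
      · by_cases h₂ : CubeEdge w.1 v j
        · refine absurd ⟨fun e => h₁.nmem (by rw [h₂.eq]; simp [e]), fun e => h₁.nmem (by rw [h₂.eq]; simp [e]), h₂.nmem, ?_⟩ hc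
          rw [h₁.eq, h₂.eq]
        · rw [step, step, dif_neg h₂, comp_zero]
      · rw [step, step, dif_neg h₁, zero_comp]

/-- The component `w → v` of the differential of the total complex. -/
def Cube.entry (Q : Cube n C) (w v : Finset (Fin n)) : Q.obj w ⟶ Q.obj v := ∑ i, Q.step w v i

variable [HasFiniteBiproducts C]

/-- The term `⨁_{|v| = k} Q_v` of the total complex. -/
def Cube.term (Q : Cube n C) (k : ℕ) : C := ⨁ fun v : {v : Finset (Fin n) // v.card = k} => Q.obj v.1

/-- The differential of the total complex: the sum of the maps of the cube. -/
def Cube.d (Q : Cube n C) (k : ℕ) : Q.term (k + 1) ⟶ Q.term k :=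
  biproduct.matrix fun w v => Q.entry w.1 v.1

theorem matrix_comp_eq_zero {I J K : Type} [Fintype I] [Fintype J] [Fintype K] {f : I → C} {g : J → C} {h : K → C} (m : ∀ i j, f i ⟶ g j) (m' : ∀ j k, g j ⟶ h k)
    (H : ∀ i k, ∑ j, m i j ≫ m' j k = 0) : biproduct.matrix m ≫ biproduct.matrix m' = 0 := by
  apply biproduct.hom_ext'
  intro u
  apply biproduct.hom_ext
  intro v
  simpa [biproduct.lift_desc] using H u v

theorem Cube.d_comp {Q : Cube n C} (h : Q.IsSkew) (k : ℕ) : Q.d (k + 1) ≫ Q.d k = 0 := by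
  suffices H : ∀ u v : Finset (Fin n), v.card = k → ∑ w : {w : Finset (Fin n) // w.card = k + 1}, Q.entry u w.1 ≫ Q.entry w.1 v = 0 from
    matrix_comp_eq_zero _ _ fun u v => H u.1 v.1 v.2
  intro u v hv
  have e (w : Finset (Fin n)) : Q.entry u w ≫ Q.entry w v = ∑ x : Fin n × Fin n, Q.step u w x.1 ≫ Q.step w v x.2 := by
    rw [Fintype.sum_prod_type]
    simp only [entry, Preadditive.sum_comp, Preadditive.comp_sum]
    rw [Finset.sum_comm]
  simp only [e]
  rw [Finset.sum_comm]
  refine Finset.sum_involution (fun x _ => x.swap) (fun x _ => Q.step_step h k u v hv x.1 x.2) ?_ (fun _ _ => Finset.mem_univ _) (fun _ _ => rfl)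
  rintro ⟨i, j⟩ _ hne e
  obtain rfl : j = i := congrArg Prod.fst e
  refine hne (Finset.sum_eq_zero fun w _ => ?_)
  by_cases h₁ : CubeEdge u w.1 j
  · by_cases h₂ : CubeEdge w.1 v j
    · exact absurd (by rw [h₂.eq]; simp) h₁.nmem
    · rw [step, step, dif_neg h₂, comp_zero]
  · rw [step, step, dif_neg h₁, zero_comp]

/-- The total complex of a skew-commutative cube, with the vertex `∅` in degree zero. -/
def Cube.total (Q : Cube n C) (h : Q.IsSkew) : ChainComplex C ℕ :=
  ChainComplex.of Q.term Q.d (Cube.d_comp h)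
end
end McKayTransform

namespace McKayTransform
noncomputable section
open GSheaf

variable {n : ℕ} {G : Subgroup (Matrix.SpecialLinearGroup (Fin n) ℂ)} {Y : Scheme.{0}} {p : Y ⟶ SpecC} [IsIntegral Y]

/-- A basis `x_1, …, x_n` of `V^∨` of `G`-eigenvectors, with their characters `κ(x_i)`. -/
structure EigenBasis (G : Subgroup (Matrix.SpecialLinearGroup (Fin n) ℂ)) where
  x : Module.Basis (Fin n) ℂ (Vd n)
  κ : Fin n → Char G
  eigen (g : G) (i : Fin n) : dualRep G g (x i) = (κ i g : ℂ) • x i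

theorem char_edge (a b c : Char G) : b⁻¹ * c = a * ((a * b)⁻¹ * c) := by
  refine MonoidHom.ext fun g => ?_
  change (b g)⁻¹ * c g = a g * ((a g * b g)⁻¹ * c g)
  rw [mul_inv, mul_assoc, mul_inv_cancel_left]

theorem char_assoc (a b c : Char G) : a * b * c = a * (b * c) :=
  MonoidHom.ext fun g => mul_assoc (a g) (b g) (c g)

theorem char_inv {a b c : Char G} (h : c = a * b) : b⁻¹ = a * c⁻¹ := by
  subst h; ext g; simp

instance : HasFiniteBiproducts Y.Modules := Abelian.hasFiniteBiproducts

/-- The character `κ(e)` of `e = x_{i_1} ∧ … ∧ x_{i_k}`. -/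
def EigenBasis.wt (x : EigenBasis G) (e : Finset (Fin n)) : Char G := ∏ i ∈ e, x.κ i

/-- The eigenvector `x_i` as a rational function on `ℂ^n`. -/
def EigenBasis.fn (x : EigenBasis G) (i : Fin n) : RatFun n := algebraMap (Poly n) (RatFun n) (linPoly (x.x i))

variable {B : QuotMap G p} {x : EigenBasis G}

theorem EigenBasis.wt_edge (x : EigenBasis G) {w v : Finset (Fin n)} {i : Fin n} (h : CubeEdge w v i) : x.wt w = x.κ i * x.wt v := by
  rw [h.eq, EigenBasis.wt, Finset.prod_insert h.nmem]; rfl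

theorem EigenBasis.wt_edge_mul (x : EigenBasis G) {w v : Finset (Fin n)} {i : Fin n} (h : CubeEdge w v i) (χ : Char G) :
    x.wt w * χ = x.κ i * (x.wt v * χ) := by
  rw [x.wt_edge h]; exact char_assoc _ _ _

theorem EigenBasis.wt_edge_inv (x : EigenBasis G) {w v : Finset (Fin n)} {i : Fin n} (h : CubeEdge w v i) (χ : Char G) :
    (x.wt v)⁻¹ * χ = x.κ i * ((x.wt w)⁻¹ * χ) := by
  rw [x.wt_edge h]; exact char_edge _ _ _

/-- A set of `G`-divisors `D_χ` such that `G` acts on `L(D_χ)` by `χ`, and such that `⨁ L(-D_χ)` is closed under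
multiplication by the `x_i`: `x_i L(-D_{κ(x_i) χ}) ⊆ L(-D_χ)`, i.e. `(x_i) + D_{κ(x_i) χ} - D_χ` is effective. -/
structure DivFamily (B : QuotMap G p) (x : EigenBasis G) where
  D : Char G → GDivisor B
  wt (χ : Char G) : (D χ).wt = χ
  stable (i : Fin n) (χ : Char G) (y : Y) : x.fn i * (D (x.κ i * χ)).eqn y * ((D χ).eqn y)⁻¹ ∈ (B.stalkHom y).range

theorem DivFamily.stable' (S : DivFamily B x) (i : Fin n) {χ χ' : Char G} (h : χ' = x.κ i * χ) (y : Y) : x.fn i * (S.D χ').eqn y * ((S.D χ).eqn y)⁻¹ ∈ (B.stalkHom y).range := by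
  subst h; exact S.stable i χ y

theorem DivFamily.stableNeg (S : DivFamily B x) (i : Fin n) {χ χ' : Char G} (h : χ' = x.κ i * χ) (y : Y) :
    x.fn i * (-S.D χ).eqn y * ((-S.D χ').eqn y)⁻¹ ∈ (B.stalkHom y).range := by
  refine (?_ : x.fn i * ((S.D χ).eqn y)⁻¹ * (((S.D χ').eqn y)⁻¹)⁻¹ ∈ (B.stalkHom y).range)
  rw [inv_inv, mul_right_comm]
  exact S.stable' i h y

/-- Multiplication `s ↦ x_i s` from `L(-D_{κ(x_i) χ})` to `L(-D_χ)`. -/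
def DivFamily.mul (S : DivFamily B x) (i : Fin n) {χ χ' : Char G} (h : χ' = x.κ i * χ) : (-S.D χ').L ⟶ (-S.D χ).L :=
  GDivisor.mulHom _ _ (x.fn i) (S.stableNeg i h)

theorem DivFamily.mul_mul (S : DivFamily B x) {i j : Fin n} {a b c d : Char G} (h₁ : d = x.κ j * b) (h₂ : b = x.κ i * a) (h₃ : d = x.κ i * c) (h₄ : c = x.κ j * a) :
    S.mul j h₁ ≫ S.mul i h₂ - S.mul i h₃ ≫ S.mul j h₄ = 0 :=
  sub_eq_zero.2 (GDivisor.mulHom_comm (S.stableNeg j h₁) (S.stableNeg i h₂) (S.stableNeg i h₃) (S.stableNeg j h₄))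

/-- Multiplication `s ↦ x_i s` from `L(D_χ)` to `L(D_{κ(x_i) χ})`. -/
def DivFamily.mulDual (S : DivFamily B x) (i : Fin n) {χ χ' : Char G} (h : χ' = x.κ i * χ) : (S.D χ).L ⟶ (S.D χ').L :=
  GDivisor.mulHom _ _ (x.fn i) (S.stable' i h)

theorem DivFamily.mulDual_mulDual (S : DivFamily B x) {i j : Fin n} {a b c d : Char G} (h₁ : b = x.κ j * d) (h₂ : a = x.κ i * b) (h₃ : c = x.κ i * d) (h₄ : a = x.κ j * c) :
    S.mulDual j h₁ ≫ S.mulDual i h₂ - S.mulDual i h₃ ≫ S.mulDual j h₄ = 0 :=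
  sub_eq_zero.2 (GDivisor.mulHom_comm (S.stable' j h₁) (S.stable' i h₂) (S.stable' i h₃) (S.stable' j h₄))

/-- The cube with the line bundle `L(-D_{κ(e) χ})` at `e` and with the maps `s ↦ x_i s`. -/
def DivFamily.cube (S : DivFamily B x) (χ : Char G) : Cube n Y.Modules where
  obj v := (-S.D (x.wt v * χ)).L
  map {w v i} h := S.mul i (x.wt_edge_mul h χ)

theorem DivFamily.cube_comm (S : DivFamily B x) (χ : Char G) : (S.cube χ).IsCommutative := by
  intro u a b v i j h₁ h₂ h₃ h₄
  exact S.mul_mul (x.wt_edge_mul h₁ χ) (x.wt_edge_mul h₂ χ) (x.wt_edge_mul h₃ χ) (x.wt_edge_mul h₄ χ)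

/-- The cube with the line bundle `L(D_{κ(e)⁻¹ χ⁻¹})` at `e` and with the maps `s ↦ x_i s`. -/
def DivFamily.dualCube (S : DivFamily B x) (χ : Char G) : Cube n Y.Modules where
  obj v := (S.D ((x.wt v)⁻¹ * χ⁻¹)).L
  map {w v i} h := S.mulDual i (x.wt_edge_inv h χ⁻¹)

theorem DivFamily.dualCube_comm (S : DivFamily B x) (χ : Char G) : (S.dualCube χ).IsCommutative := by
  intro u a b v i j h₁ h₂ h₃ h₄
  exact S.mulDual_mulDual (x.wt_edge_inv h₁ χ⁻¹) (x.wt_edge_inv h₂ χ⁻¹) (x.wt_edge_inv h₃ χ⁻¹) (x.wt_edge_inv h₄ χ⁻¹)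

/-- The McKay quiver of `G`: its vertices are the characters, its arrows `(ψ, k)` go from `ψ` to `κ(x_k) ψ`. -/
structure McKayArrow (x : EigenBasis G) (ψ ψ' : Char G) where
  k : Fin n
  head : ψ' = x.κ k * ψ

/-- Representations of the McKay quiver in `O_Y`-modules. -/
structure McKayRep (x : EigenBasis G) (Y : Scheme.{0}) where
  N : Char G → Y.Modules
  α {ψ ψ' : Char G} : McKayArrow x ψ ψ' → (N ψ ⟶ N ψ')

/-- The associated representation of the McKay quiver: the summand `L(-D_{ψ⁻¹})`, on which `G` acts by `ψ`, at the
vertex `ψ`, and `s ↦ x_k s` for the arrow `(ψ, k)`. -/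
def DivFamily.assocRep (S : DivFamily B x) : McKayRep x Y where
  N ψ := (-S.D ψ⁻¹).L
  α {ψ ψ'} q := S.mul q.k (char_inv q.head)

/-- The restriction of a representation of the McKay quiver to `hex(ψ)`, the triangles around the vertex `ψ`, arranged as a
cube: at the subset `v` the vertex `κ(v)⁻¹ ψ`, at the edge `v ∪ {i} → v` the `x_i`-arrow `κ(v ∪ {i})⁻¹ ψ → κ(v)⁻¹ ψ`. For
`n = 3` and `G ⊆ SL_3`, both ends `∅` and `{1, 2, 3}` of the cube are the centre `ψ`, as `κ({1, 2, 3}) = 1`, and the six other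
subsets are the vertices of the hexagon. -/
def McKayRep.hex (N : McKayRep x Y) (ψ : Char G) : Cube n Y.Modules where
  obj v := N.N ((x.wt v)⁻¹ * ψ)
  map {w v i} h := N.α ⟨i, x.wt_edge_inv h ψ⟩

theorem DivFamily.hex_comm (S : DivFamily B x) (ψ : Char G) : (S.assocRep.hex ψ).IsCommutative := by
  intro u a b v i j h₁ h₂ h₃ h₄
  exact S.mul_mul (char_inv (x.wt_edge_inv h₁ ψ)) (char_inv (x.wt_edge_inv h₂ ψ)) (char_inv (x.wt_edge_inv h₃ ψ)) (char_inv (x.wt_edge_inv h₄ ψ))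

/-- Invertible sheaves: locally there is a section `e` such that `a ↦ a e` is an isomorphism from `O_Y`. -/
def IsLineBundle (M : Y.Modules) : Prop :=
  ∀ y : Y, ∃ (U : Y.Opens) (e : Γ(M, U)), y ∈ U ∧ ∀ (V : Y.Opens) (h : V ≤ U), Function.Bijective fun a : Γ(Y, V) => a • res M h e

/-- A character as a one-dimensional representation. -/
def charRep (χ : Char G) : Representation ℂ G ℂ where
  toFun g := (χ g : ℂ) • LinearMap.id
  map_one' := by simp; rfl
  map_mul' g h := by ext; simp [mul_comm]

/-- The push-forward `π_{Y*} F`, with its action of `G`. -/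
abbrev pushY (F : GSheaf (prodAct G p)) : GSheaf (GAct.triv G Y) := (GSheaf.push (piY G p)).obj F

/-- A decomposition `π_{Y*} F = ⨁_χ L(-D_χ)` as a sheaf of `O_Y ⊗ (R ⋊ G)`-modules: projections that identify
`π_{Y*} F` with the (finite) direct sum, where `G` acts on `L(-D_χ)` by `χ⁻¹` and `x_i` by multiplication in `K(ℂ^n)`. -/
structure Decomp (F : GSheaf (prodAct G p)) (S : DivFamily B x) where
  pr (χ : Char G) : (pushY F).M ⟶ (-S.D χ).L
  bij (U : Y.Opens) : Function.Bijective fun (s : Γ((pushY F).M, U)) (χ : Char G) => (pr χ).app U s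
  pr_op (χ : Char G) (g : G) (U : Y.Opens) (s : Γ((pushY F).M, U)) :
    (pr χ).app U (((pushY F).op g).app U s) = scal p U ↑(χ g)⁻¹ • (pr χ).app U s
  pr_x (χ : Char G) (i : Fin n) (U : Y.Opens) (s : Γ((pushY F).M, U)) :
    (pr χ).app U (((pushLin F).a (x.x i)).app U s) = (S.mul i rfl).app U ((pr (x.κ i * χ)).app U s)

/-- Sections over `U` of `Hom_{O_Y}(M, O_Y)`. -/
structure LocDual (M : Y.Modules) (U : Y.Opens) where
  f (V : Y.Opens) (h : V ≤ U) : Γ(M, V) →ₗ[Γ(Y, V)] Γ(Y, V)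
  res_f {V W : Y.Opens} (h : V ≤ U) (h' : W ≤ V) (m : Γ(M, V)) : f W (h'.trans h) (res M h' m) = Y.presheaf.map (homOfLE h').op (f V h m)

/-- An identification of `π_{Y*} F'` with `Hom_{O_Y}(π_{Y*} F, O_Y)` as a sheaf of `O_Y ⊗ (R ⋊ G)`-modules, where
`(g • α)(s) = α (g⁻¹ s)` and `(f • α)(s) = α (f s)`. For quasi-coherent `F'` this determines `F'`: it is the dual family. -/
structure DualFamily (F F' : GSheaf (prodAct G p)) where
  b (U : Y.Opens) : Γ((pushY F').M, U) → LocDual (pushY F).M U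
  bij (U : Y.Opens) : Function.Bijective (b U)
  add (U V : Y.Opens) (h : V ≤ U) (t t' : Γ((pushY F').M, U)) (s : Γ((pushY F).M, V)) : (b U (t + t')).f V h s = (b U t).f V h s + (b U t').f V h s
  smul (U V : Y.Opens) (h : V ≤ U) (a : Γ(Y, U)) (t : Γ((pushY F').M, U)) (s : Γ((pushY F).M, V)) :
    (b U (a • t)).f V h s = Y.presheaf.map (homOfLE h).op a * (b U t).f V h s
  res_b (U V W : Y.Opens) (h : V ≤ U) (h' : W ≤ V) (t : Γ((pushY F').M, U)) (s : Γ((pushY F).M, W)) :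
    (b V (res _ h t)).f W h' s = (b U t).f W (h'.trans h) s
  equiv (g : G) (U V : Y.Opens) (h : V ≤ U) (t : Γ((pushY F').M, U)) (s : Γ((pushY F).M, V)) :
    (b U (((pushY F').op g).app U t)).f V h s = (b U t).f V h (((pushY F).op g⁻¹).app V s)
  mul (f : Poly n) (U V : Y.Opens) (h : V ≤ U) (t : Γ((pushY F').M, U)) (s : Γ((pushY F).M, V)) :
    (b U ((polyMul F'.M f).app U t)).f V h s = (b U t).f V h ((polyMul F.M f).app V s)

end
end McKayTransform

/-! The transform is defined through a projective resolution over `R ⋊ G`, and any such resolution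
may serve: two of them are homotopy equivalent, the underived transform `psi0` is additive, and a
homotopy equivalence becomes an isomorphism in `D(Y)` (`Psi_iso_of_resolution`). For `O_0 ⊗ ρ` the
resolution to take is the Koszul complex with terms `R ⊗ ∧^k V^∨ ⊗ ρ` (`koszulResolution`). Its
terms are projective because linear lifts can be averaged over the finite group `G`
(`freeM_lifting`). Its exactness comes from the de Rham differential: up to sign, the anticommutator
of the Koszul and de Rham differentials multiplies a form with coefficients of degree `d` and
exterior degree `k` by `d + k`, and over `ℂ` this is invertible except on the constants in degree
zero (`kos_kosH`, `kos_exact`, `kos_exact_zero`).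

On a module `R ⊗ U` the transform is explicit. The pull-back of its sheaf to `Y × ℂ^n` has a global
basis coming from a basis of `U` (`freeBasis`), so that tensoring with `F` and pushing forward gives
`π_{Y*} F ⊗ U` with the diagonal action (`freeIsoG`). Polynomials move across the tensor sign onto
`F`, which turns the Koszul differential of modules into the differential on `π_{Y*} F`
(`freeMapG_comm`, `sameFormula_kos`). Taking invariants gives the assertion for arbitrary `ρ`.

If `V^∨` has a basis of eigenvectors, `∧^k V^∨ ⊗ χ` has the basis of the `e ⊗ 1`, with characters
`κ(e) χ`. A section `∑ s_e ⊗ e` is invariant exactly when every `s_e` has the weight `(κ(e) χ)⁻¹`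
(`fixed_twist_iff`), that is, lies in the summand `L(-D_{κ(e) χ})`. The invariants are thus a direct
sum of line bundles (`weightHom_isIso`), and the deletion of the `j`-th factor with sign `(-1)^j` is
an edge of the cube with its skew sign (`kos_basis`, `totalIso`). The hexagon is the same cube, with
its vertices named by `κ(v)⁻¹ χ⁻¹`.

For the dual family, multiplication in `K(ℂ^n)` identifies the dual of `L(-D)` with `L(D)`
(`GDivisor.exists_represents`). Invariance of the pairing shows that the part of weight `χ` is
`L(D_χ)` (`DualFamily.eigenBij`), and the transpose of multiplication by `x_i` is multiplication by
`x_i` (`DualFamily.pr_mul`), so the same argument applies. -/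

namespace McKayTransform
noncomputable section
open GSheaf
open scoped TensorProduct

/-! ### Exactness of the Koszul complex over the polynomial ring -/

section koszulHomotopy
variable {n : ℕ} {W : Type} [AddCommGroup W] [Module ℂ W]

/-- Multiplication of polynomials by linear forms. -/
def polyAct (n : ℕ) : Vd n →ₗ[ℂ] Poly n →ₗ[ℂ] Poly n := (LinearMap.mul ℂ (Poly n)).comp linPoly

theorem polyAct_apply (m : Vd n) (f : Poly n) : polyAct n m f = linPoly m * f := rfl

theorem polyAct_comm (x y : Vd n) (f : Poly n) : polyAct n x (polyAct n y f) = polyAct n y (polyAct n x f) :=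
  mul_left_comm _ _ _

/-- The exterior product `e ∧ -`. -/
def wedgeLeft {V : Type} [AddCommGroup V] [Module ℂ V] (e : V) (k : ℕ) : (⋀[ℂ]^k V) →ₗ[ℂ] ⋀[ℂ]^(k+1) V :=
  exteriorPower.alternatingMapLinearEquiv ((exteriorPower.ιMulti ℂ (k+1)).curryLeft e)

theorem wedgeLeft_ιMulti {V : Type} [AddCommGroup V] [Module ℂ V] (e : V) (k : ℕ) (v : Fin k → V) :
    wedgeLeft e k (exteriorPower.ιMulti ℂ k v) = exteriorPower.ιMulti ℂ (k+1) (Matrix.vecCons e v) := by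
  simp [wedgeLeft]

/-- The coordinate function `e_i` as a linear form. -/
def coordForm (i : Fin n) : Vd n := LinearMap.proj i

theorem linPoly_coordForm (i : Fin n) : linPoly (coordForm i) = (MvPolynomial.X i : Poly n) := by
  simp [linPoly, coordForm, Pi.single_apply, apply_ite]

theorem sum_coordForm (m : Vd n) : ∑ i, m (Pi.single i 1) • coordForm i = m := by
  refine LinearMap.ext fun v => (Eq.trans ?_ (LinearMap.pi_apply_eq_sum_univ m v).symm)
  rw [LinearMap.sum_apply]
  refine Finset.sum_congr rfl fun i _ => ?_
  have : (Pi.single i 1 : Fin n → ℂ) = fun j => if i = j then 1 else 0 := by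
    ext j; simp [Pi.single_apply, eq_comm]
  rw [this]
  exact mul_comm _ _

/-- The de Rham homotopy `f ⊗ u ⊗ w ↦ ∑ ∂f/∂x_i ⊗ (x_i ∧ u) ⊗ w`. -/
def kosH (n : ℕ) (W : Type) [AddCommGroup W] [Module ℂ W] (k : ℕ) :
    Poly n ⊗[ℂ] ((⋀[ℂ]^k (Vd n)) ⊗[ℂ] W) →ₗ[ℂ] Poly n ⊗[ℂ] ((⋀[ℂ]^(k+1) (Vd n)) ⊗[ℂ] W) :=
  ∑ i, TensorProduct.map (MvPolynomial.pderiv i).toLinearMap (LinearMap.rTensor W (wedgeLeft (coordForm i) k))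

theorem kosH_apply (k : ℕ) (f : Poly n) (v : Fin k → Vd n) (w : W) :
    kosH n W k (f ⊗ₜ (exteriorPower.ιMulti ℂ k v ⊗ₜ w)) =
      ∑ i, MvPolynomial.pderiv i f ⊗ₜ (exteriorPower.ιMulti ℂ (k+1) (Matrix.vecCons (coordForm i) v) ⊗ₜ w) := by
  simp [kosH, wedgeLeft_ιMulti]

/-- The Euler operator, which multiplies a monomial by its degree. -/
def euler (n : ℕ) : Poly n →ₗ[ℂ] Poly n :=
  ∑ i, (LinearMap.mulLeft ℂ (MvPolynomial.X i)).comp (MvPolynomial.pderiv i).toLinearMap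

theorem euler_apply (f : Poly n) : euler n f = ∑ i, MvPolynomial.X i * MvPolynomial.pderiv i f := by
  simp [euler]

theorem euler_monomial (d : Fin n →₀ ℕ) (c : ℂ) :
    euler n (MvPolynomial.monomial d c) = (d.degree : ℂ) • MvPolynomial.monomial d c := by
  rw [euler_apply, (MvPolynomial.isHomogeneous_monomial c rfl).sum_X_mul_pderiv, ← Nat.cast_smul_eq_nsmul ℂ]

/-- The operator that multiplies a monomial of degree `d` by `d + c`. -/
def eulerShift (n c : ℕ) : Poly n →ₗ[ℂ] Poly n := euler n + (c : ℂ) • LinearMap.id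

theorem eulerShift_apply (c : ℕ) (f : Poly n) : eulerShift n c f = euler n f + (c : ℂ) • f := rfl

/-- Leibniz's rule, the partial derivatives of the linear form `m` being the constants `m(e_i)`. The
second summand is what produces the exterior degree in the homotopy formula. -/
theorem pderiv_linPoly_mul (i : Fin n) (m : Vd n) (f : Poly n) :
    MvPolynomial.pderiv i (linPoly m * f) = linPoly m * MvPolynomial.pderiv i f + m (Pi.single i 1) • f := by
  have : MvPolynomial.pderiv i (linPoly m) = MvPolynomial.C (m (Pi.single i 1)) := by
    simp [linPoly, Pi.single_apply]
  rw [Derivation.leibniz, this, smul_eq_mul, smul_eq_mul, MvPolynomial.smul_eq_C_mul, mul_comm f]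

/-- Carrying `v j` from the front back to its place passes `j` factors. -/
theorem ιMulti_cons_removeNth {V : Type} [AddCommGroup V] [Module ℂ V] (k : ℕ) (v : Fin (k + 1) → V) (j : Fin (k + 1)) :
    exteriorPower.ιMulti ℂ (k+1) (Matrix.vecCons (v j) (j.removeNth v)) = (-1 : ℤ) ^ j.1 • exteriorPower.ιMulti ℂ (k+1) v := by
  have := (exteriorPower.ιMulti ℂ (M := V) (k+1)).map_insertNth j (v j) (j.removeNth v)
  rw [Fin.insertNth_self_removeNth] at this
  rw [this, smul_smul, ← mul_pow]
  simp

theorem tmul_zsmul_tmul {A B C : Type} [AddCommGroup A] [Module ℂ A] [AddCommGroup B] [Module ℂ B] [AddCommGroup C] [Module ℂ C]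
    (a : A) (z : ℤ) (b : B) (c : C) : a ⊗ₜ[ℂ] ((z • b) ⊗ₜ[ℂ] c) = z • (a ⊗ₜ[ℂ] (b ⊗ₜ[ℂ] c)) :=
  map_zsmul ((TensorProduct.mk ℂ A (B ⊗[ℂ] C) a) ∘ₗ (TensorProduct.mk ℂ B C).flip c) z b

/-- Only the factor `x_i` created by differentiation can be contracted, and it stands at position
one, whence the minus sign. -/
theorem kos_kosH_zero (x : Poly n ⊗[ℂ] ((⋀[ℂ]^0 (Vd n)) ⊗[ℂ] W)) :
    kos W (polyAct n) 0 (kosH n W 0 x) = - LinearMap.rTensor _ (euler n) x := by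
  suffices H : kos W (polyAct n) 0 ∘ₗ kosH n W 0 = - LinearMap.rTensor _ (euler n) from congr($H x)
  apply kos_hom_ext
  intro f v w
  simp [kosH_apply, kos_apply, polyAct_apply, linPoly_coordForm, euler_apply, TensorProduct.sum_tmul, Subsingleton.elim _ v]

theorem sum_wedgeLeft {V : Type} [AddCommGroup V] [Module ℂ V] {ι : Type} [Fintype ι] (c : ι → ℂ) (e : ι → V) (k : ℕ) (u : ⋀[ℂ]^k V) :
    ∑ i, c i • wedgeLeft (e i) k u = wedgeLeft (∑ i, c i • e i) k u := by
  have h : ∀ x : V, wedgeLeft x k = exteriorPower.alternatingMapLinearEquiv ((exteriorPower.ιMulti ℂ (k+1)).curryLeft x) := fun _ => rfl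
  simp only [h, map_sum, map_smul, LinearMap.sum_apply, LinearMap.smul_apply]

/-- The `m(e_i)` are the coordinates of `m` in the coordinate functions, so `∑ m(e_i) x_i ∧ u`
collapses to `m ∧ u`: this is the term `dm ∧ u` of Leibniz's rule. -/
theorem sum_smul_tmul_wedge (f : Poly n) (m : Vd n) (k : ℕ) (u : Fin k → Vd n) (w : W) :
    ∑ i, (m (Pi.single i 1) • f) ⊗ₜ[ℂ] (exteriorPower.ιMulti ℂ (k+1) (Matrix.vecCons (coordForm i) u) ⊗ₜ[ℂ] w) =
      f ⊗ₜ (exteriorPower.ιMulti ℂ (k+1) (Matrix.vecCons m u) ⊗ₜ w) := by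
  have h (i : Fin n) : (m (Pi.single i 1) • f) ⊗ₜ[ℂ] (exteriorPower.ιMulti ℂ (k+1) (Matrix.vecCons (coordForm i) u) ⊗ₜ[ℂ] w) =
      f ⊗ₜ[ℂ] ((m (Pi.single i 1) • wedgeLeft (coordForm i) k (exteriorPower.ιMulti ℂ k u)) ⊗ₜ[ℂ] w) := by
    rw [TensorProduct.smul_tmul, TensorProduct.smul_tmul', wedgeLeft_ιMulti]
  rw [Finset.sum_congr rfl fun i _ => h i, ← TensorProduct.tmul_sum, ← TensorProduct.sum_tmul, sum_wedgeLeft, sum_coordForm, wedgeLeft_ιMulti]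

/-- `∑_j (-1)^{j+1} ∑_i v_j ∂f/∂x_i ⊗ (x_i ∧ v_0 ∧ … omit v_j …) ⊗ w`. -/
def mixedTerm (k : ℕ) (f : Poly n) (v : Fin (k + 1) → Vd n) (w : W) : Poly n ⊗[ℂ] ((⋀[ℂ]^(k+1) (Vd n)) ⊗[ℂ] W) :=
  ∑ j : Fin (k+1), (-1 : ℤ) ^ (j.1 + 1) • ∑ i,
    (linPoly (v j) * MvPolynomial.pderiv i f) ⊗ₜ[ℂ] (exteriorPower.ιMulti ℂ (k+1) (Matrix.vecCons (coordForm i) (j.removeNth v)) ⊗ₜ[ℂ] w)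

/-- Contraction of the leading factor `x_i` returns `x_i ∂f/∂x_i`, hence minus the Euler operator.
Contraction of `v j` finds it one place further to the right, behind `x_i`, so its sign is opposite
to the one in `mixedTerm`. -/
theorem kos_kosH_tmul (k : ℕ) (f : Poly n) (v : Fin (k + 1) → Vd n) (w : W) :
    kos W (polyAct n) (k+1) (kosH n W (k+1) (f ⊗ₜ (exteriorPower.ιMulti ℂ (k+1) v ⊗ₜ w))) =
      - (euler n f ⊗ₜ (exteriorPower.ιMulti ℂ (k+1) v ⊗ₜ w)) - mixedTerm k f v w := by
  rw [kosH_apply, map_sum, mixedTerm]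
  simp only [kos_apply, polyAct_apply]
  -- Position zero is the factor put in front by the homotopy; the successors are the old factors.
  simp only [Fin.sum_univ_succ (n := k+1), Finset.sum_add_distrib, Finset.smul_sum]
  rw [Finset.sum_comm (γ := Fin n), sub_eq_add_neg, ← Finset.sum_neg_distrib, euler_apply, TensorProduct.sum_tmul, ← Finset.sum_neg_distrib]
  congr 1
  · refine Finset.sum_congr rfl fun i _ => ?_
    simp [linPoly_coordForm]
  · refine Finset.sum_congr rfl fun j _ => ?_
    rw [← Finset.sum_neg_distrib]
    refine Finset.sum_congr rfl fun i _ => ?_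
    have : Fin.removeNth j.succ (Matrix.vecCons (coordForm i) v) = Matrix.vecCons (coordForm i) (j.removeNth v) := by
      ext l : 1
      refine Fin.cases ?_ (fun l => ?_) l
      · simp [Fin.removeNth]
      · simp [Fin.removeNth]
    rw [this]
    simp [pow_succ]

set_option maxHeartbeats 1000000 in
-- Leibniz's rule for `v j` times `f`: differentiating `f` gives `mixedTerm`; differentiating `v j`
-- puts it back at the front, and the signs `(-1)^(j+1)` and `(-1)^j` combine to `-1` for each of
-- the `k + 1` factors.
theorem kosH_kos_tmul (k : ℕ) (f : Poly n) (v : Fin (k + 1) → Vd n) (w : W) :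
    kosH n W k (kos W (polyAct n) k (f ⊗ₜ (exteriorPower.ιMulti ℂ (k+1) v ⊗ₜ w))) =
      mixedTerm k f v w - ((k + 1 : ℕ) : ℂ) • (f ⊗ₜ (exteriorPower.ιMulti ℂ (k+1) v ⊗ₜ w)) := by
  rw [kos_apply, map_sum, mixedTerm]
  have (j : Fin (k+1)) : kosH n W k ((-1 : ℤ) ^ (j.1 + 1) • (polyAct n (v j) f ⊗ₜ[ℂ] (exteriorPower.ιMulti ℂ k (j.removeNth v) ⊗ₜ[ℂ] w))) =
      (-1 : ℤ) ^ (j.1 + 1) • ∑ i,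
    (linPoly (v j) * MvPolynomial.pderiv i f) ⊗ₜ[ℂ] (exteriorPower.ιMulti ℂ (k+1) (Matrix.vecCons (coordForm i) (j.removeNth v)) ⊗ₜ[ℂ] w)
      - f ⊗ₜ (exteriorPower.ιMulti ℂ (k+1) v ⊗ₜ w) := by
    rw [map_zsmul, kosH_apply]
    simp only [polyAct_apply, pderiv_linPoly_mul, TensorProduct.add_tmul, Finset.sum_add_distrib]
    rw [sum_smul_tmul_wedge, ιMulti_cons_removeNth, tmul_zsmul_tmul, smul_add, sub_eq_add_neg, smul_smul, ← pow_add,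
      show j.1 + 1 + j.1 = 2 * j.1 + 1 by ring, pow_succ _ (2 * j.1), pow_mul, neg_one_sq, one_pow, one_mul, neg_smul, one_smul]
  rw [Finset.sum_congr rfl fun j _ => this j, Finset.sum_sub_distrib, Finset.sum_const, Finset.card_univ, Fintype.card_fin,
    Nat.cast_smul_eq_nsmul ℂ]

/-- Cartan's formula for the Euler vector field, up to sign: the mixed terms cancel, and polynomial
degree plus exterior degree remains. -/
theorem kos_kosH (k : ℕ) (x : Poly n ⊗[ℂ] ((⋀[ℂ]^(k+1) (Vd n)) ⊗[ℂ] W)) :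
    kos W (polyAct n) (k+1) (kosH n W (k+1) x) + kosH n W k (kos W (polyAct n) k x) =
      - LinearMap.rTensor _ (eulerShift n (k + 1)) x := by
  suffices H : kos W (polyAct n) (k+1) ∘ₗ kosH n W (k+1) + kosH n W k ∘ₗ kos W (polyAct n) k =
      - LinearMap.rTensor _ (eulerShift n (k + 1)) from congr($H x)
  apply kos_hom_ext
  intro f v w
  rw [LinearMap.add_apply, LinearMap.comp_apply, LinearMap.comp_apply, kos_kosH_tmul, kosH_kos_tmul, LinearMap.neg_apply, LinearMap.rTensor_tmul,
    eulerShift_apply, TensorProduct.add_tmul, ← TensorProduct.smul_tmul']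
  abel

/-- The operator that divides a monomial of degree `d` by `d + c`. -/
def eulerInv (n c : ℕ) : Poly n →ₗ[ℂ] Poly n :=
  (MvPolynomial.basisMonomials (Fin n) ℂ).constr ℂ fun d => ((d.degree : ℂ) + c)⁻¹ • MvPolynomial.monomial d 1

theorem eulerInv_monomial (c : ℕ) (d : Fin n →₀ ℕ) :
    eulerInv n c (MvPolynomial.monomial d 1) = ((d.degree : ℂ) + c)⁻¹ • MvPolynomial.monomial d 1 := by
  have := (MvPolynomial.basisMonomials (Fin n) ℂ).constr_basis ℂ (fun d => ((d.degree : ℂ) + c)⁻¹ • MvPolynomial.monomial d (1 : ℂ)) d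
  rwa [MvPolynomial.coe_basisMonomials] at this

theorem poly_linearMap_ext {S : Type} [AddCommGroup S] [Module ℂ S] {φ ψ : Poly n →ₗ[ℂ] S}
    (h : ∀ d, φ (MvPolynomial.monomial d 1) = ψ (MvPolynomial.monomial d 1)) : φ = ψ :=
  (MvPolynomial.basisMonomials (Fin n) ℂ).ext fun d => by
    rw [MvPolynomial.coe_basisMonomials]; exact h d

theorem euler_comp_eulerInv {c : ℕ} (hc : c ≠ 0) : eulerShift n c ∘ₗ eulerInv n c = LinearMap.id := by
  apply poly_linearMap_ext
  intro d
  have : (d.degree : ℂ) + c ≠ 0 := by norm_cast; omega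
  simp only [LinearMap.comp_apply, eulerInv_monomial, map_smul, eulerShift_apply, euler_monomial, LinearMap.id_apply, ← add_smul, smul_smul, inv_mul_cancel₀ this, one_smul]

theorem eulerInv_comp_euler {c : ℕ} (hc : c ≠ 0) : eulerInv n c ∘ₗ eulerShift n c = LinearMap.id := by
  apply poly_linearMap_ext
  intro d
  have : (d.degree : ℂ) + c ≠ 0 := by norm_cast; omega
  simp only [LinearMap.comp_apply, eulerShift_apply, euler_monomial, LinearMap.id_apply, ← add_smul, map_smul, eulerInv_monomial, smul_smul, mul_inv_cancel₀ this, one_smul]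

/-- The constant term, as an endomorphism of the polynomial ring. -/
def constTerm (n : ℕ) : Poly n →ₗ[ℂ] Poly n := Algebra.linearMap ℂ (Poly n) ∘ₗ MvPolynomial.lcoeff ℂ 0

theorem constTerm_apply (f : Poly n) : constTerm n f = MvPolynomial.C (MvPolynomial.constantCoeff f) := rfl

/-- A monomial of positive degree is recovered, while the constant monomial is killed by `euler`.
The defect, projection to the constant term, accounts for the zeroth homology. -/
theorem eulerInv_zero_comp_euler : eulerInv n 0 ∘ₗ euler n = LinearMap.id - constTerm n := by
  apply poly_linearMap_ext
  intro d
  simp only [LinearMap.comp_apply, euler_monomial, LinearMap.sub_apply, map_smul, eulerInv_monomial, smul_smul, LinearMap.id_apply,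
    constTerm_apply, Nat.cast_zero, add_zero]
  by_cases hd : d = 0
  · subst hd
    simp
  · have : (d.degree : ℂ) ≠ 0 := by
      rw [Nat.cast_ne_zero, Ne, Finsupp.degree_eq_zero_iff]; exact hd
    rw [mul_inv_cancel₀ this, one_smul, MvPolynomial.constantCoeff_eq, MvPolynomial.coeff_monomial, if_neg hd]
    simp

/-- Every summand of a Koszul boundary carries a linear form as a factor, and linear forms have no
constant term. -/
theorem constTerm_kos (k : ℕ) (x : Poly n ⊗[ℂ] ((⋀[ℂ]^(k+1) (Vd n)) ⊗[ℂ] W)) :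
    LinearMap.rTensor _ (constTerm n) (kos W (polyAct n) k x) = 0 := by
  suffices H : LinearMap.rTensor _ (constTerm n) ∘ₗ kos W (polyAct n) k = 0 from congr($H x)
  apply kos_hom_ext
  intro f v w
  have h (m : Vd n) : MvPolynomial.constantCoeff (linPoly m) = 0 := by simp [linPoly]
  simp [kos_apply, polyAct_apply, constTerm_apply, h]

/-- No computation is needed: with `d` the Koszul differential and `h` the homotopy, both sides are
`-d h d x`, by the homotopy formula in two consecutive degrees and `d d = 0`. -/
theorem kos_euler (k : ℕ) (x : Poly n ⊗[ℂ] ((⋀[ℂ]^(k+1+1) (Vd n)) ⊗[ℂ] W)) :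
    kos W (polyAct n) (k+1) (LinearMap.rTensor _ (eulerShift n (k+1+1)) x) =
      LinearMap.rTensor _ (eulerShift n (k + 1)) (kos W (polyAct n) (k+1) x) := by
  have h1 := kos_kosH (W := W) (k + 1) x
  have h2 := kos_kosH (W := W) k (kos W (polyAct n) (k+1) x)
  have h3 := congrArg (kos W (polyAct n) (k+1)) h1
  rw [kos_kos _ polyAct_comm, map_zero, add_zero] at h2
  rw [map_add, kos_kos _ polyAct_comm, zero_add, map_neg] at h3
  exact neg_injective (h3.symm.trans h2)

theorem kos_euler_zero (x : Poly n ⊗[ℂ] ((⋀[ℂ]^1 (Vd n)) ⊗[ℂ] W)) :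
    kos W (polyAct n) 0 (LinearMap.rTensor _ (eulerShift n 1) x) =
      LinearMap.rTensor _ (euler n) (kos W (polyAct n) 0 x) := by
  have h1 := kos_kosH (W := W) 0 x
  have h2 := kos_kosH_zero (W := W) (kos W (polyAct n) 0 x)
  have h3 := congrArg (kos W (polyAct n) 0) h1
  rw [map_add, kos_kos _ polyAct_comm, zero_add, map_neg] at h3
  exact neg_injective (h3.symm.trans h2)

theorem rTensor_eq_self {S T : Type} [AddCommMonoid S] [Module ℂ S] [AddCommMonoid T] [Module ℂ T] {φ ψ : S →ₗ[ℂ] S}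
    (h : φ ∘ₗ ψ = LinearMap.id) (x : S ⊗[ℂ] T) : LinearMap.rTensor T φ (LinearMap.rTensor T ψ x) = x := by
  rw [← LinearMap.comp_apply, ← LinearMap.rTensor_comp, h, LinearMap.rTensor_id]; rfl

/-- If `d h x = -N x` and `N` commutes with `d`, then `x` is the boundary of `-N⁻¹ h x`. On the
source `N` has a right inverse everywhere; on the target a left inverse is asked for only on
boundaries and at `x`, because in degree zero the Euler operator kills the constants. -/
theorem exact_of_homotopy {A B : Type} [AddCommGroup A] [Module ℂ A] [AddCommGroup B] [Module ℂ B]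
    (d : A →ₗ[ℂ] B) (h : B → A) (NA JA : A →ₗ[ℂ] A) (NB JB : B →ₗ[ℂ] B) (x : B)
    (hx : d (h x) = - NB x) (hN : ∀ a, d (NA a) = NB (d a)) (hA : ∀ a, NA (JA a) = a) (hB : ∀ a, JB (NB (d a)) = d a) (hB' : JB (NB x) = x) :
    ∃ y, d y = x := by
  refine ⟨- JA (h x), ?_⟩
  have h3 := congrArg JB ((hN (JA (h x))).symm.trans ((congrArg d (hA _)).trans hx))
  rw [hB, map_neg, hB'] at h3
  rw [map_neg, h3, neg_neg]

/-- The Koszul complex is exact in positive degrees. -/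
theorem kos_exact (k : ℕ) (x : Poly n ⊗[ℂ] ((⋀[ℂ]^(k+1) (Vd n)) ⊗[ℂ] W)) (hx : kos W (polyAct n) k x = 0) :
    ∃ y, kos W (polyAct n) (k+1) y = x := by
  refine exact_of_homotopy (kos W (polyAct n) (k+1)) (kosH n W (k+1)) (LinearMap.rTensor _ (eulerShift n (k+1+1)))
    (LinearMap.rTensor _ (eulerInv n (k+1+1))) (LinearMap.rTensor _ (eulerShift n (k+1)))
    (LinearMap.rTensor _ (eulerInv n (k+1))) x ?_ (kos_euler k)
    (rTensor_eq_self (euler_comp_eulerInv (Nat.succ_ne_zero (k+1)))) (fun a => rTensor_eq_self (eulerInv_comp_euler (Nat.succ_ne_zero k)) _)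
    (rTensor_eq_self (eulerInv_comp_euler (Nat.succ_ne_zero k)) x)
  -- On a cycle the second half of the homotopy formula vanishes.
  have h1 := kos_kosH (W := W) k x
  rwa [hx, map_zero, add_zero] at h1

/-- The zeroth homology of the Koszul complex. -/
theorem kos_exact_zero (x : Poly n ⊗[ℂ] ((⋀[ℂ]^0 (Vd n)) ⊗[ℂ] W)) (hx : LinearMap.rTensor _ (constTerm n) x = 0) :
    ∃ y, kos W (polyAct n) 0 y = x := by
  -- In degree zero the Euler operator is inverted only on elements without constant term;
  -- boundaries are of this kind, and so is `x`.
  have key (z : Poly n ⊗[ℂ] ((⋀[ℂ]^0 (Vd n)) ⊗[ℂ] W)) (hz : LinearMap.rTensor _ (constTerm n) z = 0) :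
      LinearMap.rTensor _ (eulerInv n 0) (LinearMap.rTensor _ (euler n) z) = z := by
    rw [← LinearMap.comp_apply, ← LinearMap.rTensor_comp, eulerInv_zero_comp_euler, LinearMap.rTensor_sub, LinearMap.sub_apply, hz, sub_zero,
      LinearMap.rTensor_id]; rfl
  exact exact_of_homotopy (kos W (polyAct n) 0) (kosH n W 0) (LinearMap.rTensor _ (eulerShift n 1))
    (LinearMap.rTensor _ (eulerInv n 1)) (LinearMap.rTensor _ (euler n))
    (LinearMap.rTensor _ (eulerInv n 0)) x (kos_kosH_zero x) kos_euler_zero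
    (rTensor_eq_self (euler_comp_eulerInv one_ne_zero)) (fun a => key _ (constTerm_kos 0 a)) (key x hx)

end koszulHomotopy
end
end McKayTransform


namespace McKayTransform
noncomputable section
open GSheaf
open scoped TensorProduct

/-! ### The modules `R ⊗ U` over `R ⋊ G` and their projectivity -/

section freeModules
variable {n : ℕ} (G : Subgroup (Matrix.SpecialLinearGroup (Fin n) ℂ))

/-- The representation of `G` on polynomials. -/
def polyRep : Representation ℂ G (Poly n) where
  toFun g := (polySubst g.1).toLinearMap
  map_one' := by rw [OneMemClass.coe_one, polySubst_one]; rfl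
  map_mul' g h := by rw [MulMemClass.coe_mul, polySubst_mul]; rfl

theorem polyRep_apply (g : G) (f : Poly n) : polyRep G g f = g • f := rfl

variable {G}
variable {U : Type} [AddCommMonoid U] [Module ℂ U] (σ : Representation ℂ G U)

/-- Multiplication by polynomials on `R ⊗ U`. -/
def freeMul (n : ℕ) (U : Type) [AddCommMonoid U] [Module ℂ U] : Poly n →+* Module.End ℂ (Poly n ⊗[ℂ] U) where
  toFun f := LinearMap.rTensor U (LinearMap.mulLeft ℂ f)
  map_one' := by rw [LinearMap.mulLeft_one, LinearMap.rTensor_id]; rfl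
  map_mul' f g := by rw [LinearMap.mulLeft_mul, LinearMap.rTensor_comp]; rfl
  map_zero' := by rw [LinearMap.mulLeft_zero_eq_zero, LinearMap.rTensor_zero]
  map_add' f g := by
    rw [← LinearMap.rTensor_add]
    congr 1
    exact LinearMap.ext fun x => add_mul f g x

theorem freeMul_tmul (f r : Poly n) (u : U) : freeMul n U f (r ⊗ₜ u) = (f * r) ⊗ₜ u := rfl

/-- The action of `R ⋊ G` on `R ⊗ U`. -/
def freeHom : SkewMonoidAlgebra (Poly n) G →+* Module.End ℂ (Poly n ⊗[ℂ] U) :=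
  SkewMonoidAlgebra.liftNCRingHom (freeMul n U) ((polyRep G).tprod σ) (by
    intro f g
    apply TensorProduct.ext'
    intro r u
    change freeMul n U (g • f) ((g • r) ⊗ₜ (σ g u)) = ((polyRep G).tprod σ) g ((f * r) ⊗ₜ u)
    rw [freeMul_tmul, ← smul_mul']
    rfl)

theorem freeHom_single (g : G) (f : Poly n) :
    freeHom σ (SkewMonoidAlgebra.single g f) = freeMul n U f * ((polyRep G).tprod σ) g := SkewMonoidAlgebra.liftNC_single _ _ _ _

/-- The `R ⋊ G`-module `R ⊗ U` for a representation `U` of `G`. -/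
def FreeM (_σ : Representation ℂ G U) : Type := Poly n ⊗[ℂ] U

instance : AddCommGroup (FreeM σ) := inferInstanceAs (AddCommGroup (Poly n ⊗[ℂ] U))
instance : Module (SkewMonoidAlgebra (Poly n) G) (FreeM σ) := Module.compHom (Poly n ⊗[ℂ] U) (freeHom σ)

/-- The element `r ⊗ u`. -/
def fmk (r : Poly n) (u : U) : FreeM σ := r ⊗ₜ[ℂ] u

variable {σ}
theorem FreeM.incl_smul (f : Poly n) (x : FreeM σ) : skewIncl G (Poly n) f • x = freeMul n U f x := by
  change freeHom σ (SkewMonoidAlgebra.single 1 f) x = _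
  rw [freeHom_single, map_one, mul_one]

theorem FreeM.single_smul (g : G) (x : FreeM σ) : SkewMonoidAlgebra.single g (1 : Poly n) • x = ((polyRep G).tprod σ) g x := by
  change freeHom σ (SkewMonoidAlgebra.single g 1) x = _
  rw [freeHom_single, map_one, one_mul]

theorem incl_smul_fmk (f r : Poly n) (u : U) : skewIncl G (Poly n) f • fmk σ r u = fmk σ (f * r) u := FreeM.incl_smul f _
theorem single_smul_fmk (g : G) (r : Poly n) (u : U) :
    SkewMonoidAlgebra.single g (1 : Poly n) • fmk σ r u = fmk σ (g • r) (σ g u) := FreeM.single_smul g _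

theorem fmk_induction {P : FreeM σ → Prop} (h0 : P 0) (ht : ∀ r u, P (fmk σ r u)) (ha : ∀ x y, P x → P y → P (x + y)) (x : FreeM σ) : P x :=
  TensorProduct.induction_on (motive := P) x h0 ht ha

/-- Additive maps that commute with `R` and `G` are `R ⋊ G`-linear. -/
def skewLinear {A B : Type} [AddCommGroup A] [AddCommGroup B] [Module (SkewMonoidAlgebra (Poly n) G) A] [Module (SkewMonoidAlgebra (Poly n) G) B]
    (φ : A →+ B) (hR : ∀ (f : Poly n) x, φ (skewIncl G (Poly n) f • x) = skewIncl G (Poly n) f • φ x)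
    (hG : ∀ (g : G) x, φ (SkewMonoidAlgebra.single g (1 : Poly n) • x) = SkewMonoidAlgebra.single g (1 : Poly n) • φ x) :
    A →ₗ[SkewMonoidAlgebra (Poly n) G] B where
  toFun := φ
  map_add' := map_add φ
  map_smul' a x := by
    rw [RingHom.id_apply]
    induction a using SkewMonoidAlgebra.induction_on with
    | zero => simp
    | single g f =>
      have : SkewMonoidAlgebra.single g f = skewIncl G (Poly n) f * SkewMonoidAlgebra.single g (1 : Poly n) := by
        simp [skewIncl, SkewMonoidAlgebra.single_mul_single]
      rw [this, mul_smul, hR, hG, mul_smul]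
    | add a b ha hb => rw [add_smul, map_add, ha, hb, add_smul]

theorem skewLinear_apply {A B : Type} [AddCommGroup A] [AddCommGroup B] [Module (SkewMonoidAlgebra (Poly n) G) A] [Module (SkewMonoidAlgebra (Poly n) G) B]
    (φ : A →+ B) (hR : ∀ (f : Poly n) x, φ (skewIncl G (Poly n) f • x) = skewIncl G (Poly n) f • φ x) (hG) (x : A) : skewLinear φ hR hG x = φ x := rfl

/-- `R ⊗ U` is generated over `R` by the elements `1 ⊗ u`. -/
theorem freeM_hom_ext {B : Type} [AddCommGroup B] [Module (SkewMonoidAlgebra (Poly n) G) B]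
    {φ ψ : FreeM σ →ₗ[SkewMonoidAlgebra (Poly n) G] B} (h : ∀ u, φ (fmk σ 1 u) = ψ (fmk σ 1 u)) : φ = ψ := by
  refine LinearMap.ext fun x => ?_
  induction x using fmk_induction with
  | h0 => simp
  | ht r u =>
    have : fmk σ r u = skewIncl G (Poly n) r • fmk σ 1 u := by rw [incl_smul_fmk, mul_one]
    rw [this, map_smul, map_smul, h]
  | ha x y hx hy => rw [map_add, map_add, hx, hy]

variable (σ) in
/-- The `R ⋊ G`-linear map `R ⊗ U → A` given by an equivariant map `U → A`. -/
theorem exists_freeM_lift {A : Type} [AddCommGroup A] [Module (SkewMonoidAlgebra (Poly n) G) A] (φ : U →+ A)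
    (hc : ∀ (c : ℂ) u, φ (c • u) = skewIncl G (Poly n) (MvPolynomial.C c) • φ u)
    (hG : ∀ (g : G) u, φ (σ g u) = SkewMonoidAlgebra.single g (1 : Poly n) • φ u) :
    ∃ ψ : FreeM σ →ₗ[SkewMonoidAlgebra (Poly n) G] A, ∀ u, ψ (fmk σ 1 u) = φ u := by
  -- `A` becomes a complex vector space through the constant polynomials, so that the `R`-linear
  -- extension of `φ` is a map out of a tensor product over `ℂ`.
  let M : Module ℂ A := Module.compHom A ((skewIncl G (Poly n)).comp MvPolynomial.C)
  have smul_def (c : ℂ) (a : A) : c • a = skewIncl G (Poly n) (MvPolynomial.C c) • a := rfl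
  let ψ : Poly n ⊗[ℂ] U →ₗ[ℂ] A := TensorProduct.lift (LinearMap.mk₂ ℂ (fun f u => skewIncl G (Poly n) f • φ u)
    (fun f f' u => by rw [map_add, add_smul]) (fun c f u => by rw [MvPolynomial.smul_eq_C_mul, map_mul, mul_smul, smul_def])
    (fun f u u' => by rw [map_add, smul_add])
    (fun c f u => by rw [hc, smul_def, smul_smul, smul_smul, ← map_mul, ← map_mul, mul_comm]))
  let ψ' : FreeM σ →+ A := ψ.toAddMonoidHom
  have hψ (r : Poly n) (u : U) : ψ' (fmk σ r u) = skewIncl G (Poly n) r • φ u := rfl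
  refine ⟨skewLinear ψ' (fun f x => ?_) (fun g x => ?_), fun u => ?_⟩
  · induction x using fmk_induction with
    | h0 => rw [smul_zero, map_zero, smul_zero]
    | ht r u => rw [incl_smul_fmk, hψ, hψ, smul_smul, map_mul]
    | ha x y hx hy => rw [smul_add, map_add, map_add, smul_add, hx, hy]
  · induction x using fmk_induction with
    | h0 => rw [smul_zero, map_zero, smul_zero]
    | ht r u => rw [single_smul_fmk, hψ, hψ, hG, smul_smul, smul_smul, skew_comm]
    | ha x y hx hy => rw [smul_add, map_add, map_add, smul_add, hx, hy]
  · rw [skewLinear_apply, hψ, map_one, one_smul]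

variable (σ) in
-- The argument of Maschke's theorem. The map `u ↦ f (1 ⊗ u)` lifts through `e` as a map of vector
-- spaces. Averaging `g φ g⁻¹` over `G` makes the lift equivariant and does not change its composite
-- with `e`, since `e` and `f` are equivariant already. An equivariant map on `U` then extends to `R
-- ⊗ U`.
theorem freeM_lifting [Finite G] [Module.Projective ℂ U] {A X : Type} [AddCommGroup A] [AddCommGroup X] [Module (SkewMonoidAlgebra (Poly n) G) A]
    [Module (SkewMonoidAlgebra (Poly n) G) X] (e : A →ₗ[SkewMonoidAlgebra (Poly n) G] X) (he : Function.Surjective e)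
    (f : FreeM σ →ₗ[SkewMonoidAlgebra (Poly n) G] X) : ∃ f' : FreeM σ →ₗ[SkewMonoidAlgebra (Poly n) G] A, e ∘ₗ f' = f := by
  let M : Module ℂ A := Module.compHom A ((skewIncl G (Poly n)).comp MvPolynomial.C)
  let M' : Module ℂ X := Module.compHom X ((skewIncl G (Poly n)).comp MvPolynomial.C)
  have smul_def (c : ℂ) (a : A) : c • a = skewIncl G (Poly n) (MvPolynomial.C c) • a := rfl
  have smul_def' (c : ℂ) (a : X) : c • a = skewIncl G (Poly n) (MvPolynomial.C c) • a := rfl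
  let e' : A →ₗ[ℂ] X := { toFun := e, map_add' := map_add e, map_smul' := fun c a => map_smul e _ a }
  have hfmk (c : ℂ) (u : U) : fmk σ 1 (c • u) = skewIncl G (Poly n) (MvPolynomial.C c) • fmk σ 1 u := by
    rw [incl_smul_fmk, mul_one, ← mul_one (MvPolynomial.C c), ← MvPolynomial.smul_eq_C_mul]
    exact (TensorProduct.smul_tmul c 1 u).symm
  let f₀ : U →ₗ[ℂ] X :=
    { toFun := fun u => f (fmk σ 1 u)
      map_add' := fun u u' => by rw [← map_add]; exact congrArg f (TensorProduct.tmul_add _ _ _)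
      map_smul' := fun c u => by rw [hfmk, map_smul]; rfl }
  obtain ⟨φ, hφ⟩ := Module.projective_lifting_property e' f₀ he
  have hφ' (u : U) : e (φ u) = f (fmk σ 1 u) := congr($hφ u)
  have := Fintype.ofFinite G
  let S : G → SkewMonoidAlgebra (Poly n) G := fun g => SkewMonoidAlgebra.single g (1 : Poly n)
  have S_mul (g h : G) : S g * S h = S (g * h) := by simp [S, SkewMonoidAlgebra.single_mul_single]
  -- Constants are fixed by `G`, so the group elements act `ℂ`-linearly on `A`.
  have S_C (c : ℂ) (g : G) : S g * skewIncl G (Poly n) (MvPolynomial.C c) = skewIncl G (Poly n) (MvPolynomial.C c) * S g := by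
    rw [skew_comm, poly_smul_C]
  let av : U →+ A :=
    { toFun := fun u => ((Fintype.card G : ℂ)⁻¹) • ∑ g : G, S g • φ (σ g⁻¹ u)
      map_zero' := by simp
      map_add' := fun u u' => by simp [Finset.sum_add_distrib] }
  have av_def (u : U) : av u = ((Fintype.card G : ℂ)⁻¹) • ∑ g : G, S g • φ (σ g⁻¹ u) := rfl
  obtain ⟨ψ, hψ⟩ := exists_freeM_lift σ av
    (fun c u => by
      simp only [av_def, map_smul, smul_def, smul_smul, S_C, Finset.smul_sum]
      refine Finset.sum_congr rfl fun g _ => ?_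
      rw [← mul_assoc, ← mul_assoc, ← map_mul, ← map_mul, ← map_mul, ← map_mul, mul_comm c])
    (fun h u => by
      change av (σ h u) = S h • av u
      simp only [av_def, smul_def]
      rw [smul_smul, S_C, mul_smul]
      congr 1
      rw [Finset.smul_sum]
      -- The summation variable `g` is replaced by `h⁻¹ g`.
      refine Fintype.sum_bijective (fun g => h⁻¹ * g) (Group.mulLeft_bijective _) _ _ fun g => ?_
      rw [smul_smul, S_mul, mul_inv_cancel_left]
      congr 2
      rw [mul_inv_rev, inv_inv, map_mul]
      rfl)
  refine ⟨ψ, freeM_hom_ext fun u => ?_⟩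
  rw [LinearMap.comp_apply, hψ, av_def, smul_def, map_smul, map_sum]
  -- Every summand lies over `f (1 ⊗ u)`, so that the factor `1 / |G|` makes the average lie over it
  -- too.
  have (g : G) : e (S g • φ (σ g⁻¹ u)) = f (fmk σ 1 u) := by
    rw [map_smul, hφ', ← map_smul, single_smul_fmk, smul_one, ← Module.End.mul_apply, ← map_mul, mul_inv_cancel, map_one]
    rfl
  rw [Finset.sum_congr rfl fun g _ => this g, Finset.sum_const, Finset.card_univ, ← smul_def', ← Nat.cast_smul_eq_nsmul ℂ, smul_smul,
    inv_mul_cancel₀ (Nat.cast_ne_zero.2 Fintype.card_ne_zero), one_smul]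

variable (σ) in
/-- `R ⊗ U` as an object of the category of `R ⋊ G`-modules. -/
abbrev freeMod : ModuleCat.{0} (SkewMonoidAlgebra (Poly n) G) := ModuleCat.of _ (FreeM σ)

instance [Finite G] [Module.Projective ℂ U] : Projective (freeMod σ) where
  factors {E X} f e _ := by
    obtain ⟨f', hf'⟩ := freeM_lifting σ e.hom ((ModuleCat.epi_iff_surjective e).1 inferInstance) f.hom
    exact ⟨ModuleCat.ofHom f', ModuleCat.hom_ext hf'⟩

end freeModules

/-! ### The Koszul resolution of `O_0 ⊗ ρ` -/

section koszulResolution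
variable {n : ℕ} (G : Subgroup (Matrix.SpecialLinearGroup (Fin n) ℂ))
variable {W : Type} [AddCommGroup W] [Module ℂ W] (ρ : Representation ℂ G W)

/-- The representation `∧^k V^∨ ⊗ ρ`. -/
abbrev kosRep (k : ℕ) : Representation ℂ G ((⋀[ℂ]^k (Vd n)) ⊗[ℂ] W) := (extRep (dualRep G) k).tprod ρ

/-- The Koszul differential as an `R ⋊ G`-linear map. -/
def skewKos (k : ℕ) : FreeM (kosRep G ρ (k + 1)) →ₗ[SkewMonoidAlgebra (Poly n) G] FreeM (kosRep G ρ k) :=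
  skewLinear (A := FreeM (kosRep G ρ (k + 1))) (B := FreeM (kosRep G ρ k)) (kos W (polyAct n) k).toAddMonoidHom
    (fun f x => by
      rw [FreeM.incl_smul, FreeM.incl_smul]
      -- `R`-linearity is naturality of the Koszul differential: multiplication by `f` commutes with
      -- multiplication by linear forms.
      have := kos_nat (W := W) (W' := W) (polyAct n) (polyAct n) (LinearMap.mulLeft ℂ f) LinearMap.id LinearMap.id k (fun m s => mul_left_comm _ _ _) x
      rw [exteriorPower.map_id, exteriorPower.map_id, TensorProduct.map_id, TensorProduct.map_id] at this
      exact this.symm)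
    (fun g x => by
      rw [FreeM.single_smul, FreeM.single_smul]
      -- Naturality once more, with `g` acting on all three factors: `g` carries the product of `m`
      -- and `s` to the product of `g m` and `g s`, and `g m` is again a linear form.
      exact (kos_nat (W := W) (W' := W) (polyAct n) (polyAct n) (polyRep G g) (dualRep G g) (ρ g) k (fun m s => by
        rw [polyRep_apply, polyAct_apply, smul_mul', smul_linPoly]; rfl) x).symm)

/-- The Koszul complex of `R ⋊ G`-modules. -/
def skewKosComplex : ChainComplex (ModuleCat.{0} (SkewMonoidAlgebra (Poly n) G)) ℕ :=
  ChainComplex.of (fun k => freeMod (kosRep G ρ k)) (fun k => ModuleCat.ofHom (skewKos G ρ k)) (fun k => by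
    ext x
    exact kos_kos (polyAct n) polyAct_comm k x)

/-- The augmentation `f ⊗ u ⊗ w ↦ f(0) u w` on underlying vector spaces. -/
def kosAug (n : ℕ) (W : Type) [AddCommGroup W] [Module ℂ W] : Poly n ⊗[ℂ] ((⋀[ℂ]^0 (Vd n)) ⊗[ℂ] W) →ₗ[ℂ] W :=
  (TensorProduct.lid ℂ W).toLinearMap ∘ₗ LinearMap.rTensor W (exteriorPower.zeroEquiv ℂ (Vd n)).toLinearMap ∘ₗ
    (TensorProduct.lid ℂ _).toLinearMap ∘ₗ LinearMap.rTensor _ (MvPolynomial.lcoeff ℂ 0)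

theorem kosAug_tmul (f : Poly n) (u : ⋀[ℂ]^0 (Vd n)) (w : W) :
    kosAug n W (f ⊗ₜ (u ⊗ₜ w)) = (MvPolynomial.constantCoeff f * exteriorPower.zeroEquiv ℂ (Vd n) u) • w := by
  simp [kosAug, MvPolynomial.constantCoeff_eq, mul_smul, TensorProduct.smul_tmul']

/-- `∧^0 V^∨ ⊗ W` is a copy of `W`, so the augmentation loses nothing but the nonconstant part of
the polynomial. -/
theorem kosAug_ker (x : Poly n ⊗[ℂ] ((⋀[ℂ]^0 (Vd n)) ⊗[ℂ] W)) (hx : kosAug n W x = 0) : LinearMap.rTensor _ (constTerm n) x = 0 := by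
  have h : LinearMap.rTensor ((⋀[ℂ]^0 (Vd n)) ⊗[ℂ] W) (MvPolynomial.lcoeff ℂ (0 : Fin n →₀ ℕ)) x = 0 := by
    have inj : Function.Injective (LinearMap.rTensor W (exteriorPower.zeroEquiv ℂ (Vd n)).toLinearMap) :=
      (LinearEquiv.rTensor W (exteriorPower.zeroEquiv ℂ (Vd n))).injective
    refine (TensorProduct.lid ℂ _).injective (inj ((TensorProduct.lid ℂ W).injective ?_))
    rw [map_zero, map_zero, map_zero]
    exact hx
  rw [constTerm, LinearMap.rTensor_comp, LinearMap.comp_apply, h, map_zero]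

theorem skewRep_single (g : G) (f : Poly n) :
    skewRep G ρ (SkewMonoidAlgebra.single g f) = algebraMap ℂ (Module.End ℂ W) (MvPolynomial.constantCoeff f) * ρ g := SkewMonoidAlgebra.liftNC_single _ _ _ _

theorem originRep_incl_smul (f : Poly n) (w : W) :
    (skewIncl G (Poly n) f • (show originRep G ρ from w) : originRep G ρ) = MvPolynomial.constantCoeff f • w := by
  change skewRep G ρ (SkewMonoidAlgebra.single 1 f) w = _
  rw [skewRep_single, map_one, mul_one]
  rfl

theorem originRep_single_smul (g : G) (w : W) :
    (SkewMonoidAlgebra.single g (1 : Poly n) • (show originRep G ρ from w) : originRep G ρ) = ρ g w := by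
  change skewRep G ρ (SkewMonoidAlgebra.single g 1) w = _
  rw [skewRep_single, map_one, map_one, one_mul]

/-- The augmentation of the Koszul complex. -/
def skewAug : FreeM (kosRep G ρ 0) →ₗ[SkewMonoidAlgebra (Poly n) G] originRep G ρ :=
  skewLinear (A := FreeM (kosRep G ρ 0)) (B := originRep G ρ) (kosAug n W).toAddMonoidHom
    (fun f x => by
      rw [FreeM.incl_smul]
      refine Eq.trans ?_ (originRep_incl_smul G ρ f (kosAug n W x)).symm
      suffices H : kosAug n W ∘ₗ freeMul n _ f = MvPolynomial.constantCoeff f • kosAug n W from congr($H x)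
      apply TensorProduct.ext'
      intro r u
      revert u
      suffices H : (kosAug n W ∘ₗ freeMul n _ f) ∘ₗ TensorProduct.mk ℂ _ _ r = (MvPolynomial.constantCoeff f • kosAug n W) ∘ₗ TensorProduct.mk ℂ _ _ r from
        fun u => congr($H u)
      apply TensorProduct.ext'
      intro u w
      simp [freeMul_tmul, kosAug_tmul, mul_assoc, mul_smul])
    (fun g x => by
      rw [FreeM.single_smul]
      refine Eq.trans ?_ (originRep_single_smul G ρ g (kosAug n W x)).symm
      suffices H : kosAug n W ∘ₗ ((polyRep G).tprod (kosRep G ρ 0)) g = ρ g ∘ₗ kosAug n W from congr($H x)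
      apply TensorProduct.ext'
      intro r u
      revert u
      suffices H : (kosAug n W ∘ₗ ((polyRep G).tprod (kosRep G ρ 0)) g) ∘ₗ TensorProduct.mk ℂ _ _ r = (ρ g ∘ₗ kosAug n W) ∘ₗ TensorProduct.mk ℂ _ _ r from
        fun u => congr($H u)
      apply TensorProduct.ext'
      intro u w
      -- `G` acts trivially on `∧^0 V^∨`.
      have e : exteriorPower.zeroEquiv ℂ (Vd n) (extRep (dualRep G) 0 g u) = exteriorPower.zeroEquiv ℂ (Vd n) u :=
        congr($(exteriorPower.zeroEquiv_naturality (dualRep G g)) u)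
      change kosAug n W ((g • r) ⊗ₜ (extRep (dualRep G) 0 g u ⊗ₜ ρ g w)) = ρ g (kosAug n W (r ⊗ₜ (u ⊗ₜ w)))
      rw [kosAug_tmul, kosAug_tmul, constantCoeff_smul, e, map_smul])

/-- Linear forms vanish at the origin. -/
theorem kosAug_kos (x : Poly n ⊗[ℂ] ((⋀[ℂ]^1 (Vd n)) ⊗[ℂ] W)) : kosAug n W (kos W (polyAct n) 0 x) = 0 := by
  suffices H : kosAug n W ∘ₗ kos W (polyAct n) 0 = 0 from congr($H x)
  apply kos_hom_ext
  intro f v w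
  have h (m : Vd n) : MvPolynomial.constantCoeff (linPoly m) = 0 := by simp [linPoly]
  simp [kos_apply, polyAct_apply, kosAug_tmul, h]

theorem kosAug_surjective : Function.Surjective (kosAug n W) := fun w =>
  ⟨1 ⊗ₜ ((exteriorPower.zeroEquiv ℂ (Vd n)).symm 1 ⊗ₜ w), by simp [kosAug_tmul]⟩

theorem skewKosComplex_d (k : ℕ) : (skewKosComplex G ρ).d (k + 1) k = ModuleCat.ofHom (skewKos G ρ k) :=
  ChainComplex.of_d (fun k => freeMod (kosRep G ρ k)) (fun k => ModuleCat.ofHom (skewKos G ρ k)) k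

/-- The augmentation as a morphism of modules. -/
def skewAugHom : (skewKosComplex G ρ).X 0 ⟶ originRep G ρ :=
  show freeMod (kosRep G ρ 0) ⟶ ModuleCat.of _ (originRep G ρ) from ModuleCat.ofHom (skewAug G ρ)

theorem skewKosComplex_d_aug : (skewKosComplex G ρ).d 1 0 ≫ skewAugHom G ρ = 0 := by
  rw [skewKosComplex_d]
  ext x
  exact kosAug_kos x

instance [Finite G] (k : ℕ) : Projective ((skewKosComplex G ρ).X k) := inferInstanceAs (Projective (freeMod (kosRep G ρ k)))

/-- The Koszul resolution of `O_0 ⊗ ρ` by projective `R ⋊ G`-modules. -/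
def koszulResolution [Finite G] : ProjectiveResolution (originRep G ρ) where
  complex := skewKosComplex G ρ
  π := (ChainComplex.toSingle₀Equiv _ _).symm ⟨skewAugHom G ρ, skewKosComplex_d_aug G ρ⟩
  quasiIso := ⟨fun k => by
    cases k with
    | zero =>
      -- In degree zero the claim is exactness of `P_1 → P_0 → O_0 ⊗ ρ → 0`.
      rw [ChainComplex.quasiIsoAt₀_iff, ShortComplex.quasiIso_iff_of_zeros']
      · have hex : (ShortComplex.mk _ _ (skewKosComplex_d_aug G ρ)).Exact := by
          rw [ShortComplex.moduleCat_exact_iff]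
          intro x hx
          obtain ⟨y, hy⟩ := kos_exact_zero (W := W) x (kosAug_ker x hx)
          refine ⟨y, ?_⟩
          change (skewKosComplex G ρ).d (0 + 1) 0 y = x
          rw [skewKosComplex_d]
          exact hy
        refine (ShortComplex.exact_and_epi_g_iff_of_iso ?_).2 ⟨hex, (ModuleCat.epi_iff_surjective (skewAugHom G ρ)).2 (kosAug_surjective (n := n) (W := W))⟩
        exact ShortComplex.isoMk (Iso.refl _) (Iso.refl _) (Iso.refl _)
          ((Category.id_comp _).trans (Category.comp_id _).symm)
          ((Category.id_comp _).trans ((ChainComplex.toSingle₀Equiv_symm_apply_f_zero (skewAugHom G ρ) (skewKosComplex_d_aug G ρ)).symm.trans (Category.comp_id _).symm))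
      all_goals rfl
    | succ k =>
      -- The target complex vanishes in positive degrees, so the claim is exactness of the Koszul
      -- complex.
      rw [quasiIsoAt_iff_exactAt']
      · rw [HomologicalComplex.exactAt_iff' _ (k + 1 + 1) (k + 1) k (by simp) (by simp), ShortComplex.moduleCat_exact_iff]
        intro x hx
        change (skewKosComplex G ρ).d (k + 1) k x = 0 at hx
        rw [skewKosComplex_d] at hx
        obtain ⟨y, hy⟩ := kos_exact (W := W) k x hx
        refine ⟨y, ?_⟩
        change (skewKosComplex G ρ).d (k + 1 + 1) (k + 1) y = x
        rw [skewKosComplex_d]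
        exact hy
      · apply ChainComplex.exactAt_succ_single_obj⟩

end koszulResolution
end
end McKayTransform


namespace McKayTransform
noncomputable section
open GSheaf
open scoped TensorProduct

/-! ### Tensor products with a free sheaf -/

section freeTensor
variable {X : Scheme.{0}}

theorem isIso_of_bijective_app {M N : X.Modules} (φ : M ⟶ N) (h : ∀ U, Function.Bijective (φ.app U)) : IsIso φ := by
  rw [Scheme.Modules.Hom.isIso_iff_isIso_app]
  exact fun U => (ConcreteCategory.isIso_iff_bijective _).2 (h U)

/-- The structure sheaf described by its sections. -/
def structData (X : Scheme.{0}) : ModData X where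
  S U := Γ(X, U)
  r h s := X.presheaf.map (homOfLE h).op s
  r_add h s t := map_add _ s t
  r_smul h a s := map_mul _ a s
  r_self {U} h s := by
    have : (homOfLE h).op = 𝟙 (Opposite.op U) := rfl
    rw [this, CategoryTheory.Functor.map_id]; rfl
  r_r h h' s := rmap_rmap h h' (h'.trans h) s
  glue U s hs := X.sheaf.existsUnique_gluing U s hs

/-- The structure sheaf as a module. -/
def structMod (X : Scheme.{0}) : X.Modules := (structData X).toModules

/-- A section of the structure sheaf as a function. -/
def sfun {U : X.Opens} (a : Γ(structMod X, U)) : Γ(X, U) := (structData X).get a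

theorem sfun_add {U : X.Opens} (a b : Γ(structMod X, U)) : sfun (a + b) = sfun a + sfun b := rfl
theorem sfun_smul {U : X.Opens} (r : Γ(X, U)) (b : Γ(structMod X, U)) : sfun (r • b) = r * sfun b := rfl
theorem sfun_res {U V : X.Opens} (h : V ≤ U) (a : Γ(structMod X, U)) : sfun (res _ h a) = X.presheaf.map (homOfLE h).op (sfun a) := rfl

theorem res_smul (M : X.Modules) {U V : X.Opens} (h : V ≤ U) (r : Γ(X, U)) (s : Γ(M, U)) :
    res M h (r • s) = X.presheaf.map (homOfLE h).op r • res M h s := M.map_smul (homOfLE h) r s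
theorem res_add (M : X.Modules) {U V : X.Opens} (h : V ≤ U) (s t : Γ(M, U)) : res M h (s + t) = res M h s + res M h t :=
  map_add (M.presheaf.map (homOfLE h).op).hom s t

theorem tmul_add_right {M N : X.Modules} (U : X.Opens) (m : Γ(M, U)) (x y : Γ(N, U)) : tmul U m (x + y) = tmul U m x + tmul U m y :=
  (tmulBilin M N).add_right U m x y
theorem tmul_add_left {M N : X.Modules} (U : X.Opens) (m m' : Γ(M, U)) (x : Γ(N, U)) : tmul U (m + m') x = tmul U m x + tmul U m' x :=
  (tmulBilin M N).add_left U m m' x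
theorem tmul_smul_right {M N : X.Modules} (U : X.Opens) (r : Γ(X, U)) (m : Γ(M, U)) (x : Γ(N, U)) : tmul U m (r • x) = r • tmul U m x :=
  (tmulBilin M N).smul_right U r m x
theorem tmul_smul_left {M N : X.Modules} (U : X.Opens) (r : Γ(X, U)) (m : Γ(M, U)) (x : Γ(N, U)) : tmul U (r • m) x = r • tmul U m x :=
  (tmulBilin M N).smul_left U r m x
theorem tmul_sum_right {M N : X.Modules} (U : X.Opens) (m : Γ(M, U)) {ι : Type} (J : Finset ι) (x : ι → Γ(N, U)) :
    tmul U m (∑ i ∈ J, x i) = ∑ i ∈ J, tmul U m (x i) :=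
  map_sum (AddMonoidHom.mk' (fun x : Γ(N, U) => tmul U m x) (tmul_add_right U m)) x J

/-- A global basis `e_i` of an `O_X`-module, with its coordinate functions. -/
structure GlobalBasis (N : X.Modules) (m : ℕ) (T : X.Opens) where
  e : Fin m → Γ(N, T)
  le (V : X.Opens) : V ≤ T
  c : Fin m → (N ⟶ structMod X)
  c_e (i j : Fin m) (V : X.Opens) : sfun ((c i).app V (res N (le V) (e j))) = if i = j then 1 else 0
  sum_c (V : X.Opens) (x : Γ(N, V)) : ∑ i, sfun ((c i).app V x) • res N (le V) (e i) = x

variable {M N : X.Modules} {m : ℕ} {T : X.Opens} (b : GlobalBasis N m T)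

/-- The coordinate `M ⊗ N → M`. -/
def GlobalBasis.coordHom (M : X.Modules) (b : GlobalBasis N m T) (i : Fin m) : tensorObj M N ⟶ M :=
  Bilin.lift
  { f V s x := sfun ((b.c i).app V x) • s
    add_left V s s' x := smul_add _ _ _
    add_right V s x x' := by rw [map_add, sfun_add, add_smul]
    smul_left V r s x := smul_comm _ _ _
    smul_right V r s x := by rw [Scheme.Modules.Hom.app_smul, sfun_smul, mul_smul]
    map {U V} i' s x := by
      change res M (leOfHom i') _ = sfun ((b.c i).app V (res N (leOfHom i') x)) • res M (leOfHom i') s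
      rw [res_smul, app_res, sfun_res] }

theorem GlobalBasis.coordHom_tmul (i : Fin m) (V : X.Opens) (s : Γ(M, V)) (x : Γ(N, V)) :
    (b.coordHom M i).app V (tmul V s x) = sfun ((b.c i).app V x) • s := lift_tmul _ _ _ _

/-- The inclusion `s ↦ s ⊗ e_i` of `M` in `M ⊗ N`. -/
def GlobalBasis.incl (M : X.Modules) (b : GlobalBasis N m T) (i : Fin m) : M ⟶ tensorObj M N :=
  mkHom (M := M) (N := tensorObj M N) (fun V s => tmul V s (res N (b.le V) (b.e i)))
    (fun V s t => tmul_add_left _ _ _ _) (fun V r s => tmul_smul_left _ _ _ _)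
    (fun {U V} h s => by rw [← tmul_res, res_res])

theorem GlobalBasis.incl_app (i : Fin m) (V : X.Opens) (s : Γ(M, V)) : (b.incl M i).app V s = tmul V s (res N (b.le V) (b.e i)) := rfl

theorem GlobalBasis.incl_coordHom (i j : Fin m) (V : X.Opens) (s : Γ(M, V)) :
    (b.coordHom M i).app V ((b.incl M j).app V s) = if i = j then s else 0 := by
  rw [incl_app, coordHom_tmul, b.c_e]
  split <;> simp

theorem sum_app {M N : X.Modules} {ι : Type} (J : Finset ι) (φ : ι → (M ⟶ N)) (V : X.Opens) (s : Γ(M, V)) :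
    (∑ i ∈ J, φ i).app V s = ∑ i ∈ J, (φ i).app V s := by
  classical
  induction J using Finset.induction_on with
  | empty => rfl
  | insert i J hi ih => rw [Finset.sum_insert hi, Finset.sum_insert hi, ← ih]; rfl

/-- The tensor product is a sheafification, so its sections need not be sums of elements `s ⊗ x`. An
identity of endomorphisms can nevertheless be tested on these, where it is the expansion of `x` in
the basis. -/
theorem GlobalBasis.sum_coordHom_incl : ∑ i, b.coordHom M i ≫ b.incl M i = 𝟙 (tensorObj M N) := by
  apply tensor_ext
  intro V s x
  rw [sum_app]
  change ∑ i, (b.incl M i).app V ((b.coordHom M i).app V (tmul V s x)) = tmul V s x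
  simp only [coordHom_tmul, incl_app, tmul_smul_left, ← tmul_smul_right]
  rw [← tmul_sum_right, b.sum_c]

/-- For `N` free with basis `e_i`, every section of `M ⊗ N` is uniquely of the form `∑ s_i ⊗ e_i`. -/
theorem GlobalBasis.bijective (V : X.Opens) : Function.Bijective fun s : Fin m → Γ(M, V) => ∑ i, tmul V (s i) (res N (b.le V) (b.e i)) := by
  refine ⟨fun s t h => ?_, fun y => ⟨fun i => (b.coordHom M i).app V y, ?_⟩⟩
  · have key (s : Fin m → Γ(M, V)) (i : Fin m) : (b.coordHom M i).app V (∑ j, tmul V (s j) (res N (b.le V) (b.e j))) = s i := by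
      simp only [← incl_app]
      rw [map_sum]
      simp only [incl_coordHom, Finset.sum_ite_eq, Finset.mem_univ, if_true]
    exact funext fun i => by rw [← key s i, ← key t i]; exact congrArg _ h
  · have := congr(Scheme.Modules.Hom.app $(b.sum_coordHom_incl (M := M)) V y)
    rw [sum_app] at this
    exact this
end freeTensor

/-! ### The pull-back of the sheaf of `R ⊗ U` to `Y × ℂ^n` -/

section freePull
variable {n : ℕ} {G : Subgroup (Matrix.SpecialLinearGroup (Fin n) ℂ)} {Y : Scheme.{0}} (p : Y ⟶ SpecC)
variable {M : ModuleCat.{0} (SkewMonoidAlgebra (Poly n) G)} (t : LMod (under M))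

/-- The pull-back to `Y × ℂ^n` of the sheaf of a module. -/
abbrev pullSh : (prodSp n p).Modules := (Scheme.Modules.pullback (prC n p)).obj t.N

/-- The global section of the pull-back given by an element of the module. -/
def pbt (x : M) : Γ(pullSh p t, ⊤) := pb (prC n p) t.N ⊤ (t.d x)

theorem pbt_add (x y : M) : pbt p t (x + y) = pbt p t x + pbt p t y := by
  have h : t.d (x + y : M) = t.d x + t.d y := t.d_add x y
  rw [pbt, pbt, pbt, h, pb, pb, pb]
  exact map_add _ _ _

theorem pbt_smul (r : Poly n) (x : M) : pbt p t (skewIncl G (Poly n) r • x) = polyTop p r • pbt p t x := by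
  have h : t.d (skewIncl G (Poly n) r • x) = (Scheme.ΓSpecIso (CommRingCat.of (Poly n))).inv r • t.d x := t.d_smul r x
  rw [pbt, pbt, h, pb, pb]
  exact Scheme.Modules.Hom.app_smul _ _ _

theorem pbt_sum {ι : Type} (J : Finset ι) (x : ι → M) : pbt p t (∑ i ∈ J, x i) = ∑ i ∈ J, pbt p t (x i) :=
  map_sum (AddMonoidHom.mk' (pbt p t) (pbt_add p t)) x J

variable {p t} in
-- By adjunction a morphism out of the pull-back is a morphism out of `M~`, which is determined by
-- the images of the elements of `M`.
theorem pbt_ext {K : (prodSp n p).Modules} {φ ψ : pullSh p t ⟶ K} (h : ∀ x, φ.app ⊤ (pbt p t x) = ψ.app ⊤ (pbt p t x)) : φ = ψ := by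
  apply ((Scheme.Modules.pullbackPushforwardAdjunction (prC n p)).homEquiv t.N K).injective
  rw [Adjunction.homEquiv_unit, Adjunction.homEquiv_unit]
  apply t.ext
  intro x
  have := h x
  unfold pbt at this
  rw [pb] at this
  exact this

/-- The morphism on the pull-back given by a linear map to global sections. -/
def pbtLift {K : (prodSp n p).Modules} (f : M → Γ(K, ⊤)) (add : ∀ x y, f (x + y) = f x + f y)
    (smul : ∀ r x, f (skewIncl G (Poly n) r • x) = polyTop p r • f x) : pullSh p t ⟶ K :=
  ((Scheme.Modules.pullbackPushforwardAdjunction (prC n p)).homEquiv t.N K).symm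
    (t.lift { f := f, add := add, smul := smul })

theorem pbtLift_pbt {K : (prodSp n p).Modules} (f : M → Γ(K, ⊤)) (add : ∀ x y, f (x + y) = f x + f y)
    (smul : ∀ r x, f (skewIncl G (Poly n) r • x) = polyTop p r • f x) (x : M) :
    (pbtLift p t f add smul).app ⊤ (pbt p t x) = f x := by
  refine (pb_lift (prC n p) _ ⊤ (t.d x)).trans ?_
  exact t.lift_d _ x

/-- The action on a pull-back satisfies `g (f^* m) = f^* (g m)`, and the action on `M~` is given by
that on the elements of `M`; the restrictions only identify `⊤` with its inverse image. -/
theorem pullAct_pbt (g : G) (x : M) : (((GSheaf.pull (piC G p)).obj (tildeObj t)).s g ⊤ (pbt p t x)) =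
    res (pullSh p t) le_top (pbt p t (SkewMonoidAlgebra.single g (1 : Poly n) • x)) := by
  refine (pullAct_pb (piC G p) (tildeObj t) g ⊤ (t.d x)).trans ?_
  have h : (tildeObj t).s g ⊤ (t.d x) = res t.N le_top (t.d (gm M g x)) := tildeAct_td t g x
  rw [h]
  have h2 := pb_res (prC n p) t.N (le_top : (specAct G (Poly n)).t g ⁻¹ᵁ ⊤ ≤ ⊤) (t.d (gm M g x)) le_top
  refine (congrArg _ h2).trans ?_
  exact res_res (pullSh p t) _ _ _

/-- Naturality of the unit of the adjunction between pull-back and push-forward. -/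
theorem pullMap_pbt {M' : ModuleCat.{0} (SkewMonoidAlgebra (Poly n) G)} (t' : LMod (under M')) (φ : M ⟶ M') (x : M) :
    ((GSheaf.pull (piC G p)).map (tildeMap t t' φ)).hom.app ⊤ (pbt p t x) = pbt p t' (φ.hom x) := by
  have nat := (Scheme.Modules.pullbackPushforwardAdjunction (prC n p)).unit.naturality (tildeMap t t' φ).hom
  have := congr(Scheme.Modules.Hom.app $nat ⊤ (t.d x))
  unfold pbt
  rw [pb, pb]
  refine this.symm.trans ?_
  exact congrArg (((Scheme.Modules.pullbackPushforwardAdjunction (prC n p)).unit.app t'.N).app ⊤) (tildeHom_d t t' φ x)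

variable {U : Type} [AddCommGroup U] [Module ℂ U] [Module.Finite ℂ U] (σ : Representation ℂ G U)

/-- The `i`-th coordinate of an element of `R ⊗ U`. -/
def freeCoord (i : Fin (Module.finrank ℂ U)) : FreeM σ →+ Poly n :=
  (((TensorProduct.rid ℂ (Poly n)).toLinearMap ∘ₗ LinearMap.lTensor _ ((Module.finBasis ℂ U).coord i)) : Poly n ⊗[ℂ] U →ₗ[ℂ] Poly n).toAddMonoidHom

theorem freeCoord_fmk (i : Fin (Module.finrank ℂ U)) (r : Poly n) (u : U) :
    freeCoord σ i (fmk σ r u) = (Module.finBasis ℂ U).coord i u • r := TensorProduct.rid_tmul r ((Module.finBasis ℂ U).coord i u)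

theorem freeCoord_smul (i : Fin (Module.finrank ℂ U)) (f : Poly n) (x : FreeM σ) :
    freeCoord σ i (skewIncl G (Poly n) f • x) = f * freeCoord σ i x := by
  induction x using fmk_induction with
  | h0 => simp
  | ht r u => rw [incl_smul_fmk, freeCoord_fmk, freeCoord_fmk, mul_smul_comm]
  | ha x y hx hy => rw [smul_add, map_add, hx, hy, map_add, mul_add]

section
omit [Module.Finite ℂ U]
theorem fmk_smul (c : ℂ) (r : Poly n) (u : U) : fmk σ (c • r) u = fmk σ r (c • u) := TensorProduct.smul_tmul c r u
theorem fmk_sum {ι : Type} (J : Finset ι) (r : Poly n) (u : ι → U) : fmk σ r (∑ i ∈ J, u i) = ∑ i ∈ J, fmk σ r (u i) := TensorProduct.tmul_sum _ _ _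
theorem fmk_add_right (r : Poly n) (u u' : U) : fmk σ r (u + u') = fmk σ r u + fmk σ r u' := TensorProduct.tmul_add _ _ _
end

theorem sum_freeCoord (x : FreeM σ) : ∑ i, skewIncl G (Poly n) (freeCoord σ i x) • fmk σ 1 (Module.finBasis ℂ U i) = x := by
  induction x using fmk_induction with
  | h0 => simp
  | ht r u =>
    simp only [freeCoord_fmk, incl_smul_fmk, mul_one, fmk_smul]
    rw [← fmk_sum]
    congr 1
    exact (Module.finBasis ℂ U).sum_repr u
  | ha x y hx hy => simp only [map_add, add_smul, Finset.sum_add_distrib, hx, hy]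

variable (t : LMod (under (freeMod σ)))

/-- The `i`-th coordinate of sections of the pull-back of the sheaf of `R ⊗ U`. -/
def coordPull (i : Fin (Module.finrank ℂ U)) : pullSh p t ⟶ structMod (prodSp n p) :=
  pbtLift p t (fun x : FreeM σ => (structData (prodSp n p)).sec (U := ⊤) (polyTop p (freeCoord σ i x)))
    (fun x y => congrArg (structData (prodSp n p)).sec ((congrArg (polyTop p) (map_add (freeCoord σ i) x y)).trans (map_add (polyTop p) _ _)))
    (fun r x => congrArg (structData (prodSp n p)).sec
        ((congrArg (polyTop p) (freeCoord_smul σ i r x)).trans (map_mul (polyTop p) _ _)))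

theorem coordPull_pbt (i : Fin (Module.finrank ℂ U)) (x : FreeM σ) :
    sfun ((coordPull p σ t i).app ⊤ (pbt p t (x : freeMod σ))) = polyTop p (freeCoord σ i x) :=
  congrArg sfun (pbtLift_pbt p t _ _ _ x)

/-- The morphism `O_X → N` given by a global section. -/
def smulHom {X : Scheme.{0}} {N : X.Modules} {T : X.Opens} (hT : ∀ V, V ≤ T) (e : Γ(N, T)) : structMod X ⟶ N :=
  mkHom (M := structMod X) (N := N) (fun V a => sfun a • res N (hT V) e) (fun V a b => add_smul _ _ _) (fun V a b => by rw [sfun_smul, mul_smul])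
    (fun {U V} h a => by rw [res_smul, res_res, sfun_res])

/-- The basis of the pull-back of the sheaf of `R ⊗ U` given by a basis of `U`. -/
def freeBasis : GlobalBasis (pullSh p t) (Module.finrank ℂ U) ⊤ where
  e i := pbt p t (fmk σ 1 (Module.finBasis ℂ U i) : FreeM σ)
  le V := le_top
  c := coordPull p σ t
  c_e i j V := by
    rw [app_res, sfun_res, coordPull_pbt, freeCoord_fmk]
    simp only [Module.Basis.coord_apply, Module.Basis.repr_self, Finsupp.single_apply]
    by_cases h : i = j
    · subst h; simp
    · rw [if_neg h, if_neg (Ne.symm h)]; simp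
  sum_c V x := by
    -- Sections over `V` need not come from elements of `R ⊗ U`. The expansion is therefore turned
    -- into an identity of endomorphisms, and this can be tested on such elements.
    suffices H : ∑ i, coordPull p σ t i ≫ smulHom (fun _ => le_top) (pbt p t (fmk σ 1 (Module.finBasis ℂ U i) : FreeM σ)) = 𝟙 _ by
      have := congr(Scheme.Modules.Hom.app $H V x)
      rw [sum_app] at this
      exact this
    apply pbt_ext
    intro (x : FreeM σ)
    rw [sum_app]
    change ∑ i, sfun ((coordPull p σ t i).app ⊤ (pbt p t (x : freeMod σ))) • res _ _ (pbt p t (fmk σ 1 (Module.finBasis ℂ U i) : FreeM σ)) = pbt p t (x : freeMod σ)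
    have e := congrArg (fun y : FreeM σ => pbt p t (y : freeMod σ)) (sum_freeCoord σ x)
    refine Eq.trans ?_ e
    refine Eq.trans ?_ (pbt_sum p t _ _).symm
    refine Finset.sum_congr rfl fun i _ => ?_
    rw [coordPull_pbt, res_self]
    exact (pbt_smul p t _ _).symm

end freePull
end
end McKayTransform


namespace McKayTransform
noncomputable section
open GSheaf
open scoped TensorProduct

/-! ### The transform of `R ⊗ U` before invariants -/

section freeTransform
variable {n : ℕ} {G : Subgroup (Matrix.SpecialLinearGroup (Fin n) ℂ)} {Y : Scheme.{0}} {p : Y ⟶ SpecC} (F : GSheaf (prodAct G p))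

/-- The push-forward of the tensor product of `F` with the pull-back of the sheaf of a module. -/
abbrev tensPush {M : ModuleCat.{0} (SkewMonoidAlgebra (Poly n) G)} (t : LMod (under M)) : GSheaf (GAct.triv G Y) :=
  (GSheaf.push (piY G p)).obj ((GSheaf.tensorLeft F).obj ((GSheaf.pull (piC G p)).obj (tildeObj t)))

variable {U : Type} [AddCommGroup U] [Module ℂ U] [Module.Finite ℂ U] (σ : Representation ℂ G U) (t : LMod (under (freeMod σ)))

/-- The section of the pull-back over `V` given by `u ∈ U`. -/
def freeSec (V : Y.Opens) (u : U) : Γ(pullSh p t, prY n p ⁻¹ᵁ V) := res (pullSh p t) le_top (pbt p t (fmk σ 1 u : FreeM σ))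

section
omit [Module.Finite ℂ U]
theorem freeSec_add (V : Y.Opens) (u u' : U) : freeSec (p := p) σ t V (u + u') = freeSec σ t V u + freeSec σ t V u' := by
  have := pbt_add p t (fmk σ 1 u : FreeM σ) (fmk σ 1 u' : FreeM σ)
  rw [← fmk_add_right] at this
  exact (congrArg (res (pullSh p t) le_top) this).trans (res_add (pullSh p t) _ _ _)

theorem freeSec_mul (V : Y.Opens) (f : Poly n) (u : U) :
    res (pullSh p t) (le_top : prY n p ⁻¹ᵁ V ≤ ⊤) (pbt p t (fmk σ f u : FreeM σ)) = polySec p V f • freeSec σ t V u := by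
  have := pbt_smul p t f (fmk σ 1 u : FreeM σ)
  rw [incl_smul_fmk, mul_one] at this
  exact (congrArg (res (pullSh p t) le_top) this).trans (res_smul (pullSh p t) _ _ _)

/-- A constant is the same function on `Y × ℂ^n` whether it is pulled back from `Y` or from `ℂ^n`.
-/
theorem freeSec_smul (V : Y.Opens) (c : ℂ) (u : U) :
    freeSec (p := p) σ t V (c • u) = (prY n p).app V (scal p V c) • freeSec σ t V u := by
  rw [freeSec, ← fmk_smul, ← polySec_C, ← freeSec_mul, MvPolynomial.smul_eq_C_mul, mul_one]

theorem freeSec_res {V V' : Y.Opens} (h' : prY n p ⁻¹ᵁ V' ≤ prY n p ⁻¹ᵁ V) (u : U) :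
    res (pullSh p t) h' (freeSec σ t V u) = freeSec σ t V' u := res_res _ _ _ _

end

/-- The bilinear map `(s, u) ↦ s ⊗ u`. -/
def freeBil (V : Y.Opens) : Sec p (pushY F).M V →ₗ[ℂ] U →ₗ[ℂ] Sec p (tensPush F t).M V :=
  LinearMap.mk₂ ℂ (fun (s : Γ(F.M, prY n p ⁻¹ᵁ V)) u => (tmul (prY n p ⁻¹ᵁ V) s (freeSec σ t V u) : Γ(tensorObj F.M (pullSh p t), prY n p ⁻¹ᵁ V)))
    (fun s s' u => tmul_add_left _ _ _ _)
    (fun c s u => tmul_smul_left (prY n p ⁻¹ᵁ V) ((prY n p).app V (scal p V c)) s _)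
    (fun s u u' => by rw [freeSec_add]; exact tmul_add_right _ _ _ _)
    (fun c s u => by rw [freeSec_smul]; exact tmul_smul_right _ _ _ _)

/-- The map `s ⊗ u ↦ s ⊗ u` from `π_{Y*} F ⊗ U`. -/
def freeMap : twist p U (pushY F).M ⟶ (tensPush F t).M :=
  mkHom (M := twist p U (pushY F).M) (N := (tensPush F t).M) (fun V s => TensorProduct.lift (freeBil F σ t V) ((twistData p U _).get s))
    (fun V s s' => map_add (TensorProduct.lift (freeBil F σ t V)) _ _)
    (fun V a s => by
      suffices H : ∀ x : Sec p (pushY F).M V ⊗[ℂ] U, TensorProduct.lift (freeBil F σ t V) (a • x) = a • TensorProduct.lift (freeBil F σ t V) x from H _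
      intro x
      induction x with
      | zero => simp
      | tmul s u =>
        rw [TensorProduct.smul_tmul', TensorProduct.lift.tmul, TensorProduct.lift.tmul]
        exact tmul_smul_left (prY n p ⁻¹ᵁ V) ((prY n p).app V a) s _
      | add x y hx hy => rw [smul_add, map_add, hx, hy, map_add, smul_add])
    (fun {V V'} h s => by
      suffices H : TensorProduct.lift (freeBil F σ t V') ∘ₗ LinearMap.rTensor U (secRes p (pushY F).M h) =
          secRes p (tensPush F t).M h ∘ₗ TensorProduct.lift (freeBil F σ t V) from congr($H ((twistData p U _).get s))
      apply TensorProduct.ext'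
      intro s u
      refine Eq.trans ?_ (tmul_res (pre_mono (prY n p) h) (s : Γ(F.M, prY n p ⁻¹ᵁ V)) (freeSec σ t V u))
      rw [freeSec_res σ t]
      rfl)

theorem freeMap_app (V : Y.Opens) (x : Sec p (pushY F).M V ⊗[ℂ] U) :
    (freeMap F σ t).app V ((twistData p U _).sec x) = TensorProduct.lift (freeBil F σ t V) x := rfl

/-- A basis of `U` gives coordinates on both sides: on `π_{Y*} F ⊗ U` directly, and on the tensor
product over `Y × ℂ^n` through the global basis that it induces. The map matches these coordinates.
-/
theorem freeMap_bijective (V : Y.Opens) : Function.Bijective ((freeMap F σ t).app V) := by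
  have h1 : Function.Bijective fun (x : Sec p (pushY F).M V ⊗[ℂ] U) i => coo p U i V x :=
    ⟨fun x y h => by rw [← coo_sum p U x, ← coo_sum p U y]; exact Finset.sum_congr rfl fun i _ => congrArg (fun z : Sec p (pushY F).M V => z ⊗ₜ[ℂ] Module.finBasis ℂ U i) (congrFun h i),
      fun s => ⟨∑ j, s j ⊗ₜ[ℂ] Module.finBasis ℂ U j, funext fun i => coo_mk p U s i⟩⟩
  have h2 := ((freeBasis p σ t).bijective (M := F.M) (prY n p ⁻¹ᵁ V)).comp h1
  refine (congrArg Function.Bijective (funext fun x => ?_)).mp h2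
  refine Eq.trans ?_ (Eq.refl (TensorProduct.lift (freeBil F σ t V) x))
  symm
  conv_lhs => rw [← coo_sum p U x, map_sum]
  rfl

/-- The transform of `R ⊗ U` before taking invariants is `π_{Y*} F ⊗ U`. -/
def freeMapG : GSheaf.twistRep p (pushY F) σ ⟶ tensPush F t where
  hom := freeMap F σ t
  equivariant g V x := by
    suffices H : TensorProduct.lift (freeBil F σ t V) ∘ₗ TensorProduct.map (secMap p ((pushY F).op g) V) (σ g) =
        secMap p ((tensPush F t).op g) V ∘ₗ TensorProduct.lift (freeBil F σ t V) from congr($H ((twistData p U _).get x))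
    apply TensorProduct.ext'
    intro s u
    have le : prY n p ⁻¹ᵁ V ≤ (prodAct G p).t g ⁻¹ᵁ (prY n p ⁻¹ᵁ V) := (piY G p).le g V
    -- Written on `Y × ℂ^n`, the claim is `g (s ⊗ u) = g s ⊗ g u`.
    suffices H : ∀ s : Γ(F.M, prY n p ⁻¹ᵁ V), tmul (prY n p ⁻¹ᵁ V) (res F.M le (F.s g (prY n p ⁻¹ᵁ V) s)) (freeSec σ t V (σ g u)) =
      res (tensorObj F.M (pullSh p t)) le (((GSheaf.tensorLeft F).obj ((GSheaf.pull (piC G p)).obj (tildeObj t))).s g (prY n p ⁻¹ᵁ V) (tmul (prY n p ⁻¹ᵁ V) s (freeSec σ t V u))) from H s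
    intro s
    refine Eq.trans ?_ (congrArg _ (tensor_s F ((GSheaf.pull (piC G p)).obj (tildeObj t)) g (prY n p ⁻¹ᵁ V) s (freeSec σ t V u)).symm)
    refine Eq.trans ?_ (tmul_res le _ _)
    refine congrArg (tmul (prY n p ⁻¹ᵁ V) _) ?_
    have h1 := s_res ((GSheaf.pull (piC G p)).obj (tildeObj t)) g (le_top : prY n p ⁻¹ᵁ V ≤ ⊤) (pre_mono _ le_top) (pbt p t (fmk σ 1 u : FreeM σ))
    refine Eq.trans ?_ (congrArg _ h1.symm)
    rw [pullAct_pbt]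
    -- The polynomial `1` is invariant, so `g` sends `1 ⊗ u` to `1 ⊗ σ(g) u`.
    have h2 := single_smul_fmk (σ := σ) g 1 u
    rw [smul_one] at h2
    refine Eq.trans ?_ (congrArg (fun z : FreeM σ => res (pullSh p t) le (res (pullSh p t) (pre_mono _ le_top) (res (pullSh p t) le_top (pbt p t (z : freeMod σ))))) h2.symm)
    refine Eq.trans ?_ (res_res (pullSh p t) _ _ _).symm
    exact (res_res (pullSh p t) _ _ _).symm

/-- An equivariant morphism which is an isomorphism of sheaves is an isomorphism. -/
theorem isIso_of_hom {X : Scheme.{0}} {H : Type} [Group H] {a : GAct H X} {E E' : GSheaf a} (φ : E ⟶ E') [IsIso φ.hom] : IsIso φ := by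
  have h1 (V) (s : Γ(E.M, V)) : (inv φ.hom).app V (φ.hom.app V s) = s := congr(Scheme.Modules.Hom.app $(IsIso.hom_inv_id φ.hom) V s)
  have h2 (V) (s : Γ(E'.M, V)) : φ.hom.app V ((inv φ.hom).app V s) = s := congr(Scheme.Modules.Hom.app $(IsIso.inv_hom_id φ.hom) V s)
  refine ⟨⟨inv φ.hom, fun g V s => ?_⟩, Hom.ext (IsIso.hom_inv_id φ.hom), Hom.ext (IsIso.inv_hom_id φ.hom)⟩
  conv_lhs => rw [← h2 V s, ← φ.equivariant, h1]

instance : IsIso (freeMapG F σ t) := by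
  have : IsIso (freeMapG F σ t).hom := isIso_of_bijective_app _ (freeMap_bijective F σ t)
  exact isIso_of_hom _

/-- The transform of `R ⊗ U` before taking invariants is `π_{Y*} F ⊗ U`, as an isomorphism. -/
def freeIsoG : GSheaf.twistRep p (pushY F) σ ≅ tensPush F t := asIso (freeMapG F σ t)

end freeTransform

/-! ### Comparison of the Koszul differentials -/

section koszulTransform
variable {n : ℕ} {G : Subgroup (Matrix.SpecialLinearGroup (Fin n) ℂ)} {Y : Scheme.{0}} {p : Y ⟶ SpecC} (F : GSheaf (prodAct G p))

/-- The map on `tensPush` induced by a morphism of modules. -/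
abbrev tensPushMap {M M' : ModuleCat.{0} (SkewMonoidAlgebra (Poly n) G)} (t : LMod (under M)) (t' : LMod (under M')) (φ : M ⟶ M') :
    tensPush F t ⟶ tensPush F t' :=
  (GSheaf.push (piY G p)).map ((GSheaf.tensorLeft F).map ((GSheaf.pull (piC G p)).map (tildeMap t t' φ)))

theorem tensPushMap_tmul {M M' : ModuleCat.{0} (SkewMonoidAlgebra (Poly n) G)} (t : LMod (under M)) (t' : LMod (under M')) (φ : M ⟶ M')
    (V : Y.Opens) (s : Γ(F.M, prY n p ⁻¹ᵁ V)) (x : M) :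
    (tensPushMap F t t' φ).hom.app V (tmul (prY n p ⁻¹ᵁ V) s (res (pullSh p t) le_top (pbt p t x)) : Γ(tensorObj F.M (pullSh p t), prY n p ⁻¹ᵁ V)) =
      (tmul (prY n p ⁻¹ᵁ V) s (res (pullSh p t') le_top (pbt p t' (φ.hom x))) : Γ(tensorObj F.M (pullSh p t'), prY n p ⁻¹ᵁ V)) := by
  refine (lift_tmul _ _ _ _).trans ?_
  have h := app_res ((GSheaf.pull (piC G p)).map (tildeMap t t' φ)).hom (le_top : prY n p ⁻¹ᵁ V ≤ ⊤) (pbt p t x)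
  rw [pullMap_pbt] at h
  exact congrArg (tmul (prY n p ⁻¹ᵁ V) s) h

/-- The element `s ⊗ x` of the transform. -/
def secMul {M : ModuleCat.{0} (SkewMonoidAlgebra (Poly n) G)} (t : LMod (under M)) (V : Y.Opens) (s : Sec p (pushY F).M V) (x : M) : Sec p (tensPush F t).M V :=
  (tmul (prY n p ⁻¹ᵁ V) (s : Γ(F.M, prY n p ⁻¹ᵁ V)) (res (pullSh p t) le_top (pbt p t x)) : Γ(tensorObj F.M (pullSh p t), prY n p ⁻¹ᵁ V))

theorem secMul_sum {M : ModuleCat.{0} (SkewMonoidAlgebra (Poly n) G)} (t : LMod (under M)) (V : Y.Opens) (s : Sec p (pushY F).M V) {ι : Type} (J : Finset ι) (x : ι → M) :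
    secMul F t V s (∑ i ∈ J, x i) = ∑ i ∈ J, secMul F t V s (x i) :=
  map_sum (AddMonoidHom.mk' (secMul F t V s) (fun x y => by
    unfold secMul
    rw [pbt_add, res_add]; exact tmul_add_right _ _ _ _)) x J

theorem secMul_zsmul {M : ModuleCat.{0} (SkewMonoidAlgebra (Poly n) G)} (t : LMod (under M)) (V : Y.Opens) (s : Sec p (pushY F).M V) (z : ℤ) (x : M) :
    secMul F t V s (z • x) = z • secMul F t V s x :=
  map_zsmul (AddMonoidHom.mk' (secMul F t V s) (fun x y => by
    unfold secMul
    rw [pbt_add, res_add]; exact tmul_add_right _ _ _ _)) z x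

/-- The tensor product is over the functions on `Y × ℂ^n`, so a polynomial can be moved from `R ⊗ U`
to the section of `F`. This turns multiplication in `R` into the action of linear forms on `π_{Y*}
F`. -/
theorem secMul_fmk {U : Type} [AddCommGroup U] [Module ℂ U] [Module.Finite ℂ U] (σ : Representation ℂ G U) (t : LMod (under (freeMod σ))) (V : Y.Opens) (s : Sec p (pushY F).M V) (m : Vd n) (u : U) :
    secMul F t V s (fmk σ (linPoly m) u : FreeM σ) = freeBil F σ t V ((pushLin F).lin V m s) u := by
  unfold secMul
  rw [freeSec_mul]
  exact (tmul_smul_right (prY n p ⁻¹ᵁ V) (polySec p V (linPoly m)) s _).trans (tmul_smul_left (prY n p ⁻¹ᵁ V) (polySec p V (linPoly m)) s _).symm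

variable {U U' : Type} [AddCommGroup U] [Module ℂ U] [Module.Finite ℂ U] [AddCommGroup U'] [Module ℂ U'] [Module.Finite ℂ U']
  (σ : Representation ℂ G U) (σ' : Representation ℂ G U') (D : freeMod σ' ⟶ freeMod σ)
  (DS : GSheaf.twistRep p (pushY F) σ' ⟶ GSheaf.twistRep p (pushY F) σ)

/-- Morphisms `R ⊗ U' → R ⊗ U` and `π_{Y*} F ⊗ U' → π_{Y*} F ⊗ U` given by the same formula at `u`,
as combinations of multiplications by linear forms. -/
def SameFormula (u : U') : Prop :=
  ∃ (N : ℕ) (z : Fin N → ℤ) (m : Fin N → Vd n) (w : Fin N → U),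
    D.hom (fmk σ' 1 u : FreeM σ') = (∑ i, z i • fmk σ (linPoly (m i)) (w i) : FreeM σ) ∧
    ∀ (V : Y.Opens) (s : Sec p (pushY F).M V),
      (twistData p U _).get (DS.hom.app V ((twistData p U' _).sec (s ⊗ₜ u))) = ∑ i, z i • ((pushLin F).lin V (m i) s ⊗ₜ w i)

/-- By linearity the two composites need only be compared on `s ⊗ u` with `u` in a spanning set.
There the common formula applies, and the linear forms are moved across the tensor sign. -/
theorem freeMapG_comm (gen : Set U') (hgen : Submodule.span ℂ gen = ⊤) (H : ∀ u ∈ gen, SameFormula F σ σ' D DS u)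
    (t : LMod (under (freeMod σ))) (t' : LMod (under (freeMod σ'))) :
    DS ≫ freeMapG F σ t = freeMapG F σ' t' ≫ tensPushMap F t' t D := by
  apply Hom.ext
  ext V x
  suffices key : ∀ x : Sec p (pushY F).M V ⊗[ℂ] U', (freeMap F σ t).app V (DS.hom.app V ((twistData p U' _).sec x)) =
      (tensPushMap F t' t D).hom.app V ((freeMap F σ' t').app V ((twistData p U' _).sec x)) from key ((twistData p U' _).get x)
  intro x
  induction x with
  | zero =>
    refine ((congrArg _ (map_zero (DS.hom.app V).hom)).trans (map_zero ((freeMap F σ t).app V).hom)).trans ?_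
    exact ((congrArg _ (map_zero ((freeMap F σ' t').app V).hom)).trans (map_zero ((tensPushMap F t' t D).hom.app V).hom)).symm
  | add x y hx hy =>
    refine ((congrArg _ (map_add (DS.hom.app V).hom _ _)).trans (map_add ((freeMap F σ t).app V).hom _ _)).trans ?_
    refine Eq.trans ?_ ((congrArg _ (map_add ((freeMap F σ' t').app V).hom _ _)).trans (map_add ((tensPushMap F t' t D).hom.app V).hom _ _)).symm
    exact congrArg₂ (· + ·) hx hy
  | tmul s u =>
    -- The section `s` stays arbitrary in the induction over the span, because a scalar on `u` is
    -- absorbed in `s`.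
    revert s
    have hu : u ∈ Submodule.span ℂ gen := by rw [hgen]; trivial
    induction hu using Submodule.span_induction with
    | mem u hu =>
      intro s
      obtain ⟨N, z, m, w, h1, h2⟩ := H u hu
      refine (congrArg (fun y => (freeMap F σ t).app V ((twistData p U _).sec y)) (h2 V s)).trans ?_
      refine (freeMap_app F σ t V _).trans ?_
      rw [map_sum]
      refine Eq.trans ?_ (tensPushMap_tmul F t' t D V s (fmk σ' 1 u : FreeM σ')).symm
      rw [h1]
      refine Eq.trans ?_ (secMul_sum F t V s Finset.univ _).symm
      refine Finset.sum_congr rfl fun i _ => ?_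
      rw [map_zsmul, TensorProduct.lift.tmul]
      refine Eq.trans ?_ (secMul_zsmul F t V s _ _).symm
      exact congrArg _ (secMul_fmk F σ t V s (m i) (w i)).symm
    | zero =>
      intro s
      rw [TensorProduct.tmul_zero]
      refine ((congrArg _ (map_zero (DS.hom.app V).hom)).trans (map_zero ((freeMap F σ t).app V).hom)).trans ?_
      exact ((congrArg _ (map_zero ((freeMap F σ' t').app V).hom)).trans (map_zero ((tensPushMap F t' t D).hom.app V).hom)).symm
    | add u v _ _ hu hv =>
      intro s
      rw [TensorProduct.tmul_add]
      refine ((congrArg _ (map_add (DS.hom.app V).hom _ _)).trans (map_add ((freeMap F σ t).app V).hom _ _)).trans ?_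
      refine Eq.trans ?_ ((congrArg _ (map_add ((freeMap F σ' t').app V).hom _ _)).trans (map_add ((tensPushMap F t' t D).hom.app V).hom _ _)).symm
      exact congrArg₂ (· + ·) (hu s) (hv s)
    | smul c u _ hu =>
      intro s
      rw [← TensorProduct.smul_tmul]
      exact hu (c • s)

/-- Finite-dimensional representations of `G`. -/
structure FinRep (G : Type) [Group G] where
  U : Type
  [grp : AddCommGroup U]
  [mod : Module ℂ U]
  [fin : Module.Finite ℂ U]
  σ : Representation ℂ G U

attribute [instance] FinRep.grp FinRep.mod FinRep.fin

section
variable (R : ℕ → FinRep G) (D : ∀ k, freeMod (R (k + 1)).σ ⟶ freeMod (R k).σ)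
  (DS : ∀ k, GSheaf.twistRep p (pushY F) (R (k + 1)).σ ⟶ GSheaf.twistRep p (pushY F) (R k).σ)
  (hD : ∀ k, D (k + 1) ≫ D k = 0) (hDS : ∀ k, DS (k + 1) ≫ DS k = 0)

/-- The complex of the modules `R ⊗ U_k`. -/
abbrev freeComplex : ChainComplex (ModuleCat.{0} (SkewMonoidAlgebra (Poly n) G)) ℕ := ChainComplex.of (fun k => freeMod (R k).σ) D hD

/-- The complex of the `G`-sheaves `π_{Y*} F ⊗ U_k`. -/
abbrev twistComplex : ChainComplex (GSheaf (GAct.triv G Y)) ℕ := ChainComplex.of (fun k => GSheaf.twistRep p (pushY F) (R k).σ) DS hDS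

/-- Transforms of complexes of modules `R ⊗ U_k`. -/
def psi0FreeIso (gen : ∀ k, Set (R (k + 1)).U) (hgen : ∀ k, Submodule.span ℂ (gen k) = ⊤)
    (H : ∀ k, ∀ u ∈ gen k, SameFormula F (R k).σ (R (k + 1)).σ (D k) (DS k) u) :
    (invariants.mapHomologicalComplex _).obj (twistComplex F R DS hDS) ≅ ((psi0 G p F).mapHomologicalComplex _).obj (freeComplex R D hD) :=
  HomologicalComplex.Hom.isoOfComponents (fun k => invariants.mapIso (freeIsoG F (R k).σ (tl (under (freeMod (R k).σ))))) (by
    rintro _ k rfl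
    -- The squares commute before invariants are taken; the functor of invariants is applied to
    -- them.
    have h := congrArg (fun φ => invariants.map φ) (freeMapG_comm F (R k).σ (R (k + 1)).σ (D k) (DS k) (gen k) (hgen k) (H k) (tl _) (tl _))
    simp only [Functor.map_comp] at h
    have e1 : (twistComplex F R DS hDS).d (k + 1) k = DS k := ChainComplex.of_d (fun k => GSheaf.twistRep p (pushY F) (R k).σ) DS k
    have e2 : (freeComplex R D hD).d (k + 1) k = D k := ChainComplex.of_d (fun k => freeMod (R k).σ) D k
    refine (congrArg (fun φ => invariants.map (freeIsoG F (R (k + 1)).σ (tl (under (freeMod (R (k + 1)).σ)))).hom ≫ (psi0 G p F).map φ) e2).trans ?_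
    refine h.symm.trans ?_
    exact (congrArg (fun φ => invariants.map φ ≫ invariants.map (freeIsoG F (R k).σ (tl (under (freeMod (R k).σ)))).hom) e1).symm)
end

variable {W : Type} [AddCommGroup W] [Module ℂ W] [Module.Finite ℂ W] (ρ : Representation ℂ G W)

theorem pushLin_op (g : G) (m : Vd n) (V : Y.Opens) (s : Γ((pushY F).M, V)) :
    ((pushY F).op g).app V (((pushLin F).a m).app V s) = ((pushLin F).a (dualRep G g m)).app V (((pushY F).op g).app V s) := by
  refine (op_polyMul F g (linPoly m) V s).trans ?_
  rw [smul_linPoly]; rfl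

variable {W : Type} [AddCommGroup W] [Module ℂ W] [Module.Finite ℂ W] (ρ : Representation ℂ G W)

variable (G) in
/-- The representation `∧^k V^∨ ⊗ ρ`. -/
def kosFinRep (k : ℕ) : FinRep G := ⟨(⋀[ℂ]^k (Vd n)) ⊗[ℂ] W, kosRep G ρ k⟩

/-- The differential of the Koszul complex of modules. -/
def skewKosD (k : ℕ) : freeMod (kosFinRep G ρ (k + 1)).σ ⟶ freeMod (kosFinRep G ρ k).σ := ModuleCat.ofHom (skewKos G ρ k)

/-- The Koszul differential of sheaves. -/
def kosShD (k : ℕ) : GSheaf.twistRep p (pushY F) (kosFinRep G ρ (k + 1)).σ ⟶ GSheaf.twistRep p (pushY F) (kosFinRep G ρ k).σ :=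
  kosDG (pushLin F) (dualRep G) ρ (pushLin_op F) k

/-- The Koszul formula is available on decomposable elements only; these span the exterior power. -/
theorem span_ext_tmul (k : ℕ) : Submodule.span ℂ (Set.range fun x : (Fin k → Vd n) × W => exteriorPower.ιMulti ℂ k x.1 ⊗ₜ[ℂ] x.2) = ⊤ := by
  rw [eq_top_iff, ← TensorProduct.span_tmul_eq_top, Submodule.span_le]
  rintro _ ⟨u, w, rfl⟩
  have hu : u ∈ Submodule.span ℂ (Set.range (exteriorPower.ιMulti ℂ k (M := Vd n))) := by rw [exteriorPower.ιMulti_span]; trivial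
  induction hu using Submodule.span_induction with
  | mem u hu =>
    obtain ⟨v, rfl⟩ := hu
    exact Submodule.subset_span ⟨(v, w), rfl⟩
  | zero => rw [TensorProduct.zero_tmul]; exact zero_mem _
  | add u v _ _ hu hv => rw [TensorProduct.add_tmul]; exact add_mem hu hv
  | smul c u _ hu => rw [← TensorProduct.smul_tmul']; exact Submodule.smul_mem _ c hu

/-- The general formula `kos_apply` describes both differentials: once for `V^∨` acting on `R`,
evaluated at `1`, and once for `V^∨` acting on the sections of `π_{Y*} F`. -/
theorem sameFormula_kos (k : ℕ) (v : Fin (k + 1) → Vd n) (w : W) :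
    SameFormula F (kosFinRep G ρ k).σ (kosFinRep G ρ (k + 1)).σ (skewKosD ρ k) (kosShD F ρ k) (exteriorPower.ιMulti ℂ (k + 1) v ⊗ₜ[ℂ] w : (⋀[ℂ]^(k + 1) (Vd n)) ⊗[ℂ] W) := by
  refine ⟨k + 1, fun i => (-1) ^ (i.1 + 1), v, fun i => (exteriorPower.ιMulti ℂ k (i.removeNth v) ⊗ₜ[ℂ] w : (⋀[ℂ]^k (Vd n)) ⊗[ℂ] W), ?_, fun V s => kos_apply _ k v s w⟩
  refine (kos_apply (polyAct n) k v 1 w).trans (Finset.sum_congr rfl fun i _ => ?_)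
  rw [polyAct_apply, mul_one]
  rfl

theorem skewKosD_comp (k : ℕ) : skewKosD (n := n) ρ (k + 1) ≫ skewKosD ρ k = 0 := by
  ext x
  exact kos_kos (polyAct n) polyAct_comm k x

theorem kosShD_comp (k : ℕ) : kosShD F ρ (k + 1) ≫ kosShD F ρ k = 0 := Hom.ext (kosD_comp (pushLin F) W k)

/-- The transform of the Koszul resolution. -/
def psi0KoszulIso : pointComplex F ρ ≅ ((psi0 G p F).mapHomologicalComplex _).obj (skewKosComplex G ρ) :=
  psi0FreeIso F (kosFinRep G ρ) (skewKosD ρ) (kosShD F ρ) (skewKosD_comp ρ) (kosShD_comp F ρ)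
    (fun k => Set.range fun x : (Fin (k + 1) → Vd n) × W => exteriorPower.ιMulti ℂ (k + 1) x.1 ⊗ₜ x.2) (fun k => span_ext_tmul (k + 1)) (by
      rintro k _ ⟨⟨v, w⟩, rfl⟩
      exact sameFormula_kos F ρ k v w)

end koszulTransform
end
end McKayTransform


namespace McKayTransform
noncomputable section
open GSheaf
open scoped TensorProduct

/-! ### Independence of the resolution -/

section transformInvariance
variable {n : ℕ} {G : Subgroup (Matrix.SpecialLinearGroup (Fin n) ℂ)} {Y : Scheme.{0}} {p : Y ⟶ SpecC}
variable (F : GSheaf (prodAct G p))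

/-- The sum is formed on the underlying modules, as no addition is put on equivariant morphisms.
Additivity is checked on pulled-back elements for the pull-back and on `s ⊗ x` for the tensor
product, which determine the morphisms. -/
theorem tensorPull_add {M M' : ModuleCat.{0} (SkewMonoidAlgebra (Poly n) G)} (φ ψ : M ⟶ M') :
    ((tildeG G (Poly n) ⋙ GSheaf.pull (piC G p) ⋙ GSheaf.tensorLeft F).map (φ + ψ)).hom =
      ((tildeG G (Poly n) ⋙ GSheaf.pull (piC G p) ⋙ GSheaf.tensorLeft F).map φ).hom +
      ((tildeG G (Poly n) ⋙ GSheaf.pull (piC G p) ⋙ GSheaf.tensorLeft F).map ψ).hom := by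
  have h : ((tildeG G (Poly n) ⋙ GSheaf.pull (piC G p)).map (φ + ψ)).hom =
      ((tildeG G (Poly n) ⋙ GSheaf.pull (piC G p)).map φ).hom + ((tildeG G (Poly n) ⋙ GSheaf.pull (piC G p)).map ψ).hom := by
    apply pbt_ext (p := p) (t := tl (under M))
    intro x
    refine (pullMap_pbt p (tl (under M)) (tl (under M')) (φ + ψ) x).trans ?_
    refine Eq.trans ?_ (congrArg₂ (· + ·) (pullMap_pbt p (tl (under M)) (tl (under M')) φ x) (pullMap_pbt p (tl (under M)) (tl (under M')) ψ x)).symm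
    exact pbt_add p _ (φ.hom x) (ψ.hom x)
  apply tensor_ext
  intro U s x
  refine (lift_tmul _ U s x).trans ?_
  refine Eq.trans ?_ (congrArg₂ (· + ·) (lift_tmul _ U s x) (lift_tmul _ U s x)).symm
  refine Eq.trans ?_ (tmul_add_right U s _ _)
  exact congrArg (tmul U s) congr(Scheme.Modules.Hom.app $h U x)

/-- Additivity lets the transform carry chain homotopies to chain homotopies. For invariants it is
checked after their inclusion in the whole sheaf, which is a monomorphism. -/
instance : (psi0 G p F).Additive where
  map_add {M M'} φ ψ := by
    have h := congrArg (fun f => (Scheme.Modules.pushforward (prY n p)).map f) (tensorPull_add F φ ψ)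
    let E' := (tildeG G (Poly n) ⋙ GSheaf.pull (piC G p) ⋙ GSheaf.tensorLeft F ⋙ GSheaf.push (piY G p)).obj M'
    let E := (tildeG G (Poly n) ⋙ GSheaf.pull (piC G p) ⋙ GSheaf.tensorLeft F ⋙ GSheaf.push (piY G p)).obj M
    have key (θ : M ⟶ M') : (psi0 G p F).map θ ≫ kernel.ι (Pi.lift fun g : G => E'.op g - 𝟙 E'.M) =
        kernel.ι (Pi.lift fun g : G => E.op g - 𝟙 E.M) ≫ ((tildeG G (Poly n) ⋙ GSheaf.pull (piC G p) ⋙ GSheaf.tensorLeft F ⋙ GSheaf.push (piY G p)).map θ).hom :=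
      kernel.lift_ι _ _ _
    refine (cancel_mono (kernel.ι (Pi.lift fun g : G => E'.op g - 𝟙 E'.M))).1 ?_
    refine (key (φ + ψ)).trans (Eq.trans ?_ (Preadditive.add_comp _ _ _ _ _ _).symm)
    refine Eq.trans ?_ (congrArg₂ (· + ·) (key φ) (key ψ)).symm
    refine Eq.trans ?_ (Preadditive.comp_add _ _ _ _ _ _)
    exact congrArg _ h

/-- Two projective resolutions are homotopy equivalent, and an additive functor preserves this. A
homotopy equivalence is a quasi-isomorphism, remains one after extension to cohomological degrees,
and is inverted in `D(Y)`. -/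
theorem Psi_iso_of_resolution {E : ModuleCat.{0} (SkewMonoidAlgebra (Poly n) G)} (P : ProjectiveResolution E) :
    Nonempty (Psi G p F E ≅ toD (((psi0 G p F).mapHomologicalComplex _).obj P.complex)) := by
  let e := (psi0 G p F).mapHomotopyEquiv (ProjectiveResolution.homotopyEquiv (ProjectiveResolution.of E) P)
  have : QuasiIso e.hom := inferInstance
  have h : QuasiIso (HomologicalComplex.extendMap e.hom ComplexShape.embeddingDownNat) := (HomologicalComplex.quasiIso_extendMap_iff _ _).2 this
  have : IsIso (DerivedCategory.Q.map (HomologicalComplex.extendMap e.hom ComplexShape.embeddingDownNat)) :=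
    (DerivedCategory.isIso_Q_map_iff_quasiIso _ _).2 h
  exact ⟨@asIso _ _ _ _ _ this⟩

/-- Isomorphic complexes have isomorphic objects in the derived category. -/
def toDIso {K L : ChainComplex Y.Modules ℕ} (e : K ≅ L) : toD K ≅ toD L :=
  DerivedCategory.Q.mapIso ((ComplexShape.embeddingDownNat.extendFunctor Y.Modules).mapIso e)

variable {W : Type} [AddCommGroup W] [Module ℂ W] [Module.Finite ℂ W]

theorem Psi_iso_pointComplex [Finite G] (ρ : Representation ℂ G W) : Nonempty (Psi G p F (originRep G ρ) ≅ toD (pointComplex F ρ)) := by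
  obtain ⟨e⟩ := Psi_iso_of_resolution F (koszulResolution G ρ)
  exact ⟨e ≪≫ (toDIso (psi0KoszulIso F ρ)).symm⟩

end transformInvariance
end
end McKayTransform


namespace McKayTransform
noncomputable section
open GSheaf
open scoped TensorProduct

/-! ### Sections of the sheaf of invariants -/

section invariantSections
variable {G : Type} [Group G] {Y : Scheme.{0}} (E : GSheaf (GAct.triv G Y))

/-- The sections fixed by `G`. -/
def fixedSec (U : Y.Opens) : Submodule Γ(Y, U) Γ(E.M, U) where
  carrier := {s | ∀ g, (E.op g).app U s = s}
  add_mem' {s t} hs ht g := by rw [map_add, hs g, ht g]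
  zero_mem' g := map_zero _
  smul_mem' a s hs g := by rw [Scheme.Modules.Hom.app_smul, hs g]

theorem fixedSec_res {U V : Y.Opens} (h : V ≤ U) {s : Γ(E.M, U)} (hs : s ∈ fixedSec E U) : res E.M h s ∈ fixedSec E V := fun g => by
  rw [app_res, hs g]

/-- The sheaf of fixed sections. -/
def fixedData : ModData Y where
  S U := fixedSec E U
  r h s := ⟨res E.M h s.1, fixedSec_res E h s.2⟩
  r_add h s t := Subtype.ext (res_add E.M h s.1 t.1)
  r_smul h a s := Subtype.ext (res_smul E.M h a s.1)
  r_self h s := Subtype.ext (res_self E.M h s.1)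
  r_r h h' s := Subtype.ext (res_res E.M h h' s.1)
  glue {ι} U s hs := by
    have glue := glue_mod E.M U (fun i => (s i).1) (fun i j => congrArg Subtype.val (hs i j))
    have huniq := fun {a b} => glue.unique (y₁ := a) (y₂ := b)
    obtain ⟨t, ht, ht'⟩ := glue
    -- If `t` glues the given fixed sections then so does `g t`, and uniqueness of gluing gives `g t
    -- = t`.
    refine ⟨⟨t, fun g => huniq (fun i => ?_) ht⟩, fun i => Subtype.ext (ht i), fun t' h' => Subtype.ext (ht' _ fun i => congrArg Subtype.val (h' i))⟩
    rw [← app_res, ht i]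
    exact (s i).2 g

/-- The sheaf of fixed sections, as a module. -/
def fixedMod : Y.Modules := (fixedData E).toModules

/-- The inclusion of the fixed sections. -/
def fixedIncl : fixedMod E ⟶ E.M :=
  mkHom (M := fixedMod E) (N := E.M) (fun U s => ((fixedData E).get s : fixedSec E U).1) (fun _ _ _ => rfl) (fun _ _ _ => rfl) (fun _ _ => rfl)

/-- The inclusion `E^G → E`. -/
def invIncl : invariants.obj E ⟶ E.M := kernel.ι (Pi.lift fun g : G => E.op g - 𝟙 E.M)

instance : Mono (invIncl E) := inferInstanceAs (Mono (kernel.ι _))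

theorem invIncl_op (g : G) : invIncl E ≫ E.op g = invIncl E := by
  have h := kernel.condition (Pi.lift fun g : G => E.op g - 𝟙 E.M)
  have h2 := congrArg (fun f => f ≫ Pi.π _ g) h
  simp only [Category.assoc, limit.lift_π, Fan.mk_π_app, zero_comp, Preadditive.comp_sub, Category.comp_id] at h2
  exact sub_eq_zero.1 h2

theorem invIncl_mem (U : Y.Opens) (z : Γ(invariants.obj E, U)) : (invIncl E).app U z ∈ fixedSec E U := fun g =>
  congr(Scheme.Modules.Hom.app $(invIncl_op E g) U z)

theorem invIncl_map {E E' : GSheaf (GAct.triv G Y)} (φ : E ⟶ E') : invariants.map φ ≫ invIncl E' = invIncl E ≫ φ.hom :=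
  kernel.lift_ι _ _ _

/-- The map `E^G →` fixed sections. -/
def invToFixed : invariants.obj E ⟶ fixedMod E :=
  mkHom (M := invariants.obj E) (N := fixedMod E) (fun U z => (fixedData E).sec ⟨(invIncl E).app U z, invIncl_mem E U z⟩)
    (fun U s t => Subtype.ext (map_add ((invIncl E).app U).hom s t)) (fun U a s => Subtype.ext ((invIncl E).app_smul a s))
    (fun h s => Subtype.ext (app_res (invIncl E) h s))

/-- The map from the fixed sections to `E^G`. -/
def fixedToInv : fixedMod E ⟶ invariants.obj E := kernel.lift _ (fixedIncl E) (by
  refine Pi.hom_ext _ _ fun g => ?_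
  simp only [Category.assoc, limit.lift_π, Fan.mk_π_app, zero_comp, Preadditive.comp_sub, Category.comp_id]
  refine sub_eq_zero.2 ?_
  ext U s
  exact ((fixedData E).get s : fixedSec E U).2 g)

theorem fixedToInv_incl : fixedToInv E ≫ invIncl E = fixedIncl E := kernel.lift_ι _ _ _

/-- The kernel is known by its universal property alone. Its comparison with the explicit sheaf of
fixed sections has a one-sided inverse, which is enough for injectivity on sections. -/
theorem invIncl_injective (U : Y.Opens) : Function.Injective ((invIncl E).app U) := by
  have h : invToFixed E ≫ fixedToInv E = 𝟙 _ := by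
    rw [← cancel_mono (invIncl E), Category.assoc, fixedToInv_incl, Category.id_comp]
    rfl
  intro a b hab
  have ha := congr(Scheme.Modules.Hom.app $h U a)
  have hb := congr(Scheme.Modules.Hom.app $h U b)
  refine ha.symm.trans (Eq.trans ?_ hb)
  exact congrArg ((fixedToInv E).app U) (Subtype.ext (p := fun s => s ∈ fixedSec E U) hab)

/-- The universal property of the kernel, applied to the sheaf of fixed sections. -/
theorem exists_invIncl (U : Y.Opens) (s : Γ(E.M, U)) (hs : ∀ g, (E.op g).app U s = s) : ∃ z, (invIncl E).app U z = s :=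
  ⟨(fixedToInv E).app U ((fixedData E).sec ⟨s, hs⟩), congr(Scheme.Modules.Hom.app $(fixedToInv_incl E) U ((fixedData E).sec ⟨s, hs⟩))⟩

end invariantSections

/-! ### Invariants of `E ⊗ σ` in an eigenbasis of `σ` -/

section coordinates
variable {Y : Scheme.{0}} (p : Y ⟶ SpecC) {M N : Y.Modules}

section
variable {W : Type} [AddCommMonoid W] [Module ℂ W]

/-- The map `s ⊗ w ↦ f(w) s` on sections. -/
def contract (f : W →ₗ[ℂ] ℂ) (U : Y.Opens) : Sec p M U ⊗[ℂ] W →ₗ[ℂ] Sec p M U :=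
  (TensorProduct.rid ℂ (Sec p M U)).toLinearMap ∘ₗ LinearMap.lTensor _ f

theorem contract_tmul (f : W →ₗ[ℂ] ℂ) (U : Y.Opens) (s : Sec p M U) (w : W) : contract p f U (s ⊗ₜ[ℂ] w) = f w • s :=
  TensorProduct.rid_tmul s (f w)

variable {ι : Type} [Fintype ι] (b : Module.Basis ι ℂ W)

theorem sum_contract_tmul (U : Y.Opens) (x : Sec p M U ⊗[ℂ] W) : ∑ i, contract p (b.coord i) U x ⊗ₜ[ℂ] b i = x := by
  induction x with
  | zero => simp
  | tmul s w =>
    simp only [contract_tmul, TensorProduct.smul_tmul, ← TensorProduct.tmul_sum, Module.Basis.coord_apply, Module.Basis.sum_repr]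
  | add x y hx hy => simp only [map_add, TensorProduct.add_tmul, Finset.sum_add_distrib, hx, hy]

theorem contract_sum_tmul (U : Y.Opens) (s : ι → Sec p M U) (i : ι) : contract p (b.coord i) U (∑ j, s j ⊗ₜ[ℂ] b j) = s i := by
  classical
  simp [contract_tmul, Finsupp.single_apply]

/-- In a basis of eigenvectors of `L` the matrix of `φ ⊗ L` is diagonal, with entries `c_i φ`. -/
theorem contract_map (φ : M ⟶ N) (U : Y.Opens) (L : W →ₗ[ℂ] W) (c : ι → ℂ) (hL : ∀ i, L (b i) = c i • b i) (i : ι) (x : Sec p M U ⊗[ℂ] W) :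
    contract p (b.coord i) U (TensorProduct.map (secMap p φ U) L x) = c i • secMap p φ U (contract p (b.coord i) U x) := by
  have h : b.coord i ∘ₗ L = c i • b.coord i := by
    classical
    refine b.ext fun j => ?_
    by_cases e : j = i
    · subst e; simp [hL]
    · simp [hL, e]
  induction x with
  | zero => simp
  | tmul s w =>
    have := congr($h w)
    rw [LinearMap.comp_apply] at this
    rw [TensorProduct.map_tmul, contract_tmul, this, contract_tmul, map_smul, smul_smul]
    rfl
  | add x y hx hy => simp only [map_add, hx, hy, smul_add]

end

variable {W : Type} [AddCommGroup W] [Module ℂ W] [Module.Finite ℂ W]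

/-- The map `s ⊗ w ↦ f(w) s`. -/
def contractHom (M : Y.Modules) (f : W →ₗ[ℂ] ℂ) : twist p W M ⟶ M :=
  mkHom (M := twist p W M) (N := M) (fun U s => contract p f U ((twistData p W M).get s)) (fun U s t => map_add (contract p f U) _ _)
    (fun U a s => by
      suffices H : ∀ x : Sec p M U ⊗[ℂ] W, contract p f U (a • x) = a • contract p f U x from H _
      intro x
      induction x with
      | zero => simp
      | tmul s w => rw [TensorProduct.smul_tmul', contract_tmul, contract_tmul, smul_comm]
      | add x y hx hy => simp only [smul_add, map_add, hx, hy])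
    (fun {U V} h s => by
      suffices H : ∀ x : Sec p M U ⊗[ℂ] W, contract p f V (LinearMap.rTensor W (secRes p M h) x) = secRes p M h (contract p f U x) from H _
      intro x
      induction x with
      | zero => simp
      | tmul s w => rw [LinearMap.rTensor_tmul, contract_tmul, contract_tmul, map_smul]
      | add x y hx hy => simp only [map_add, hx, hy])

variable {ι : Type} [Fintype ι] (b : Module.Basis ι ℂ W) {G : Type} [Group G]

variable {p}

/-- The sections on which `G` acts by the character `c`. -/
def IsEigen (E : GSheaf (GAct.triv G Y)) (p : Y ⟶ SpecC) (c : G →* ℂˣ) (U : Y.Opens) (s : Γ(E.M, U)) : Prop :=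
  ∀ g, (E.op g).app U s = scal p U (c g) • s

variable (E : GSheaf (GAct.triv G Y)) (σ : Representation ℂ G W) (c : ι → (G →* ℂˣ)) (hσ : ∀ g i, σ g (b i) = (c i g : ℂ) • b i)

include hσ in
-- The action sends `∑ s_i ⊗ b_i` to `∑ c_i(g) g s_i ⊗ b_i`. Comparing coordinates, invariance means
-- that each `s_i` has the inverse character of `b_i`.
theorem fixed_twist_iff (U : Y.Opens) (x : Sec p E.M U ⊗[ℂ] W) :
    (∀ g, ((GSheaf.twistRep p E σ).op g).app U ((twistData p W E.M).sec x) = (twistData p W E.M).sec x) ↔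
      ∀ i, IsEigen E p (c i)⁻¹ U (contract p (b.coord i) U x) := by
  have key (g : G) (i : ι) : contract p (b.coord i) U (TensorProduct.map (secMap p (E.op g) U) (σ g) x) =
      (c i g : ℂ) • secMap p (E.op g) U (contract p (b.coord i) U x) := contract_map p b (E.op g) U (σ g) (fun i => (c i g : ℂ)) (hσ g) i x
  have hu (g : G) (i : ι) : (c i g : ℂ) ≠ 0 := (c i g).ne_zero
  have step (g : G) (i : ι) : contract p (b.coord i) U (TensorProduct.map (secMap p (E.op g) U) (σ g) x) = contract p (b.coord i) U x ↔
      secMap p (E.op g) U (contract p (b.coord i) U x) = (c i g : ℂ)⁻¹ • contract p (b.coord i) U x := by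
    rw [key, eq_inv_smul_iff₀ (hu g i)]
  have e : (∀ g, TensorProduct.map (secMap p (E.op g) U) (σ g) x = x) ↔
      ∀ i g, secMap p (E.op g) U (contract p (b.coord i) U x) = (c i g : ℂ)⁻¹ • contract p (b.coord i) U x := by
    constructor
    · intro h i g
      rw [← step, h]
    · intro h g
      rw [← sum_contract_tmul p b U (TensorProduct.map (secMap p (E.op g) U) (σ g) x)]
      conv_rhs => rw [← sum_contract_tmul p b U x]
      exact Finset.sum_congr rfl fun i _ => by rw [(step g i).2 (h i g)]
  refine Iff.trans e (forall_congr' fun i => forall_congr' fun g => ?_)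
  have : (((c i)⁻¹ g : ℂˣ) : ℂ) = (c i g : ℂ)⁻¹ := Units.val_inv_eq_inv_val _
  rw [this]
  rfl

/-- `q : E → N` identifies the sections of character `c` with `N`. -/
def EigenBij (E : GSheaf (GAct.triv G Y)) (p : Y ⟶ SpecC) (c : G →* ℂˣ) {N : Y.Modules} (q : E.M ⟶ N) : Prop :=
  ∀ (U : Y.Opens) (t : Γ(N, U)), ∃! s : Γ(E.M, U), IsEigen E p c U s ∧ q.app U s = t

variable {K : ι → Y.Modules} (q : ∀ i, E.M ⟶ K i)

/-- The map from the invariants of `E ⊗ σ` to the direct sum of the images of the eigensheaves of `E`. -/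
def weightHom : invariants.obj (GSheaf.twistRep p E σ) ⟶ ⨁ K :=
  biproduct.lift fun i => invIncl (GSheaf.twistRep p E σ) ≫ contractHom p E.M (b.coord i) ≫ q i

include hσ in
-- The coordinates of an invariant section range independently over the sections of weight `c_i⁻¹`,
-- and `q i` identifies these with the sections of `K i`.
theorem weightHom_isIso (hq : ∀ i, EigenBij E p (c i)⁻¹ (q i)) : IsIso (weightHom (p := p) b E σ q) := by
  refine isIso_of_bijective_app _ fun U => ?_
  have hπ (z : Γ(invariants.obj (GSheaf.twistRep p E σ), U)) (i : ι) : (biproduct.π K i).app U ((weightHom (p := p) b E σ q).app U z) =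
      (q i).app U (contract p (b.coord i) U ((twistData p W E.M).get ((invIncl (GSheaf.twistRep p E σ)).app U z))) :=
    congr(Scheme.Modules.Hom.app $(biproduct.lift_π (fun i => invIncl (GSheaf.twistRep p E σ) ≫ contractHom p E.M (b.coord i) ≫ q i) i) U z)
  -- A section of a finite direct sum is determined by its components, since the identity is the sum
  -- of the projections followed by the inclusions.
  have hext (y y' : Γ(⨁ K, U)) (h : ∀ i, (biproduct.π K i).app U y = (biproduct.π K i).app U y') : y = y' := by
    have key (y : Γ(⨁ K, U)) : ∑ i, (biproduct.ι K i).app U ((biproduct.π K i).app U y) = y := by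
      have := congr(Scheme.Modules.Hom.app $(biproduct.total (f := K)) U y)
      rw [sum_app] at this
      exact this
    rw [← key y, ← key y']
    exact Finset.sum_congr rfl fun i _ => by rw [h]
  have hfix (z : Γ(invariants.obj (GSheaf.twistRep p E σ), U)) :=
    (fixed_twist_iff b E σ c hσ U ((twistData p W E.M).get ((invIncl (GSheaf.twistRep p E σ)).app U z))).1 (invIncl_mem (GSheaf.twistRep p E σ) U z)
  constructor
  · intro z z' h
    apply invIncl_injective
    have e : (twistData p W E.M).get ((invIncl (GSheaf.twistRep p E σ)).app U z) = (twistData p W E.M).get ((invIncl (GSheaf.twistRep p E σ)).app U z') := by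
      rw [← sum_contract_tmul p b U ((twistData p W E.M).get ((invIncl (GSheaf.twistRep p E σ)).app U z)),
        ← sum_contract_tmul p b U ((twistData p W E.M).get ((invIncl (GSheaf.twistRep p E σ)).app U z'))]
      refine Finset.sum_congr rfl fun i _ => congrArg (fun s : Sec p E.M U => s ⊗ₜ[ℂ] b i) ?_
      refine (hq i U _).unique ⟨hfix z i, rfl⟩ ⟨hfix z' i, ?_⟩
      rw [← hπ, ← hπ, h]
    exact e
  · intro y
    -- Each component is lifted to an eigensection `s i`; the combination of the `s i ⊗ b i` is then
    -- invariant.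
    choose s hs _ using fun i => hq i U ((biproduct.π K i).app U y)
    obtain ⟨z, hz⟩ := exists_invIncl (GSheaf.twistRep p E σ) U ((twistData p W E.M).sec (∑ i, (s i : Sec p E.M U) ⊗ₜ[ℂ] b i))
      ((fixed_twist_iff b E σ c hσ U _).2 fun i => (congrArg (IsEigen E p (c i)⁻¹ U) (contract_sum_tmul p b U s i)).mpr (hs i).1)
    refine ⟨z, hext _ _ fun i => ?_⟩
    rw [hπ, hz, ← (hs i).2]
    exact congrArg ((q i).app U) (contract_sum_tmul p b U s i)

end coordinates
end
end McKayTransform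


namespace McKayTransform
noncomputable section
open GSheaf
open scoped TensorProduct

/-! ### Invariant complexes as total complexes of cubes -/

section cubeTotal
variable {n : ℕ} {G : Subgroup (Matrix.SpecialLinearGroup (Fin n) ℂ)} {Y : Scheme.{0}} {p : Y ⟶ SpecC} (F : GSheaf (prodAct G p))
variable (R : ℕ → FinRep G) (DS : ∀ k, GSheaf.twistRep p (pushY F) (R (k + 1)).σ ⟶ GSheaf.twistRep p (pushY F) (R k).σ)
  (hDS : ∀ k, DS (k + 1) ≫ DS k = 0)
  (b : ∀ k, Module.Basis {v : Finset (Fin n) // v.card = k} ℂ (R k).U) (c : Finset (Fin n) → Char G)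
  (Q : Cube n Y.Modules) (q : ∀ v, (pushY F).M ⟶ Q.obj v) (a : Fin n → ((pushY F).M ⟶ (pushY F).M))

open Classical in
/-- The component `w → v` of the differential of a cube of copies of `π_{Y*} F` with the maps `a i`. -/
def edgeSum (w v : Finset (Fin n)) : (pushY F).M ⟶ (pushY F).M :=
  ∑ i, if CubeEdge w v i then (-1 : ℤ) ^ pos w i • a i else 0

variable {a q} in
-- Along an edge, `a i` on `π_{Y*} F` induces the map of the cube, and both sides carry the same
-- sign.
theorem edgeSum_comp (hq : ∀ {w v : Finset (Fin n)} {i : Fin n} (h : CubeEdge w v i), a i ≫ q v = q w ≫ Q.map h) (w v : Finset (Fin n)) :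
    edgeSum F a w v ≫ q v = (q w ≫ Q.skewify.entry w v : (pushY F).M ⟶ Q.skewify.obj v) := by
  rw [edgeSum, Cube.entry, Preadditive.sum_comp]
  refine Eq.trans ?_ (Preadditive.comp_sum _ _ _).symm
  refine Finset.sum_congr rfl fun i _ => ?_
  rw [Cube.step]
  split_ifs with h
  · rw [Preadditive.zsmul_comp, hq h]
    exact (Preadditive.comp_zsmul _ _ _).symm
  · exact zero_comp.trans comp_zero.symm

/-- The matrix calculation behind the compatibility of the weight decomposition with the
differentials. -/
theorem sum_comp_exchange {C ι : Type*} [Category C] [Preadditive C] [Fintype ι] {A B D K : C} {J : ι → C} (u : A ⟶ B) (t : ι → (B ⟶ D))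
    (e : ι → (D ⟶ D)) (r : D ⟶ K) (q : ∀ w, D ⟶ J w) (m : ∀ w, J w ⟶ K) (h : ∀ w, e w ≫ r = q w ≫ m w) :
    ∑ w, (u ≫ t w ≫ q w) ≫ m w = u ≫ (∑ w, t w ≫ e w) ≫ r := by
  simp [Preadditive.sum_comp, Preadditive.comp_sum, h]

/-- A complex of invariants of sheaves `π_{Y*} F ⊗ σ_k`, as the total complex of a cube of eigensheaves. -/
def totalIso (hσ : ∀ k g i, (R k).σ g (b k i) = (c i.1 g : ℂ) • b k i) (hbij : ∀ v, EigenBij (pushY F) p (c v)⁻¹ (q v))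
    (hq : ∀ w v, edgeSum F a w v ≫ q v = q w ≫ Q.entry w v)
    (hD : ∀ k v, (DS k).hom ≫ contractHom p (pushY F).M ((b k).coord v) =
      ∑ w, contractHom p (pushY F).M ((b (k + 1)).coord w) ≫ edgeSum F a w.1 v.1)
    (hQ : Q.IsSkew) :
    (invariants.mapHomologicalComplex _).obj (twistComplex F R DS hDS) ≅ Q.total hQ :=
  have isIso (k : ℕ) : IsIso (weightHom (p := p) (b k) (pushY F) (R k).σ (fun i => q i.1)) :=
    weightHom_isIso (b k) (pushY F) (R k).σ (fun i => c i.1) (hσ k) (fun i => q i.1) (fun i => hbij i.1)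
  HomologicalComplex.Hom.isoOfComponents (fun k => @asIso _ _ _ _ (weightHom (p := p) (b k) (pushY F) (R k).σ (fun i => q i.1)) (isIso k)) (by
    rintro _ k rfl
    have e1 : (twistComplex F R DS hDS).d (k + 1) k = DS k := ChainComplex.of_d (fun k => GSheaf.twistRep p (pushY F) (R k).σ) DS k
    have e2 : (Q.total hQ).d (k + 1) k = Q.d k := ChainComplex.of_d Q.term Q.d k
    -- After projection to a summand `v`, both sides are sums over the vertices `w` one degree
    -- higher: take the coordinate at `w`, then the component `w → v` of the differential.
    have key : weightHom (p := p) (b (k + 1)) (pushY F) (R (k + 1)).σ (fun i => q i.1) ≫ Q.d k =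
        invariants.map (DS k) ≫ weightHom (p := p) (b k) (pushY F) (R k).σ (fun i => q i.1) := by
      apply biproduct.hom_ext
      intro v
      have h0 : invariants.map (DS k) ≫ invIncl _ ≫ contractHom p (pushY F).M ((b k).coord v) ≫ q v.1 =
          invIncl _ ≫ ((DS k).hom ≫ contractHom p (pushY F).M ((b k).coord v)) ≫ q v.1 := by
        rw [← Category.assoc, invIncl_map, Category.assoc]
        exact congrArg _ (Category.assoc _ _ _).symm
      have h1 : (invariants.map (DS k) ≫ weightHom (p := p) (b k) (pushY F) (R k).σ (fun i => q i.1)) ≫ biproduct.π _ v =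
          invIncl _ ≫ ((DS k).hom ≫ contractHom p (pushY F).M ((b k).coord v)) ≫ q v.1 := by
        rw [Category.assoc, weightHom, biproduct.lift_π]
        exact h0
      have h2 : (weightHom (p := p) (b (k + 1)) (pushY F) (R (k + 1)).σ (fun i => q i.1) ≫ Q.d k) ≫ biproduct.π _ v =
          ∑ w, (invIncl (GSheaf.twistRep p (pushY F) (R (k + 1)).σ) ≫ contractHom p (pushY F).M ((b (k + 1)).coord w) ≫ q w.1) ≫ Q.entry w.1 v.1 := by
        rw [Cube.d, weightHom]
        refine (congrArg (fun φ => φ ≫ biproduct.π _ v) (biproduct.lift_matrix _ _)).trans ?_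
        exact biproduct.lift_π _ _
      refine h2.trans (Eq.trans ?_ h1.symm)
      rw [hD]
      exact sum_comp_exchange (invIncl (GSheaf.twistRep p (pushY F) (R (k + 1)).σ)) (fun w => contractHom p (pushY F).M ((b (k + 1)).coord w))
        (fun w => edgeSum F a w.1 v.1) (q v.1) (fun w => q w.1) (fun w => Q.entry w.1 v.1) (fun w => hq w.1 v.1)
    exact ((congrArg _ e2).trans key).trans (congrArg (fun φ => invariants.map φ ≫ _) e1.symm))

end cubeTotal

/-! ### The eigenbasis of `∧^k V^∨ ⊗ χ` -/

section koszulBasis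
variable {n : ℕ} {G : Subgroup (Matrix.SpecialLinearGroup (Fin n) ℂ)} (x : EigenBasis G)

/-- The basis of `∧^k V^∨ ⊗ ℂ` of the `x_{i_1} ∧ … ∧ x_{i_k} ⊗ 1`. -/
def kosBasis (k : ℕ) : Module.Basis {v : Finset (Fin n) // v.card = k} ℂ ((⋀[ℂ]^k (Vd n)) ⊗[ℂ] ℂ) :=
  (x.x.exteriorPower k).map (TensorProduct.rid ℂ _).symm

theorem kosBasis_apply (k : ℕ) (v : {v : Finset (Fin n) // v.card = k}) :
    kosBasis x k v = exteriorPower.ιMulti ℂ k (x.x ∘ v.1.orderEmbOfFin v.2) ⊗ₜ[ℂ] (1 : ℂ) := by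
  have h : x.x.exteriorPower k v = exteriorPower.ιMulti ℂ k (x.x ∘ v.1.orderEmbOfFin v.2) := exteriorPower.basis_apply ℂ k x.x v
  rw [← h]
  exact (Module.Basis.map_apply _ _ _).trans (TensorProduct.rid_symm_apply _)

/-- By multilinearity a wedge of eigenvectors is an eigenvector for the product of their characters;
the one-dimensional second factor contributes `χ`. -/
theorem kosBasis_eigen (χ : Char G) (k : ℕ) (g : G) (v : {v : Finset (Fin n) // v.card = k}) :
    kosRep G (charRep χ) k g (kosBasis x k v) = ((x.wt v.1 * χ : Char G) g : ℂ) • kosBasis x k v := by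
  rw [kosBasis_apply]
  have h1 : exteriorPower.map k (dualRep G g) (exteriorPower.ιMulti ℂ k (x.x ∘ v.1.orderEmbOfFin v.2)) =
      (x.wt v.1 g : ℂ) • exteriorPower.ιMulti ℂ k (x.x ∘ v.1.orderEmbOfFin v.2) := by
    rw [exteriorPower.map_apply_ιMulti]
    have e : (dualRep G g) ∘ x.x ∘ (v.1.orderEmbOfFin v.2) = fun j => (x.κ (v.1.orderEmbOfFin v.2 j) g : ℂ) • (x.x ∘ v.1.orderEmbOfFin v.2) j :=
      funext fun j => x.eigen g _
    rw [e, AlternatingMap.map_smul_univ]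
    congr 1
    rw [EigenBasis.wt, MonoidHom.finsetProd_apply, Units.coe_prod]
    -- The product over positions becomes the product over the elements of `v` through their
    -- increasing enumeration.
    have im : v.1 = Finset.univ.map (v.1.orderEmbOfFin v.2).toEmbedding := (Finset.map_orderEmbOfFin_univ v.1 v.2).symm
    conv_rhs => rw [im]
    rw [Finset.prod_map]
    rfl
  refine (TensorProduct.map_tmul _ _ _ _).trans ?_
  have h2 : charRep χ g (1 : ℂ) = (χ g : ℂ) • (1 : ℂ) := rfl
  refine (congrArg₂ (fun y z => y ⊗ₜ[ℂ] z) h1 h2).trans ?_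
  rw [TensorProduct.tmul_smul, ← TensorProduct.smul_tmul', smul_smul, mul_comm]
  rfl

/-- With `j` counted from zero, the elements up to the `j`-th are the first `j + 1`. This is why
`(-1) ^ pos` agrees with the sign `(-1) ^ (j + 1)` of `kos_apply`. -/
theorem pos_orderEmbOfFin {k : ℕ} (w : Finset (Fin n)) (hw : w.card = k) (j : Fin k) : pos w (w.orderEmbOfFin hw j) = j.1 + 1 := by
  have h : w.filter (· ≤ w.orderEmbOfFin hw j) = (Finset.Iic j).map (w.orderEmbOfFin hw).toEmbedding := by
    ext i
    simp only [Finset.mem_filter, Finset.mem_map, Finset.mem_Iic]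
    constructor
    · rintro ⟨hi, hij⟩
      obtain ⟨l, rfl⟩ : i ∈ Set.range (w.orderEmbOfFin hw) := by rw [Finset.range_orderEmbOfFin]; exact hi
      exact ⟨l, (w.orderEmbOfFin hw).le_iff_le.1 hij, rfl⟩
    · rintro ⟨l, hl, rfl⟩
      exact ⟨Finset.orderEmbOfFin_mem _ _ _, (w.orderEmbOfFin hw).le_iff_le.2 hl⟩
  rw [pos, h, Finset.card_map, Fin.card_Iic]

/-- The enumeration of `w` with the index `j` skipped is strictly increasing with values in the
smaller set, and there is only one such enumeration. -/
theorem orderEmbOfFin_erase {k : ℕ} (w : Finset (Fin n)) (hw : w.card = k + 1) (j : Fin (k + 1)) (h : (w.erase (w.orderEmbOfFin hw j)).card = k) :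
    (fun i => w.orderEmbOfFin hw (j.succAbove i)) = (w.erase (w.orderEmbOfFin hw j)).orderEmbOfFin h := by
  refine Finset.orderEmbOfFin_unique h (fun i => ?_) (fun i i' hi => ?_)
  · refine Finset.mem_erase.2 ⟨fun e => ?_, Finset.orderEmbOfFin_mem _ _ _⟩
    exact Fin.succAbove_ne j i ((w.orderEmbOfFin hw).injective e)
  · exact (w.orderEmbOfFin hw).strictMono (Fin.strictMono_succAbove j hi)

variable {S : Type} [AddCommGroup S] [Module ℂ S]

open Classical in
-- An edge that starts at `w` is the deletion of one element of `w`. The double sum over targets `v`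
-- and directions `i` therefore collapses to the sum over positions in `kos_apply`.
theorem kos_basis (a : Vd n →ₗ[ℂ] S →ₗ[ℂ] S) (k : ℕ) (w : {v : Finset (Fin n) // v.card = k + 1}) (s : S) :
    kos ℂ a k (s ⊗ₜ kosBasis x (k + 1) w) =
      ∑ v, ∑ i, (if CubeEdge w.1 v.1 i then (-1 : ℤ) ^ pos w.1 i • a (x.x i) s else 0) ⊗ₜ[ℂ] kosBasis x k v := by
  rw [kosBasis_apply, kos_apply, Finset.sum_comm]
  refine Fintype.sum_of_injective (w.1.orderEmbOfFin w.2) (w.1.orderEmbOfFin w.2).injective _ _ (fun i hi => ?_) (fun j => ?_)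
  -- A direction outside `w` belongs to no edge.
  · refine Finset.sum_eq_zero fun v _ => ?_
    rw [if_neg, TensorProduct.zero_tmul]
    rintro h
    refine hi ?_
    rw [Finset.range_orderEmbOfFin, h.eq]
    simp
  · have hc : (w.1.erase (w.1.orderEmbOfFin w.2 j)).card = k := by
      rw [Finset.card_erase_of_mem (Finset.orderEmbOfFin_mem _ _ _), w.2]; rfl
    -- In the direction of the `j`-th element the only target is `w` without this element.
    rw [Finset.sum_eq_single (⟨w.1.erase (w.1.orderEmbOfFin w.2 j), hc⟩ : {v : Finset (Fin n) // v.card = k})]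
    · rw [if_pos ⟨Finset.notMem_erase _ _, (Finset.insert_erase (Finset.orderEmbOfFin_mem _ _ _)).symm⟩, pos_orderEmbOfFin, kosBasis_apply]
      have e : j.removeNth (x.x ∘ w.1.orderEmbOfFin w.2) = x.x ∘ (w.1.erase (w.1.orderEmbOfFin w.2 j)).orderEmbOfFin hc := by
        rw [← orderEmbOfFin_erase w.1 w.2 j hc]; rfl
      rw [e]
      exact TensorProduct.smul_tmul' _ _ _
    · intro v _ hv
      rw [if_neg, TensorProduct.zero_tmul]
      intro h
      refine hv (Subtype.ext ?_)
      change v.1 = w.1.erase (w.1.orderEmbOfFin w.2 j)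
      generalize w.1.orderEmbOfFin w.2 j = i at h
      rw [h.eq, Finset.erase_insert h.nmem]
    · simp

end koszulBasis

/-! ### Matrix entries of the Koszul differential -/

section koszulEntries
variable {n : ℕ} {G : Subgroup (Matrix.SpecialLinearGroup (Fin n) ℂ)} (x : EigenBasis G) {Y : Scheme.{0}} {p : Y ⟶ SpecC} {M : Y.Modules}
  (A : LinAct p M (Vd n))

theorem zsmul_app {M N : Y.Modules} (z : ℤ) (φ : M ⟶ N) (U : Y.Opens) (s : Γ(M, U)) : (z • φ).app U s = z • φ.app U s :=
  map_zsmul (AddMonoidHom.mk' (fun φ : M ⟶ N => φ.app U s) (fun _ _ => rfl)) z φ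

open Classical in
-- Every `y` is a combination of the basis elements with coefficients in the sections of `M`, and
-- `kos_basis` gives the differential of each term.
theorem contract_kos (U : Y.Opens) (a : Vd n →ₗ[ℂ] Sec p M U →ₗ[ℂ] Sec p M U) (k : ℕ)
    (v : {v : Finset (Fin n) // v.card = k}) (y : Sec p M U ⊗[ℂ] ((⋀[ℂ]^(k + 1) (Vd n)) ⊗[ℂ] ℂ)) :
    contract p ((kosBasis x k).coord v) U (kos ℂ a k y) =
      ∑ w, ∑ i, if CubeEdge w.1 v.1 i then (-1 : ℤ) ^ pos w.1 i • a (x.x i) (contract p ((kosBasis x (k + 1)).coord w) U y) else 0 := by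
  obtain ⟨t, rfl⟩ : ∃ t : _ → Sec p M U, ∑ w, t w ⊗ₜ[ℂ] kosBasis x (k + 1) w = y := ⟨_, sum_contract_tmul p (kosBasis x (k + 1)) U y⟩
  rw [map_sum, map_sum]
  refine Finset.sum_congr rfl fun w _ => ?_
  rw [kos_basis, contract_sum_tmul]
  have h := contract_sum_tmul p (kosBasis x k) U (fun v => ∑ i, if CubeEdge w.1 v.1 i then (-1 : ℤ) ^ pos w.1 i • a (x.x i) (t w) else 0) v
  simp only [TensorProduct.sum_tmul] at h
  exact h

theorem kosD_contractHom_app {V : Type} [AddCommGroup V] [Module ℂ V] [Module.Finite ℂ V] {W : Type} [AddCommGroup W] [Module ℂ W] [Module.Finite ℂ W]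
    (A : LinAct p M V) (k : ℕ) (f : (⋀[ℂ]^k V) ⊗[ℂ] W →ₗ[ℂ] ℂ) (U : Y.Opens) (s : Γ(kosTerm A W (k + 1), U)) :
    (kosD A W k ≫ contractHom p M f).app U s = contract p f U (kos W (A.lin U) k ((twistData p _ M).get s)) := rfl

theorem contract_get {W : Type} [AddCommGroup W] [Module ℂ W] [Module.Finite ℂ W] (f : W →ₗ[ℂ] ℂ) (U : Y.Opens) (s : Γ(twist p W M, U)) :
    contract p f U ((twistData p W M).get s) = (contractHom p M f).app U s := rfl

open Classical in
theorem kosD_entry (k : ℕ) (v : {v : Finset (Fin n) // v.card = k}) (U : Y.Opens) (s : Γ(kosTerm A ℂ (k + 1), U)) :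
    (kosD A ℂ k ≫ contractHom p M ((kosBasis x k).coord v)).app U s =
      ∑ w, ∑ i, if CubeEdge w.1 v.1 i then
        (-1 : ℤ) ^ pos w.1 i • (A.a (x.x i)).app U ((contractHom p M ((kosBasis x (k + 1)).coord w)).app U s) else 0 := by
  refine (kosD_contractHom_app A k _ U s).trans ((contract_kos x U (A.lin U) k v ((twistData p _ M).get s)).trans ?_)
  refine Finset.sum_congr rfl fun w _ => Finset.sum_congr rfl fun i _ => ?_
  have e : contract p ((kosBasis x (k + 1)).coord w) U ((twistData p _ M).get s) = (contractHom p M ((kosBasis x (k + 1)).coord w)).app U s :=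
    contract_get _ U s
  rw [e]
  rfl

/-- Morphisms of modules are determined by their effect on sections; this passes from a formula on
sections to an identity of morphisms. -/
theorem hom_eq_sum {K N : Y.Modules} {ι κ : Type} [Fintype ι] [Fintype κ] (f : K ⟶ N) (t : ι → (K ⟶ M)) (c : ι → κ → Prop) [∀ w i, Decidable (c w i)]
    (z : ι → κ → ℤ) (e : κ → (M ⟶ N))
    (h : ∀ U s, f.app U s = ∑ w, ∑ i, if c w i then z w i • (e i).app U ((t w).app U s) else 0) :
    f = ∑ w, t w ≫ ∑ i, if c w i then z w i • e i else 0 := by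
  ext U s
  refine (h U s).trans ?_
  refine Eq.trans ?_ (sum_app _ _ U s).symm
  refine Finset.sum_congr rfl fun w _ => ?_
  refine Eq.trans ?_ (sum_app _ _ U ((t w).app U s)).symm
  refine Finset.sum_congr rfl fun i _ => ?_
  split_ifs
  · exact (zsmul_app _ _ U _).symm
  · rfl

open Classical in
theorem kosD_contractHom (k : ℕ) (v : {v : Finset (Fin n) // v.card = k}) :
    kosD A ℂ k ≫ contractHom p M ((kosBasis x k).coord v) =
      ∑ w, contractHom p M ((kosBasis x (k + 1)).coord w) ≫ ∑ i, if CubeEdge w.1 v.1 i then (-1 : ℤ) ^ pos w.1 i • A.a (x.x i) else 0 :=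
  by
  let t : {v : Finset (Fin n) // v.card = k + 1} → (kosTerm A ℂ (k + 1) ⟶ M) := fun w => contractHom p M ((kosBasis x (k + 1)).coord w)
  have h : ∀ (U : Y.Opens) (s : Γ(kosTerm A ℂ (k + 1), U)), (kosD A ℂ k ≫ contractHom p M ((kosBasis x k).coord v)).app U s =
      ∑ w, ∑ i, if CubeEdge w.1 v.1 i then (-1 : ℤ) ^ pos w.1 i • (A.a (x.x i)).app U ((t w).app U s) else 0 := kosD_entry x A k v
  change kosD A ℂ k ≫ contractHom p M ((kosBasis x k).coord v) = ∑ w, t w ≫ ∑ i, if CubeEdge w.1 v.1 i then (-1 : ℤ) ^ pos w.1 i • A.a (x.x i) else 0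
  clear_value t
  generalize kosD A ℂ k ≫ contractHom p M ((kosBasis x k).coord v) = f at h ⊢
  generalize kosTerm A ℂ (k + 1) = K at t f h ⊢
  exact hom_eq_sum f t _ _ _ h

end koszulEntries

/-! ### The cube attached to `O_0 ⊗ χ` -/

section eigenCube
variable {n : ℕ} {G : Subgroup (Matrix.SpecialLinearGroup (Fin n) ℂ)} {Y : Scheme.{0}} {p : Y ⟶ SpecC} (F : GSheaf (prodAct G p)) (x : EigenBasis G) (χ : Char G)

/-- The basis `kosBasis` of the representation `∧^k V^∨ ⊗ χ`. -/
def kosRepBasis (k : ℕ) : Module.Basis {v : Finset (Fin n) // v.card = k} ℂ (kosFinRep G (charRep χ) k).U := kosBasis x k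

theorem kosShD_contract (k : ℕ) (v : {v : Finset (Fin n) // v.card = k}) :
    (kosShD F (charRep χ) k).hom ≫ contractHom p (pushY F).M ((kosRepBasis x χ k).coord v) =
      ∑ w, contractHom p (pushY F).M ((kosRepBasis x χ (k + 1)).coord w) ≫ edgeSum F (fun i => (pushLin F).a (x.x i)) w.1 v.1 :=
  kosD_contractHom x (pushLin F) k v

/-- The complex of invariants attached to `O_0 ⊗ χ`, as the total complex of a cube of eigensheaves of `π_{Y*} F`. -/
def pointComplexIso (c : Finset (Fin n) → Char G) (hc : ∀ v, c v = x.wt v * χ) (Q : Cube n Y.Modules) (q : ∀ v, (pushY F).M ⟶ Q.obj v)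
    (hbij : ∀ v, EigenBij (pushY F) p (c v)⁻¹ (q v))
    (hq : ∀ {w v : Finset (Fin n)} {i : Fin n} (h : CubeEdge w v i), (pushLin F).a (x.x i) ≫ q v = q w ≫ Q.map h)
    (hQ : Q.skewify.IsSkew) : pointComplex F (charRep χ) ≅ Q.skewify.total hQ :=
  totalIso F (kosFinRep G (charRep χ)) (kosShD F (charRep χ)) (kosShD_comp F (charRep χ)) (kosRepBasis x χ) c Q.skewify q
    (fun i => (pushLin F).a (x.x i)) (fun k g v => by rw [hc]; exact kosBasis_eigen x χ k g v) hbij (edgeSum_comp F Q hq)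
    (kosShD_contract F x χ) hQ

end eigenCube
end
end McKayTransform


namespace McKayTransform
noncomputable section
open GSheaf

/-! ### Line bundles `L(D)` and the duality of `L(D)` with `L(-D)` -/

section divisors
variable {n : ℕ} {G : Subgroup (Matrix.SpecialLinearGroup (Fin n) ℂ)} {Y : Scheme.{0}} {p : Y ⟶ SpecC} [IsIntegral Y] (B : QuotMap G p)

/-- The local rings of an integral scheme embed in its function field, and `ι` is a homomorphism of
fields. -/
theorem QuotMap.stalkHom_injective (y : Y) : Function.Injective (B.stalkHom y) := by
  have h : Function.Injective (algebraMap (Y.presheaf.stalk y) Y.functionField) := IsFractionRing.injective _ _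
  exact B.ι.injective.comp h

/-- The value in `K(ℂ^n)` at `z` of a function on `Y`. -/
def QuotMap.val {U : Y.Opens} (a : Γ(Y, U)) (z : U) : RatFun n := B.stalkHom z.1 (Y.presheaf.germ U z.1 z.2 a)

theorem QuotMap.val_add {U : Y.Opens} (a b : Γ(Y, U)) (z : U) : B.val (a + b) z = B.val a z + B.val b z := by
  rw [QuotMap.val, map_add, map_add]; rfl
theorem QuotMap.val_mul {U : Y.Opens} (a b : Γ(Y, U)) (z : U) : B.val (a * b) z = B.val a z * B.val b z := by
  rw [QuotMap.val, map_mul, map_mul]; rfl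
theorem QuotMap.val_res {U V : Y.Opens} (h : V ≤ U) (a : Γ(Y, U)) (z : V) : B.val (Y.presheaf.map (homOfLE h).op a) z = B.val a ⟨z.1, h z.2⟩ := by
  rw [QuotMap.val, Y.presheaf.germ_res_apply]; rfl
theorem QuotMap.val_mem {U : Y.Opens} (a : Γ(Y, U)) (z : U) : B.val a z ∈ (B.stalkHom z.1).range := ⟨_, rfl⟩
theorem QuotMap.val_const {U : Y.Opens} (a : Γ(Y, U)) (y z : U) : B.val a y = B.val a z := B.stalkHom_germ U y.1 z.1 y.2 z.2 a

/-- A function is determined by its germs, and a germ by its value in `K(ℂ^n)`. -/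
theorem QuotMap.val_ext {U : Y.Opens} {a b : Γ(Y, U)} (h : ∀ z, B.val a z = B.val b z) : a = b :=
  TopCat.Presheaf.section_ext Y.sheaf U a b fun z hz => B.stalkHom_injective z (h ⟨z, hz⟩)

/-- A locally constant function with values in the local rings is given by a function on `Y`. -/
theorem QuotMap.exists_val {U : Y.Opens} (f : U → RatFun n) (hf : ∀ y : U, ∃ V : Y.Opens, y.1 ∈ V ∧ ∀ z : U, z.1 ∈ V → f z = f y)
    (hf' : ∀ y : U, f y ∈ (B.stalkHom y.1).range) : ∃ a : Γ(Y, U), ∀ z, B.val a z = f z := by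
  have loc (y : U) : ∃ (V : Y.Opens) (h : V ≤ U) (a : Γ(Y, V)), y.1 ∈ V ∧ ∀ z : V, B.val a z = f ⟨z.1, h z.2⟩ := by
    obtain ⟨V, hV, h⟩ := hf y
    obtain ⟨c, hc⟩ := hf' y
    obtain ⟨V', hy, a, rfl⟩ := Y.presheaf.exists_germ_eq c
    -- On this intersection `f` is constant and the germ at `y` extends to a function. Such a
    -- function has the same value in `K(ℂ^n)` at all points, so agreement at `y` gives agreement
    -- throughout.
    have h1 : U ⊓ V ⊓ V' ≤ V' := inf_le_right
    have hy' : y.1 ∈ U ⊓ V ⊓ V' := ⟨⟨y.2, hV⟩, hy⟩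
    refine ⟨U ⊓ V ⊓ V', inf_le_left.trans inf_le_left, Y.presheaf.map (homOfLE h1).op a, hy', fun z => ?_⟩
    rw [B.val_const _ z ⟨y.1, hy'⟩, B.val_res]
    exact hc.trans (h ⟨z.1, z.2.1.1⟩ z.2.1.2).symm
  choose V hVU a hy ha using loc
  have hU : iSup V = U := le_antisymm (iSup_le hVU) fun y h => TopologicalSpace.Opens.mem_iSup.2 ⟨⟨y, h⟩, hy ⟨y, h⟩⟩
  obtain ⟨t, ht, _⟩ := Y.sheaf.existsUnique_gluing' V U (fun y => homOfLE (hVU y)) hU.ge a (fun i j => by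
    refine B.val_ext (U := V i ⊓ V j) fun z => ?_
    refine (B.val_res inf_le_left (a i) z).trans (Eq.trans ?_ (B.val_res inf_le_right (a j) z).symm)
    rw [ha, ha])
  refine ⟨t, fun z => ?_⟩
  have h1 := B.val_res (hVU z) t ⟨z.1, hy z⟩
  refine h1.symm.trans (Eq.trans ?_ (ha z ⟨z.1, hy z⟩))
  exact congrArg (fun b => B.val b ⟨z.1, hy z⟩) (ht z)

variable {B}
namespace GDivisor
variable (D : GDivisor B) {U V : Y.Opens}

theorem fn_add (s t : Γ(D.L, U)) (y : U) : fn (s + t) y = fn s y + fn t y := rfl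
theorem fn_smul (a : Γ(Y, U)) (s : Γ(D.L, U)) (y : U) : fn (a • s) y = B.val a y * fn s y := rfl
theorem fn_res (h : V ≤ U) (s : Γ(D.L, U)) (y : V) : fn (res D.L h s) y = fn s ⟨y.1, h y.2⟩ := rfl
theorem fn_loc (s : Γ(D.L, U)) (y : U) : ∃ V : Y.Opens, y.1 ∈ V ∧ ∀ z : U, z.1 ∈ V → fn s z = fn s y := (D.modData.get s : D.subgp U).2.1 y
theorem fn_mem (s : Γ(D.L, U)) (y : U) : fn s y * D.eqn y.1 ∈ (B.stalkHom y.1).range := (D.modData.get s : D.subgp U).2.2 y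

/-- Sections from functions with values in `K(ℂ^n)`. -/
theorem exists_fn (f : U → RatFun n) (hf : ∀ y : U, ∃ V : Y.Opens, y.1 ∈ V ∧ ∀ z : U, z.1 ∈ V → f z = f y)
    (hf' : ∀ y : U, f y * D.eqn y.1 ∈ (B.stalkHom y.1).range) : ∃ s : Γ(D.L, U), ∀ y, fn s y = f y :=
  ⟨D.modData.sec (⟨f, hf, hf'⟩ : D.subgp U), fun _ => rfl⟩

/-- Near `y` all local equations are equal to `eqn y` up to units, so every section is a regular
function times the constant `(eqn y)⁻¹`. -/
theorem exists_generator (y : Y) : ∃ (V : Y.Opens) (e : Γ(D.L, V)), y ∈ V ∧ (∀ z, fn e z = (D.eqn y)⁻¹) ∧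
    ∀ (V' : Y.Opens) (h : V' ≤ V) (s : Γ(D.L, V')), ∃ a : Γ(Y, V'), a • res D.L h e = s := by
  obtain ⟨V, hV, h⟩ := D.eqn_loc y
  have hy := D.eqn_ne y
  obtain ⟨e, he⟩ := D.exists_fn (U := V) (fun _ => (D.eqn y)⁻¹) (fun _ => ⟨⊤, trivial, fun _ _ => rfl⟩) (fun z => by
    obtain ⟨u, hu⟩ := h z.1 z.2
    rw [hu, inv_mul_cancel_left₀ hy]
    exact ⟨_, rfl⟩)
  refine ⟨V, e, hV, he, fun V' h' s => ?_⟩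
  obtain ⟨a, ha⟩ := B.exists_val (U := V') (fun z => fn s z * D.eqn y) (fun z => by
      obtain ⟨W, hW, hW'⟩ := D.fn_loc s z
      exact ⟨W, hW, fun z' hz' => by rw [hW' z' hz']⟩) (fun z => by
      obtain ⟨u, hu⟩ := h z.1 (h' z.2)
      obtain ⟨c, hc⟩ := D.fn_mem s z
      refine ⟨c * (u⁻¹ : (Y.presheaf.stalk z.1)ˣ), ?_⟩
      rw [map_mul, hc, hu, mul_assoc, mul_assoc, ← map_mul, Units.mul_inv, map_one, mul_one])
  refine ⟨a, D.L_ext fun z => ?_⟩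
  rw [fn_smul, ha, fn_res, he, mul_assoc, mul_inv_cancel₀ hy, mul_one]

/-- The local generator is a non-zero element of a field, so multiplication by it is injective as
well. -/
theorem isLineBundle : IsLineBundle D.L := by
  intro y
  obtain ⟨V, e, hV, he, hs⟩ := D.exists_generator y
  refine ⟨V, e, hV, fun V' h => ⟨fun a b hab => B.val_ext fun z => ?_, hs V' h⟩⟩
  have := congrArg (fun s => fn s z) hab
  simp only [fn_smul, fn_res, he] at this
  exact mul_right_cancel₀ (inv_ne_zero (D.eqn_ne y)) this

variable {D} in
/-- The pairing of `L(D)` with `L(-D)` is represented by multiplication in `K(ℂ^n)`. -/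
def Represents (f : Γ(D.L, U)) (φ : LocDual (-D).L U) : Prop :=
  ∀ (V : Y.Opens) (h : V ≤ U) (s : Γ((-D).L, V)) (z : V), B.val (φ.f V h s) z = fn f ⟨z.1, h z.2⟩ * fn s z

theorem eqn_neg (y : Y) : (-D).eqn y = (D.eqn y)⁻¹ := rfl

variable {D} in
-- A generator of `L(-D)` near the point has a non-zero value, which can be cancelled.
theorem Represents.unique {f f' : Γ(D.L, U)} {φ : LocDual (-D).L U} (h : Represents f φ) (h' : Represents f' φ) : f = f' := by
  refine D.L_ext fun z => ?_
  obtain ⟨V, e, hV, he, _⟩ := (-D).exists_generator z.1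
  have e1 := h (V ⊓ U) inf_le_right (res _ inf_le_left e) ⟨z.1, hV, z.2⟩
  rw [h' (V ⊓ U) inf_le_right (res _ inf_le_left e) ⟨z.1, hV, z.2⟩, fn_res, he] at e1
  exact (mul_right_cancel₀ (inv_ne_zero ((-D).eqn_ne z.1)) e1).symm

/-- A functional on `L(-D)` is multiplication by its value on a local generator divided by that
generator. By linearity and compatibility with restriction the quotient does not depend on the
generator; hence it is locally constant in `K(ℂ^n)` and defines a section of `L(D)`. -/
theorem exists_represents (φ : LocDual (-D).L U) : ∃ f : Γ(D.L, U), Represents f φ := by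
  choose V e hV he hs using (-D).exists_generator
  -- The generator `e z` has the constant value `((-D).eqn z)⁻¹`; `c z` is the value of the
  -- functional on it.
  let c (z : U) : Γ(Y, V z ⊓ U) := φ.f (V z ⊓ U) inf_le_right (res _ inf_le_left (e z))
  have key (y z : U) (hz : z.1 ∈ V y) (W : Y.Opens) (h : W ≤ U) (s : Γ((-D).L, W)) (hw : z.1 ∈ W) :
      B.val (φ.f W h s) ⟨z.1, hw⟩ = fn s ⟨z.1, hw⟩ * (-D).eqn y * B.val (c y) ⟨z.1, hz, z.2⟩ := by
    have hw' : z.1 ∈ V y ⊓ W := ⟨hz, hw⟩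
    -- Near `z` the section `s` is a multiple `a e` of the generator at `y`, so the functional takes
    -- the value `a c` on it.
    obtain ⟨a, ha⟩ := hs y (V y ⊓ W) inf_le_left (res _ inf_le_right s)
    have e1 := φ.res_f h (inf_le_right : V y ⊓ W ≤ W) s
    rw [← ha, map_smul] at e1
    have e2 := φ.res_f (inf_le_right : V y ⊓ U ≤ U) (inf_le_inf_left _ h : V y ⊓ W ≤ V y ⊓ U) (res _ inf_le_left (e y))
    rw [res_res] at e2
    rw [e2] at e1
    have e3 := congrArg (fun b => B.val b ⟨z.1, hw'⟩) e1
    simp only [smul_eq_mul, B.val_mul, B.val_res] at e3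
    have e4 := congrArg (fun b => fn b ⟨z.1, hw'⟩) ha
    simp only [fn_smul, fn_res, he] at e4
    rw [← e3, ← e4, inv_mul_cancel_right₀ ((-D).eqn_ne _)]
  obtain ⟨f, hf⟩ := D.exists_fn (U := U) (fun z => (-D).eqn z.1 * B.val (c z) ⟨z.1, hV _, z.2⟩) (fun y => by
    refine ⟨V y, hV _, fun z hz => ?_⟩
    -- `key` is applied to the generator at `z`: dividing by its value identifies the quotient
    -- formed at `z` with the one formed at `y`.
    have h1 := key y z hz (V z ⊓ U) inf_le_right (res _ inf_le_left (e z)) ⟨hV _, z.2⟩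
    rw [fn_res, he] at h1
    change (-D).eqn z.1 * B.val (φ.f (V z ⊓ U) inf_le_right (res _ inf_le_left (e z))) _ = _
    rw [h1, mul_assoc, mul_inv_cancel_left₀ ((-D).eqn_ne _)]
    rw [B.val_const (c y)]) (fun y => by
    rw [eqn_neg, mul_comm, mul_inv_cancel_left₀ (D.eqn_ne _)]
    exact B.val_mem (c y) ⟨y.1, hV _, y.2⟩)
  refine ⟨f, fun W h s z => ?_⟩
  rw [hf, key ⟨z.1, h z.2⟩ ⟨z.1, h z.2⟩ (hV _) W h s z.2]
  ring

/-- The local equations of `D` and `-D` cancel, so the product is regular at every point. -/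
theorem exists_val_mul (f : Γ(D.L, U)) (s : Γ((-D).L, U)) : ∃ a : Γ(Y, U), ∀ z, B.val a z = fn f z * fn s z :=
  B.exists_val _ (fun y => by
    obtain ⟨V, hV, h⟩ := D.fn_loc f y
    obtain ⟨V', hV', h'⟩ := (-D).fn_loc s y
    exact ⟨V ⊓ V', ⟨hV, hV'⟩, fun z hz => by rw [h z hz.1, h' z hz.2]⟩) (fun y => by
    have h := mul_mem (D.fn_mem f y) ((-D).fn_mem s y)
    rw [eqn_neg] at h
    have e : fn f y * D.eqn y.1 * (fn s y * (D.eqn y.1)⁻¹) = fn f y * fn s y := by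
      field_simp [D.eqn_ne y.1]
    rwa [e] at h)

/-- The pairing `L(D) × L(-D) → O_Y`. -/
def pairing (f : Γ(D.L, U)) (s : Γ((-D).L, U)) : Γ(Y, U) := (D.exists_val_mul f s).choose

theorem val_pairing (f : Γ(D.L, U)) (s : Γ((-D).L, U)) (z : U) : B.val (D.pairing f s) z = fn f z * fn s z := (D.exists_val_mul f s).choose_spec z

end GDivisor
end divisors
end
end McKayTransform


/-! ### Characters and local functionals -/

namespace McKayTransform
noncomputable section
open GSheaf

/-- The values of a character are roots of unity of order dividing `|G|`. Finiteness makes the sum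
over all weight components meaningful. -/
theorem finite_char {n : ℕ} (G : Subgroup (Matrix.SpecialLinearGroup (Fin n) ℂ)) [Finite G] : Finite (Char G) := by
  have hpos : 0 < Nat.card G := Nat.card_pos
  have : NeZero (Nat.card G) := ⟨hpos.ne'⟩
  have hmem (χ : Char G) (g : G) : χ g ∈ rootsOfUnity (Nat.card G) ℂ := by
    rw [mem_rootsOfUnity, ← map_pow, pow_card_eq_one', map_one]
  refine Finite.of_injective (fun (χ : Char G) (g : G) => (⟨χ g, hmem χ g⟩ : rootsOfUnity (Nat.card G) ℂ)) fun χ χ' h => ?_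
  exact MonoidHom.ext fun g => congrArg Subtype.val (congrFun h g)

theorem char_inv_inv {n : ℕ} {G : Subgroup (Matrix.SpecialLinearGroup (Fin n) ℂ)} (a : Char G) : a⁻¹⁻¹ = a := by
  ext g; simp

theorem char_inv_mul_inv {n : ℕ} {G : Subgroup (Matrix.SpecialLinearGroup (Fin n) ℂ)} (a b : Char G) : (a⁻¹ * b⁻¹)⁻¹ = a * b := by
  ext g; simp [mul_comm]

theorem EigenBij.congr {G : Type} [Group G] {Y : Scheme.{0}} {E : GSheaf (GAct.triv G Y)} {p : Y ⟶ SpecC} {c c' : G →* ℂˣ} {N : Y.Modules} {q : E.M ⟶ N}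
    (h : c = c') (H : EigenBij E p c q) : EigenBij E p c' q := h ▸ H

/-- The restriction of a local functional along a morphism. -/
def LocDual.comp {Y : Scheme.{0}} {M N : Y.Modules} {U : Y.Opens} (φ : LocDual N U) (u : M ⟶ N) : LocDual M U where
  f V h := { toFun := fun s => φ.f V h (u.app V s), map_add' := fun s t => by rw [map_add, map_add],
             map_smul' := fun a s => by rw [Scheme.Modules.Hom.app_smul, map_smul]; rfl }
  res_f h h' m := by
    refine Eq.trans ?_ (φ.res_f h h' (u.app _ m))
    exact congrArg _ (app_res u h' m)

theorem LocDual.ext {Y : Scheme.{0}} {M : Y.Modules} {U : Y.Opens} {φ ψ : LocDual M U} (h : ∀ V hV s, φ.f V hV s = ψ.f V hV s) : φ = ψ := by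
  cases φ; cases ψ
  congr
  funext V hV
  exact LinearMap.ext (h V hV)

/-! ### Weights of a family and of its dual -/

section decomposition
variable {n : ℕ} {G : Subgroup (Matrix.SpecialLinearGroup (Fin n) ℂ)} {Y : Scheme.{0}} {p : Y ⟶ SpecC}

/-- The invertible constant `c - d` annihilates `s`. -/
theorem eq_zero_of_two_weights {M : Y.Modules} {U : Y.Opens} {s : Γ(M, U)} {c d : ℂ} (hcd : c ≠ d) (h : scal p U c • s = scal p U d • s) : s = 0 := by
  have h1 : scal p U (c - d) • s = 0 := by rw [map_sub, sub_smul, h, sub_self]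
  have h2 : scal p U ((c - d)⁻¹ * (c - d)) • s = 0 := by rw [map_mul, mul_smul, h1, smul_zero]
  rwa [inv_mul_cancel₀ (sub_ne_zero.2 hcd), map_one, one_smul] at h2

theorem exists_char_ne {χ χ' : Char G} (h : χ ≠ χ') : ∃ g, (((χ g)⁻¹ : ℂˣ) : ℂ) ≠ (((χ' g)⁻¹ : ℂˣ) : ℂ) := by
  by_contra! H
  exact h (MonoidHom.ext fun g => inv_injective (Units.ext (H g)))

variable [IsIntegral Y] {B : QuotMap G p} {x : EigenBasis G} {S : DivFamily B x} {F F' : GSheaf (prodAct G p)} (d : Decomp F S) (e : DualFamily F F')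

theorem Decomp.ext {U : Y.Opens} {s t : Γ((pushY F).M, U)} (h : ∀ χ, (d.pr χ).app U s = (d.pr χ).app U t) : s = t :=
  (d.bij U).1 (funext h)

/-- On this component each `g` acts by the values of both `χ⁻¹` and `χ'⁻¹`, and these differ for
some `g`. -/
theorem Decomp.pr_eigen_ne {χ χ' : Char G} (h : χ' ≠ χ) {U : Y.Opens} {s : Γ((pushY F).M, U)} (hs : IsEigen (pushY F) p χ⁻¹ U s) :
    (d.pr χ').app U s = 0 := by
  obtain ⟨g, hg⟩ := exists_char_ne h
  refine eq_zero_of_two_weights (p := p) hg ?_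
  rw [← d.pr_op, hs g]
  exact Scheme.Modules.Hom.app_smul _ _ _

theorem Decomp.exists_incl (χ : Char G) (U : Y.Opens) (t : Γ((-S.D χ).L, U)) :
    ∃ s : Γ((pushY F).M, U), (d.pr χ).app U s = t ∧ ∀ χ', χ' ≠ χ → (d.pr χ').app U s = 0 := by
  classical
  obtain ⟨s, hs⟩ := (d.bij U).2 fun χ' => if h : χ' = χ then h ▸ t else 0
  refine ⟨s, ?_, fun χ' h => ?_⟩
  · have := congrFun hs χ
    simpa using this
  · have := congrFun hs χ'
    simpa [h] using this

/-- The inclusion of `L(-D_χ)` in `π_{Y*} F` on sections. -/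
def Decomp.inclSec (χ : Char G) (U : Y.Opens) (t : Γ((-S.D χ).L, U)) : Γ((pushY F).M, U) := (d.exists_incl χ U t).choose

theorem Decomp.pr_inclSec (χ : Char G) (U : Y.Opens) (t : Γ((-S.D χ).L, U)) : (d.pr χ).app U (d.inclSec χ U t) = t := (d.exists_incl χ U t).choose_spec.1
theorem Decomp.pr_inclSec_ne {χ χ' : Char G} (h : χ' ≠ χ) (U : Y.Opens) (t : Γ((-S.D χ).L, U)) : (d.pr χ').app U (d.inclSec χ U t) = 0 :=
  (d.exists_incl χ U t).choose_spec.2 χ' h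

theorem Decomp.eq_inclSec {χ : Char G} {U : Y.Opens} {t : Γ((-S.D χ).L, U)} {s : Γ((pushY F).M, U)} (h : (d.pr χ).app U s = t)
    (h' : ∀ χ', χ' ≠ χ → (d.pr χ').app U s = 0) : s = d.inclSec χ U t := by
  refine d.ext fun χ' => ?_
  by_cases hχ : χ' = χ
  · subst hχ; rw [h, d.pr_inclSec]
  · rw [h' χ' hχ, d.pr_inclSec_ne hχ]

/-- The inclusion of `L(-D_χ)` in `π_{Y*} F`. -/
def Decomp.incl (χ : Char G) : (-S.D χ).L ⟶ (pushY F).M :=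
  mkHom (M := (-S.D χ).L) (N := (pushY F).M) (d.inclSec χ)
    (fun U s t => (d.eq_inclSec (by rw [map_add, d.pr_inclSec, d.pr_inclSec])
      (fun χ' h => by rw [map_add, d.pr_inclSec_ne h, d.pr_inclSec_ne h, add_zero])).symm)
    (fun U a s => (d.eq_inclSec (by rw [Scheme.Modules.Hom.app_smul, d.pr_inclSec])
      (fun χ' h => by rw [Scheme.Modules.Hom.app_smul, d.pr_inclSec_ne h, smul_zero])).symm)
    (fun {U V} h s => (d.eq_inclSec (by rw [app_res, d.pr_inclSec])
      (fun χ' hχ => by rw [app_res, d.pr_inclSec_ne hχ]; exact map_zero _)).symm)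

theorem Decomp.pr_incl (χ : Char G) (U : Y.Opens) (t : Γ((-S.D χ).L, U)) : (d.pr χ).app U ((d.incl χ).app U t) = t := d.pr_inclSec χ U t
theorem Decomp.pr_incl_ne {χ χ' : Char G} (h : χ' ≠ χ) (U : Y.Opens) (t : Γ((-S.D χ).L, U)) : (d.pr χ').app U ((d.incl χ).app U t) = 0 :=
  d.pr_inclSec_ne h U t
theorem Decomp.eq_incl {χ : Char G} {U : Y.Opens} {s : Γ((pushY F).M, U)} (h' : ∀ χ', χ' ≠ χ → (d.pr χ').app U s = 0) :
    s = (d.incl χ).app U ((d.pr χ).app U s) := d.eq_inclSec rfl h'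

theorem Decomp.incl_eigen (χ : Char G) (U : Y.Opens) (t : Γ((-S.D χ).L, U)) : IsEigen (pushY F) p χ⁻¹ U ((d.incl χ).app U t) := fun g => by
  refine d.ext fun χ' => ?_
  rw [d.pr_op, Scheme.Modules.Hom.app_smul]
  by_cases h : χ' = χ
  · subst h; rfl
  · rw [d.pr_incl_ne h, smul_zero, smul_zero]

/-- A section of weight `χ⁻¹` has no other components, so it is recovered from the one in `L(-D_χ)`.
-/
theorem Decomp.eigenBij (χ : Char G) : EigenBij (pushY F) p χ⁻¹ (d.pr χ) := fun U t => by
  refine ⟨(d.incl χ).app U t, ⟨d.incl_eigen χ U t, d.pr_incl χ U t⟩, ?_⟩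
  rintro s ⟨hs, rfl⟩
  exact d.eq_incl fun χ' h => d.pr_eigen_ne h hs

theorem Decomp.pr_mul {χ χ' : Char G} (i : Fin n) (h : χ' = x.κ i * χ) : (pushLin F).a (x.x i) ≫ d.pr χ = d.pr χ' ≫ S.mul i h := by
  subst h
  ext U s
  exact d.pr_x χ i U s

/-- The `ψ`-component of `x_i s` is `x_i` times the `κ(x_i) ψ`-component of `s`. If `s` is
concentrated at `κ(x_i) χ`, only `ψ = χ` survives. -/
theorem Decomp.mul_incl {χ χ' : Char G} (i : Fin n) (h : χ' = x.κ i * χ) (U : Y.Opens) (t : Γ((-S.D χ').L, U)) :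
    ((pushLin F).a (x.x i)).app U ((d.incl χ').app U t) = (d.incl χ).app U ((S.mul i h).app U t) := by
  have key (ψ : Char G) : (d.pr ψ).app U (((pushLin F).a (x.x i)).app U ((d.incl χ').app U t)) =
      (S.mul i rfl).app U ((d.pr (x.κ i * ψ)).app U ((d.incl χ').app U t)) := d.pr_x ψ i U _
  refine (d.eq_incl (χ := χ) fun ψ hψ => ?_).trans ?_
  · rw [key, d.pr_incl_ne, map_zero]
    rw [h]
    exact fun e => hψ (mul_left_cancel e)
  · congr 1
    subst h
    rw [key, d.pr_incl]

theorem Decomp.sum_incl [Fintype (Char G)] (U : Y.Opens) (s : Γ((pushY F).M, U)) : ∑ χ, (d.incl χ).app U ((d.pr χ).app U s) = s := by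
  classical
  refine d.ext fun χ => ?_
  rw [map_sum, Finset.sum_eq_single χ]
  · exact d.pr_incl χ U _
  · intro χ' _ h
    exact d.pr_incl_ne h.symm U _
  · simp

/-- The functional is restricted to the summand `L(-D_χ)` and represented there by multiplication.
-/
theorem DualFamily.exists_represents (χ : Char G) (U : Y.Opens) (t : Γ((pushY F').M, U)) :
    ∃ f : Γ((S.D χ).L, U), GDivisor.Represents f ((e.b U t).comp (d.incl χ)) := (S.D χ).exists_represents _

/-- The component in `L(D_χ)` of a section of the dual sheaf. -/
def DualFamily.prSec (χ : Char G) (U : Y.Opens) (t : Γ((pushY F').M, U)) : Γ((S.D χ).L, U) := (e.exists_represents d χ U t).choose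

theorem DualFamily.prSec_represents (χ : Char G) (U : Y.Opens) (t : Γ((pushY F').M, U)) :
    GDivisor.Represents (e.prSec d χ U t) ((e.b U t).comp (d.incl χ)) := (e.exists_represents d χ U t).choose_spec

theorem DualFamily.val_prSec (χ : Char G) (U : Y.Opens) (t : Γ((pushY F').M, U)) (V : Y.Opens) (h : V ≤ U) (s : Γ((-S.D χ).L, V)) (z : V) :
    B.val ((e.b U t).f V h ((d.incl χ).app V s)) z = GDivisor.fn (e.prSec d χ U t) ⟨z.1, h z.2⟩ * GDivisor.fn s z :=
  e.prSec_represents d χ U t V h s z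

theorem DualFamily.prSec_eq {χ : Char G} {U : Y.Opens} {t : Γ((pushY F').M, U)} {f : Γ((S.D χ).L, U)}
    (h : ∀ (V : Y.Opens) (h : V ≤ U) (s : Γ((-S.D χ).L, V)) (z : V), B.val ((e.b U t).f V h ((d.incl χ).app V s)) z = GDivisor.fn f ⟨z.1, h z.2⟩ * GDivisor.fn s z) :
    e.prSec d χ U t = f := (e.prSec_represents d χ U t).unique h

/-- The projection of the dual sheaf to `L(D_χ)`. -/
def DualFamily.pr (χ : Char G) : (pushY F').M ⟶ (S.D χ).L :=
  mkHom (M := (pushY F').M) (N := (S.D χ).L) (e.prSec d χ)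
    (fun U t t' => e.prSec_eq d fun V h s z => by rw [e.add, B.val_add, e.val_prSec, e.val_prSec, GDivisor.fn_add, add_mul])
    (fun U a t => e.prSec_eq d fun V h s z => by rw [e.smul, B.val_mul, e.val_prSec, GDivisor.fn_smul, B.val_res, mul_assoc])
    (fun {U V} h t => e.prSec_eq d fun W h' s z => by rw [e.res_b, e.val_prSec, GDivisor.fn_res])

theorem DualFamily.val_pr (χ : Char G) (U : Y.Opens) (t : Γ((pushY F').M, U)) (V : Y.Opens) (h : V ≤ U) (s : Γ((-S.D χ).L, V)) (z : V) :
    B.val ((e.b U t).f V h ((d.incl χ).app V s)) z = GDivisor.fn ((e.pr d χ).app U t) ⟨z.1, h z.2⟩ * GDivisor.fn s z := e.val_prSec d χ U t V h s z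

theorem DualFamily.pr_eq {χ : Char G} {U : Y.Opens} {t : Γ((pushY F').M, U)} {f : Γ((S.D χ).L, U)}
    (h : ∀ (V : Y.Opens) (h : V ≤ U) (s : Γ((-S.D χ).L, V)) (z : V), B.val ((e.b U t).f V h ((d.incl χ).app V s)) z = GDivisor.fn f ⟨z.1, h z.2⟩ * GDivisor.fn s z) :
    (e.pr d χ).app U t = f := e.prSec_eq d h

/-- On the dual, `x_i` acts by the transpose of its action on `π_{Y*} F`. Transposition reverses
`L(-D_{χ'}) → L(-D_χ)`, and since both pairings are products in `K(ℂ^n)`, the transpose is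
multiplication by `x_i` again. -/
theorem DualFamily.pr_mul {χ χ' : Char G} (i : Fin n) (h : χ' = x.κ i * χ) : (pushLin F').a (x.x i) ≫ e.pr d χ' = e.pr d χ ≫ S.mulDual i h := by
  ext U t
  refine e.pr_eq d fun V hV s z => ?_
  have h1 : (e.b U (((pushLin F').a (x.x i)).app U t)).f V hV ((d.incl χ').app V s) = (e.b U t).f V hV (((pushLin F).a (x.x i)).app V ((d.incl χ').app V s)) :=
    e.mul (linPoly (x.x i)) U V hV t _
  refine (congrArg (fun a => B.val a z) h1).trans ?_
  rw [d.mul_incl i h, e.val_pr]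
  change _ * (x.fn i * GDivisor.fn s z) = x.fn i * GDivisor.fn ((e.pr d χ).app U t) ⟨z.1, hV z.2⟩ * GDivisor.fn s z
  ring

theorem DualFamily.b_ext {U : Y.Opens} {t t' : Γ((pushY F').M, U)} (h : ∀ V hV s, (e.b U t).f V hV s = (e.b U t').f V hV s) : t = t' :=
  (e.bij U).1 (LocDual.ext h)

/-- Multiplication by a section of `L(D)` as a local functional on `L(-D)`. -/
def pairingDual (D : GDivisor B) {U : Y.Opens} (f : Γ(D.L, U)) : LocDual (-D).L U where
  f V h := { toFun := fun s => D.pairing (res _ h f) s,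
             map_add' := fun s t => B.val_ext fun z => by
               rw [B.val_add, D.val_pairing, D.val_pairing, D.val_pairing, GDivisor.fn_add, mul_add]
             map_smul' := fun a s => B.val_ext fun z => by
               rw [D.val_pairing, GDivisor.fn_smul, RingHom.id_apply, smul_eq_mul, B.val_mul, D.val_pairing, mul_left_comm] }
  res_f {V W} h h' m := B.val_ext fun z => by
    refine (D.val_pairing _ _ z).trans ?_
    rw [B.val_res]
    exact (D.val_pairing (res D.L h f) m ⟨z.1, h' z.2⟩).symm

theorem val_pairingDual (D : GDivisor B) {U : Y.Opens} (f : Γ(D.L, U)) (V : Y.Opens) (h : V ≤ U) (s : Γ((-D).L, V)) (z : V) :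
    B.val ((pairingDual D f).f V h s) z = GDivisor.fn f ⟨z.1, h z.2⟩ * GDivisor.fn s z := D.val_pairing _ _ z

/-- The pairing of the dual with `π_{Y*} F` is invariant, so a value on sections of weights `χ` and
`χ'⁻¹` can be non-zero only if `χ' = χ`. -/
theorem DualFamily.b_eigen_ne {χ χ' : Char G} (h : χ' ≠ χ) {U : Y.Opens} {t : Γ((pushY F').M, U)} (ht : IsEigen (pushY F') p χ U t)
    (V : Y.Opens) (hV : V ≤ U) (s : Γ((-S.D χ').L, V)) : (e.b U t).f V hV ((d.incl χ').app V s) = 0 := by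
  obtain ⟨g, hg⟩ := exists_char_ne h
  -- The inverse is taken so that `g` itself acts on the argument of the functional.
  have h1 := e.equiv g⁻¹ U V hV t ((d.incl χ').app V s)
  rw [ht, e.smul, inv_inv, d.incl_eigen, map_smul, scal_res] at h1
  have h2 : scal p V (((χ' g)⁻¹ : ℂˣ) : ℂ) * (e.b U t).f V hV ((d.incl χ').app V s) = scal p V (((χ g)⁻¹ : ℂˣ) : ℂ) * (e.b U t).f V hV ((d.incl χ').app V s) := by
    rw [map_inv] at h1
    exact h1.symm
  have h3 : scal p V ((((χ' g)⁻¹ : ℂˣ) : ℂ) - (((χ g)⁻¹ : ℂˣ) : ℂ)) * (e.b U t).f V hV ((d.incl χ').app V s) = 0 := by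
    rw [map_sub, sub_mul, h2, sub_self]
  have h4 := congrArg (fun a => scal p V ((((χ' g)⁻¹ : ℂˣ) : ℂ) - (((χ g)⁻¹ : ℂˣ) : ℂ))⁻¹ * a) h3
  simp only [mul_zero] at h4
  rwa [← mul_assoc, ← map_mul, inv_mul_cancel₀ (sub_ne_zero.2 hg), map_one, one_mul] at h4

/-- A section `f` of `L(D_χ)` gives the functional that multiplies by `f` on `L(-D_χ)` and vanishes
on the other summands; it has weight `χ` because `G` acts on `L(-D_χ)` by `χ⁻¹`. Conversely, a
functional of weight `χ` vanishes on the other summands and is determined by its component. -/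
theorem DualFamily.eigenBij [Finite G] (χ : Char G) : EigenBij (pushY F') p χ (e.pr d χ) := fun U f => by
  obtain ⟨t, ht⟩ := (e.bij U).2 ((pairingDual (S.D χ) f).comp (d.pr χ))
  have hb (V hV s) : (e.b U t).f V hV s = (pairingDual (S.D χ) f).f V hV ((d.pr χ).app V s) := by rw [ht]; rfl
  refine ⟨t, ⟨fun g => e.b_ext fun V hV s => ?_, e.pr_eq d fun V hV s z => ?_⟩, ?_⟩
  · rw [e.equiv, e.smul, hb, hb, d.pr_op, map_smul, scal_res, map_inv, inv_inv]
    rfl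
  · rw [hb, d.pr_incl, val_pairingDual]
  · rintro t' ⟨ht', rfl⟩
    refine e.b_ext fun V hV s => ?_
    have := finite_char G
    have := Fintype.ofFinite (Char G)
    -- The argument is split into its finitely many weight components, which are compared one by
    -- one.
    rw [← d.sum_incl V s, map_sum, map_sum]
    refine Finset.sum_congr rfl fun χ' _ => ?_
    by_cases h : χ' = χ
    · subst h
      refine B.val_ext fun z => ?_
      rw [e.val_pr, hb, d.pr_incl, val_pairingDual]
    · rw [e.b_eigen_ne d h ht', hb, d.pr_incl_ne (Ne.symm h), map_zero]

end decomposition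
end
end McKayTransform


/-! ### The four assertions -/

open McKayTransform in
theorem proposition2p2 :
    -- for an arbitrary finite group: the transform is the invariant part of the Koszul-type complex
    (∀ (n : ℕ) (G : Subgroup (Matrix.SpecialLinearGroup (Fin n) ℂ)) [Finite G]
      (Y : Scheme.{0}) (p : Y ⟶ SpecC) [SmoothOfRelativeDimension n p] [IsSeparated p] [QuasiCompact p]
      (F : GSheaf (prodAct G p)) [F.M.IsQuasicoherent]
      (W : Type) [AddCommGroup W] [Module ℂ W] [Module.Finite ℂ W] (ρ : Representation ℂ G W),
      Nonempty (Psi G p F (originRep G ρ) ≅ toD (pointComplex F ρ))) ∧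
    -- abelian groups: the total complex of the cube of the line bundles `L(-D_{κ(e) χ})`
    (∀ (n : ℕ) (G : Subgroup (Matrix.SpecialLinearGroup (Fin n) ℂ)) [Finite G] (_ : ∀ g h : G, g * h = h * g)
      (Y : Scheme.{0}) (p : Y ⟶ SpecC) [SmoothOfRelativeDimension n p] [IsSeparated p] [QuasiCompact p] [IsIntegral Y]
      (B : QuotMap G p) (x : EigenBasis G) (S : DivFamily B x)
      (F : GSheaf (prodAct G p)) [F.M.IsQuasicoherent] (_ : Decomp F S) (χ : Char G),
      (∀ v, IsLineBundle ((S.cube χ).obj v)) ∧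
      Nonempty (Psi G p F (originRep G (charRep χ)) ≅
        toD ((S.cube χ).skewify.total (S.cube_comm χ).skewify))) ∧
    -- abelian groups, dual family: the total complex of the cube of the line bundles `L(D_{κ(e)⁻¹ χ⁻¹})`
    (∀ (n : ℕ) (G : Subgroup (Matrix.SpecialLinearGroup (Fin n) ℂ)) [Finite G] (_ : ∀ g h : G, g * h = h * g)
      (Y : Scheme.{0}) (p : Y ⟶ SpecC) [SmoothOfRelativeDimension n p] [IsSeparated p] [QuasiCompact p] [IsIntegral Y]
      (B : QuotMap G p) (x : EigenBasis G) (S : DivFamily B x)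
      (F F' : GSheaf (prodAct G p)) [F.M.IsQuasicoherent] [F'.M.IsQuasicoherent]
      (_ : Decomp F S) (_ : DualFamily F F') (χ : Char G),
      (∀ v, IsLineBundle ((S.dualCube χ).obj v)) ∧
      Nonempty (Psi G p F' (originRep G (charRep χ)) ≅
        toD ((S.dualCube χ).skewify.total (S.dualCube_comm χ).skewify))) ∧
    -- abelian subgroups of `SL_3`: the cube of line bundles is the one coming from `hex(χ⁻¹)`
    (∀ (G : Subgroup (Matrix.SpecialLinearGroup (Fin 3) ℂ)) [Finite G] (_ : ∀ g h : G, g * h = h * g)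
      (Y : Scheme.{0}) (p : Y ⟶ SpecC) [SmoothOfRelativeDimension 3 p] [IsSeparated p] [QuasiCompact p] [IsIntegral Y]
      (B : QuotMap G p) (x : EigenBasis G) (S : DivFamily B x)
      (F : GSheaf (prodAct G p)) [F.M.IsQuasicoherent] (_ : Decomp F S) (χ : Char G),
      (∀ v, IsLineBundle ((S.assocRep.hex χ⁻¹).obj v)) ∧
      Nonempty (Psi G p F (originRep G (charRep χ)) ≅
        toD ((S.assocRep.hex χ⁻¹).skewify.total (S.hex_comm χ⁻¹).skewify))) := by
  refine ⟨?_, ?_, ?_, ?_⟩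
  · intro n G _ Y p _ _ _ F _ W _ _ _ ρ
    exact Psi_iso_pointComplex F ρ
  · intro n G _ _ Y p _ _ _ _ B x S F _ d χ
    refine ⟨fun v => GDivisor.isLineBundle _, ?_⟩
    obtain ⟨e⟩ := Psi_iso_pointComplex F (charRep χ)
    -- The coordinate at `v` has to be of weight `(κ(v) χ)⁻¹`, which is the weight of `L(-D_{κ(v)
    -- χ})`.
    exact ⟨e ≪≫ toDIso (pointComplexIso F x χ (fun v => x.wt v * χ) (fun _ => rfl) (S.cube χ) (fun v => d.pr (x.wt v * χ))
      (fun v => d.eigenBij _) (fun {w v i} h => d.pr_mul i (x.wt_edge_mul h χ)) _)⟩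
  · intro n G _ _ Y p _ _ _ _ B x S F F' _ _ d e χ
    refine ⟨fun v => GDivisor.isLineBundle _, ?_⟩
    obtain ⟨ε⟩ := Psi_iso_pointComplex F' (charRep χ)
    -- The character `κ(v) χ` is written as the inverse of `ψ = κ(v)⁻¹ χ⁻¹`, because `G` acts on the
    -- summand `L(D_ψ)` of the dual by `ψ` itself.
    exact ⟨ε ≪≫ toDIso (pointComplexIso F' x χ (fun v => ((x.wt v)⁻¹ * χ⁻¹)⁻¹) (fun v => char_inv_mul_inv _ _) (S.dualCube χ)
      (fun v => e.pr d ((x.wt v)⁻¹ * χ⁻¹)) (fun v => (e.eigenBij d _).congr (char_inv_inv _).symm)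
      (fun {w v i} h => e.pr_mul d i (x.wt_edge_inv h χ⁻¹)) _)⟩
  · intro G _ _ Y p _ _ _ _ B x S F _ d χ
    refine ⟨fun v => GDivisor.isLineBundle _, ?_⟩
    obtain ⟨e⟩ := Psi_iso_pointComplex F (charRep χ)
    -- At the vertex `ψ = κ(v)⁻¹ χ⁻¹` of the hexagon stands `L(-D_{ψ⁻¹})`, and `ψ⁻¹ = κ(v) χ` is
    -- again the character required of the coordinate at `v`.
    exact ⟨e ≪≫ toDIso (pointComplexIso F x χ (fun v => ((x.wt v)⁻¹ * χ⁻¹)⁻¹) (fun v => char_inv_mul_inv _ _) (S.assocRep.hex χ⁻¹)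
      (fun v => d.pr ((x.wt v)⁻¹ * χ⁻¹)⁻¹) (fun v => d.eigenBij _) (fun {w v i} h => d.pr_mul i (char_inv (x.wt_edge_inv h χ⁻¹))) _)⟩
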